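/- Let $k$ be a field. A dg category is a category enriched in cochain complexes of $k$-vector spaces, and a dg algebra is a dg category with one object; all modules are right dg modules. For a dg category $\mathcal C$ let $\mathcal D(\mathcal C)$ be its derived (dg) category of right modules, and let $\mathcal D_{\mathrm{fd}}(\mathcal C)\subseteq\mathcal D(\mathcal C)$ be the full dg subcategory of perfectly valued modules, i.e. of those $N$ such that $\bigoplus_n H^n(N(c))$ is finite dimensional over $k$ for every object $c$. A module $S$ is a \emph{$\mathcal D_{\mathrm{fd}}$-generator} for $\mathcal C$ if $\mathbf{thick}_{\mathcal D(\mathcal C)}(S)=\mathcal D_{\mathrm{fd}}(\mathcal C)$. A dg category $\mathcal C$ is \emph{reflexive} if the natural functor $$\mathrm{ev}\colon \mathcal C^{\mathrm{op}}\to \mathcal D_{\mathrm{fd}}\big(\mathcal D_{\mathrm{fd}}(\mathcal C)^{\mathrm{op}}\big),\qquad c\mapsto (N\mapsto N(c)),$$ is a Morita equivalence, i.e. it is quasi-fully faithful and its image generates the target under shifts, cones and direct summands. For a dg algebra $A$ and an $A$-module $M$ put $A^!_M:=\mathbb R\mathrm{End}_A(M)^{\mathrm{op}}$. Then $M$ is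 naturally a right $A^!_M$-module; put $A^{!!}_M:=(A^!_M)^!_M=\mathbb R\mathrm{End}_{A^!_M}(M)^{\mathrm{op}}$. The action of $A$ on $M$ induces the derived completion map $A\to A^{!!}_M$, and $A$ is \emph{derived complete with respect to $M$} if this map is a quasi-isomorphism. \textbf{Theorem (two-out-of-three).} Let $A$ be a dg algebra over $k$ and let $M$ be a $\mathcal D_{\mathrm{fd}}$-generator for $A$. If any two of the following conditions hold, then so does the third: \begin{enumerate} \item $A$ is reflexive; \item $M$ is a $\mathcal D_{\mathrm{fd}}$-generator for $A^!_M$; \item $A$ is derived complete with respect to $M$. \end{enumerate} -/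

import Mathlib

open CategoryTheory CochainComplex.HomComplex

universe v u u₁ u₂ u₃ u₄ w

noncomputable section

/-! ### Signs -/

theorem lin_units_smul {R V W : Type*} [Ring R] [AddCommGroup V] [AddCommGroup W] [Module R V]
    [Module R W] (f : V →ₗ[R] W) (u : ℤˣ) (x : V) : f (u • x) = u • f x := by
  rw [Units.smul_def, map_zsmul, Units.smul_def]

theorem lin_units_smul₂ {R V W U : Type*} [CommRing R] [AddCommGroup V] [AddCommGroup W]
    [AddCommGroup U] [Module R V] [Module R W] [Module R U] (f : V →ₗ[R] W →ₗ[R] U) (u : ℤˣ)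
    (x : V) (y : W) : f (u • x) y = u • f x y := by
  rcases Int.units_eq_one_or u with rfl | rfl <;> simp

theorem hom_units_smul {R : Type*} [CommRing R] {V W : ModuleCat R} (f : V ⟶ W) (u : ℤˣ) (x : V) :
    (u • f).hom x = u • f.hom x := by
  rcases Int.units_eq_one_or u with rfl | rfl <;> simp

theorem negOnePow_congr {a b : ℤ} (h : Even (a - b)) : a.negOnePow = b.negOnePow :=
  (Int.negOnePow_eq_iff a b).2 h

/-! ### Differential graded categories -/

/-- A (small) dg category over `k`: a category enriched in cochain complexes of `k`-vector spaces.
Composition is written in function order, `comp h g f` being `g ∘ f`. -/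
structure DGCat (k : Type v) [Field k] where
  /-- the objects -/
  Obj : Type u₁
  /-- the complexes of morphisms -/
  Hom : Obj → Obj → CochainComplex (ModuleCat.{u₂} k) ℤ
  /-- the identities -/
  id : ∀ X : Obj, (Hom X X).X 0
  /-- the bilinear composition of a morphism of degree `q` after one of degree `p` -/
  comp : ∀ {X Y Z : Obj} {q p n : ℤ}, q + p = n →
    ((Hom Y Z).X q →ₗ[k] (Hom X Y).X p →ₗ[k] (Hom X Z).X n)
  id_comp : ∀ {X Y : Obj} {p : ℤ} (f : (Hom X Y).X p), comp (zero_add p) (id Y) f = f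
  comp_id : ∀ {X Y : Obj} {p : ℤ} (f : (Hom X Y).X p), comp (add_zero p) f (id X) = f
  assoc : ∀ {W X Y Z : Obj} {r q p rq qp n : ℤ} (h₁ : r + q = rq) (h₂ : rq + p = n)
    (h₃ : q + p = qp) (h₄ : r + qp = n)
    (e : (Hom Y Z).X r) (g : (Hom X Y).X q) (f : (Hom W X).X p),
    comp h₂ (comp h₁ e g) f = comp h₄ e (comp h₃ g f)
  /-- the graded Leibniz rule -/
  d_comp : ∀ {X Y Z : Obj} {q p n : ℤ} (h : q + p = n)
    (g : (Hom Y Z).X q) (f : (Hom X Y).X p),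
    ((Hom X Z).d n (n + 1)).hom (comp h g f) =
      comp (by omega) (((Hom Y Z).d q (q + 1)).hom g) f +
        q.negOnePow • comp (by omega) g (((Hom X Y).d p (p + 1)).hom f)

variable {k : Type v} [Field k]

namespace DGCat

/-- The opposite dg category, with `g ∘ᵒᵖ f = (-1)^{|g||f|} f ∘ g`. -/
def op (C : DGCat.{v, u₁, u₂} k) : DGCat.{v, u₁, u₂} k where
  Obj := C.Obj
  Hom X Y := C.Hom Y X
  id X := C.id X
  comp {X Y Z q p n} h := LinearMap.mk₂ k
    (fun g f => (q * p).negOnePow • C.comp (show p + q = n by omega) f g)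
    (by intros; rw [map_add, smul_add])
    (by intros; rw [map_smul, smul_comm])
    (by intros; rw [map_add, LinearMap.add_apply, smul_add])
    (by intros; rw [map_smul, LinearMap.smul_apply, smul_comm])
  id_comp f := by simp [C.comp_id]
  comp_id f := by simp [C.id_comp]
  assoc := by
    intro W X Y Z r q p rq qp n h₁ h₂ h₃ h₄ e g f
    change (rq * p).negOnePow • C.comp _ f ((r * q).negOnePow • C.comp _ g e) =
      (r * qp).negOnePow • C.comp _ ((q * p).negOnePow • C.comp _ f g) e
    rw [lin_units_smul, lin_units_smul₂, smul_smul, smul_smul, ← Int.negOnePow_add,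
      ← Int.negOnePow_add,
      C.assoc (show p + q = qp by omega) (by omega) (show q + r = rq by omega) (by omega)]
    congr 1
    apply negOnePow_congr
    subst h₁ h₃
    exact ⟨0, by ring⟩
  d_comp := by
    intro X Y Z q p n h g f
    simp only [LinearMap.mk₂_apply, lin_units_smul, smul_smul, ← Int.negOnePow_add]
    rw [C.d_comp, smul_add, smul_smul, ← Int.negOnePow_add,
      negOnePow_congr (show Even ((q * p + p) - (q + 1) * p) from ⟨0, by ring⟩),
      negOnePow_congr (show Even (q * p - (q + q * (p + 1))) from ⟨-q, by ring⟩)]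
    exact add_comm _ _

/-- The full dg subcategory of `C` on a family of objects. -/
def full (C : DGCat.{v, u₁, u₂} k) {ι : Type u₃} (φ : ι → C.Obj) : DGCat.{v, u₃, u₂} k where
  Obj := ι
  Hom i j := C.Hom (φ i) (φ j)
  id i := C.id (φ i)
  comp h := C.comp h
  id_comp := C.id_comp
  comp_id := C.comp_id
  assoc := C.assoc
  d_comp := C.d_comp

end DGCat

/-! ### Right dg modules -/

/-- A right dg module over a dg category `C`: a complex `obj X` for every object `X` of `C`, with a
right action of the morphisms of `C` (a dg functor from `Cᵒᵖ` to complexes). -/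
structure DGModule (C : DGCat.{v, u₁, u₂} k) where
  /-- the complexes -/
  obj : C.Obj → CochainComplex (ModuleCat.{w} k) ℤ
  /-- the bilinear action: `act h m x` is `m · x` -/
  act : ∀ {X Y : C.Obj} {q p n : ℤ}, q + p = n →
    ((obj Y).X q →ₗ[k] (C.Hom X Y).X p →ₗ[k] (obj X).X n)
  act_id : ∀ {X : C.Obj} {q : ℤ} (m : (obj X).X q), act (add_zero q) m (C.id X) = m
  act_act : ∀ {X Y Z : C.Obj} {r q p rq qp n : ℤ} (h₁ : r + q = rq) (h₂ : rq + p = n)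
    (h₃ : q + p = qp) (h₄ : r + qp = n)
    (m : (obj Z).X r) (y : (C.Hom Y Z).X q) (x : (C.Hom X Y).X p),
    act h₂ (act h₁ m y) x = act h₄ m (C.comp h₃ y x)
  /-- the graded Leibniz rule -/
  d_act : ∀ {X Y : C.Obj} {q p n : ℤ} (h : q + p = n)
    (m : (obj Y).X q) (x : (C.Hom X Y).X p),
    ((obj X).d n (n + 1)).hom (act h m x) =
      act (by omega) (((obj Y).d q (q + 1)).hom m) x +
        q.negOnePow • act (by omega) m (((C.Hom X Y).d p (p + 1)).hom x)

namespace DGModule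

variable {C : DGCat.{v, u₁, u₂} k}

/-- The degree `n` morphisms of graded modules `M → N`: families of `k`-linear maps of degree `n`
commuting with the right action. -/
def homSubmodule (M N : DGModule.{v, u₁, u₂, w} C) (n : ℤ) :
    Submodule k (∀ X : C.Obj, Cochain (M.obj X) (N.obj X) n) where
  carrier := {f | ∀ (X Y : C.Obj) (q p i q' j : ℤ) (h : q + p = i) (h₁ : q + n = q')
    (h₂ : i + n = j) (m : (M.obj Y).X q) (x : (C.Hom X Y).X p),
    ((f X).v i j h₂).hom (M.act h m x) =
      N.act (show q' + p = j by omega) (((f Y).v q q' h₁).hom m) x}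
  zero_mem' := by
    intro X Y q p i q' j h h₁ h₂ m x
    simp
  add_mem' := by
    intro f g hf hg X Y q p i q' j h h₁ h₂ m x
    simp [hf X Y q p i q' j h h₁ h₂ m x, hg X Y q p i q' j h h₁ h₂ m x]
  smul_mem' := by
    intro a f hf X Y q p i q' j h h₁ h₂ m x
    simp [hf X Y q p i q' j h h₁ h₂ m x]

theorem d_act' (M : DGModule.{v, u₁, u₂, w} C) {X Y : C.Obj} {q p n q' p' n' : ℤ} (h : q + p = n)
    (hq : q + 1 = q') (hp : p + 1 = p') (hn : n + 1 = n')
    (m : (M.obj Y).X q) (x : (C.Hom X Y).X p) :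
    ((M.obj X).d n n').hom (M.act h m x) =
      M.act (by omega) (((M.obj Y).d q q').hom m) x +
        q.negOnePow • M.act (by omega) m (((C.Hom X Y).d p p').hom x) := by
  subst hq hp hn
  exact M.d_act h m x

theorem δ_mem (M N : DGModule.{v, u₁, u₂, w} C) (n n' : ℤ)
    (f : ∀ X : C.Obj, Cochain (M.obj X) (N.obj X) n) (hf : f ∈ homSubmodule M N n) :
    (fun X => δ n n' (f X)) ∈ homSubmodule M N n' := by
  by_cases hn : n + 1 = n'
  swap
  · have : (fun X => δ n n' (f X)) = 0 := by
      funext X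
      exact δ_shape n n' hn (f X)
    rw [this]
    exact zero_mem _
  subst hn
  intro X Y q p i q' j h h₁ h₂ m x
  have e₁ := hf X Y q p i (q + n) (i + n) h rfl rfl m x
  have e₂ := hf X Y (q + 1) p (i + 1) q' j (by omega) (by omega) (by omega)
    (((M.obj Y).d q (q + 1)).hom m) x
  have e₃ := hf X Y q (p + 1) (i + 1) (q + n) j (by omega) (by omega) (by omega) m
    (((C.Hom X Y).d p (p + 1)).hom x)
  rw [δ_v n (n + 1) rfl (f X) i j h₂ (i + n) (i + 1) (by omega) rfl,
    δ_v n (n + 1) rfl (f Y) q q' h₁ (q + n) (q + 1) (by omega) rfl]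
  simp only [ModuleCat.hom_add, ModuleCat.hom_comp, hom_units_smul, LinearMap.add_apply,
    LinearMap.comp_apply, map_add, lin_units_smul₂]
  rw [e₁, N.d_act' (show q + n + p = i + n by omega) (show q + n + 1 = q' by omega) rfl
    (show i + n + 1 = j by omega), M.d_act h, map_add, lin_units_smul, e₂, e₃, smul_add, smul_smul,
    ← Int.negOnePow_add, show (q + n).negOnePow = -(n + 1 + q).negOnePow by
      rw [← Int.negOnePow_succ]; exact negOnePow_congr ⟨-1, by ring⟩, Units.neg_smul]
  abel

/-- The complex `Hom_C(M, N)`, with differential `f ↦ d ∘ f - (-1)^{|f|} f ∘ d`. -/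
def homComplex (M N : DGModule.{v, u₁, u₂, w} C) :
    CochainComplex (ModuleCat.{max u₁ w} k) ℤ where
  X n := ModuleCat.of k (homSubmodule M N n)
  d n n' := ModuleCat.ofHom
    ((LinearMap.pi fun X => (δ_hom k (M.obj X) (N.obj X) n n').comp (LinearMap.proj X)).restrict
      (fun f hf => δ_mem M N n n' f hf))
  shape n n' h := ModuleCat.hom_ext (LinearMap.ext fun f => Subtype.ext (funext fun X =>
    δ_shape n n' h (f.1 X)))
  d_comp_d' i j l _ _ := ModuleCat.hom_ext (LinearMap.ext fun f => Subtype.ext (funext fun X =>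
    δ_δ i j l (f.1 X)))

/-- The composition `g ∘ f` of morphisms of graded modules. -/
def homComp {M N P : DGModule.{v, u₁, u₂, w} C} {q p n : ℤ} (h : q + p = n) :
    homSubmodule N P q →ₗ[k] homSubmodule M N p →ₗ[k] homSubmodule M P n :=
  LinearMap.mk₂ k
    (fun g f => ⟨fun X => (f.1 X).comp (g.1 X) (show p + q = n by omega), by
      intro X Y r s i r' j h₀ h₁ h₂ m x
      rw [Cochain.comp_v _ _ _ i (i + p) j rfl (by omega),
        Cochain.comp_v _ _ _ r (r + p) r' rfl (by omega)]
      simp only [ModuleCat.hom_comp, LinearMap.comp_apply]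
      rw [f.2 X Y r s i (r + p) (i + p) h₀ rfl rfl m x,
        g.2 X Y (r + p) s (i + p) r' j (by omega) (by omega) (by omega)]⟩)
    (fun _ _ _ => Subtype.ext (funext fun _ => Cochain.comp_add _ _ _ (by omega)))
    (fun _ _ _ => Subtype.ext (funext fun _ => Cochain.comp_smul _ _ _ (by omega)))
    (fun _ _ _ => Subtype.ext (funext fun _ => Cochain.add_comp _ _ _ (by omega)))
    (fun _ _ _ => Subtype.ext (funext fun _ => Cochain.smul_comp _ _ _ (by omega)))

/-- The identity of a dg module. -/
def homId (M : DGModule.{v, u₁, u₂, w} C) : homSubmodule M M 0 :=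
  ⟨fun X => Cochain.ofHom (𝟙 (M.obj X)), by
    intro X Y q p i q' j h h₁ h₂ m x
    obtain rfl : q = q' := by omega
    obtain rfl : i = j := by omega
    simp⟩

variable (C) in
/-- The dg category of right dg modules over `C`. -/
def dgCat : DGCat.{v, max u₁ u₂ v (w + 1), max u₁ w} k where
  Obj := DGModule.{v, u₁, u₂, w} C
  Hom M N := homComplex M N
  id M := homId M
  comp h := homComp h
  id_comp f := Subtype.ext (funext fun X => Cochain.comp_id (f.1 X))
  comp_id f := Subtype.ext (funext fun X => Cochain.id_comp (f.1 X))
  assoc {M N P Q r q p rq qp n} h₁ h₂ h₃ h₄ e g f := Subtype.ext (funext fun X =>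
    (Cochain.comp_assoc (f.1 X) (g.1 X) (e.1 X) (show p + q = qp by omega)
      (show q + r = rq by omega) (by omega)).symm)
  d_comp {M N P q p n} h g f := Subtype.ext (funext fun X =>
    δ_comp (f.1 X) (g.1 X) (show p + q = n by omega) (p + 1) (q + 1) (n + 1) rfl rfl rfl)

/-! ### Morphisms, shifts and cones of dg modules -/

/-- Morphisms of dg modules: closed morphisms of degree `0`, that is, families of chain maps
commuting with the action. -/
structure Morphism (M N : DGModule.{v, u₁, u₂, w} C) where
  /-- the chain maps -/
  app : ∀ X : C.Obj, M.obj X ⟶ N.obj X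
  app_act : ∀ {X Y : C.Obj} {q p n : ℤ} (h : q + p = n) (m : (M.obj Y).X q)
    (x : (C.Hom X Y).X p),
    ((app X).f n).hom (M.act h m x) = N.act h (((app Y).f q).hom m) x

/-- The element of degree `0` of `Hom_C(M, N)` given by a morphism. -/
def Morphism.toHom {M N : DGModule.{v, u₁, u₂, w} C} (f : Morphism M N) : homSubmodule M N 0 :=
  ⟨fun X => Cochain.ofHom (f.app X), by
    intro X Y q p i q' j h h₁ h₂ m x
    obtain rfl : q = q' := by omega
    obtain rfl : i = j := by omega
    simp [f.app_act]⟩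

/-- A quasi-isomorphism of dg modules. -/
def Morphism.IsQuasiIso {M N : DGModule.{v, u₁, u₂, w} C} (f : Morphism M N) : Prop :=
  ∀ X : C.Obj, QuasiIso (f.app X)

/-- The shift `M[a]`, with `M[a]^i = M^{i+a}` and differential `(-1)^a d`. -/
def shift (M : DGModule.{v, u₁, u₂, w} C) (a : ℤ) : DGModule.{v, u₁, u₂, w} C where
  obj X := (CochainComplex.shiftFunctor (ModuleCat k) a).obj (M.obj X)
  act {X Y q p n} h := M.act (show q + a + p = n + a by omega)
  act_id m := M.act_id m
  act_act h₁ h₂ h₃ h₄ m y x := M.act_act _ _ _ (by omega) m y x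
  d_act {X Y q p n} h m x := by
    change (M.obj Y).X (q + a) at m
    change (a.negOnePow • (M.obj X).d (n + a) (n + 1 + a)).hom
        (M.act (show q + a + p = n + a by omega) m x) =
      M.act (show q + 1 + a + p = n + 1 + a by omega)
        ((a.negOnePow • (M.obj Y).d (q + a) (q + 1 + a)).hom m) x +
      q.negOnePow • M.act (show q + a + (p + 1) = n + 1 + a by omega) m
        (((C.Hom X Y).d p (p + 1)).hom x)
    rw [hom_units_smul, hom_units_smul]
    rw [M.d_act' (show q + a + p = n + a by omega) (show q + a + 1 = q + 1 + a by omega) rfl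
      (show n + a + 1 = n + 1 + a by omega), smul_add, lin_units_smul₂, smul_smul,
      ← Int.negOnePow_add, negOnePow_congr (show Even (a + (q + a) - q) from ⟨a, by ring⟩)]

section ConeLemmas

open CochainComplex.mappingCone

variable {K L : CochainComplex (ModuleCat.{w} k) ℤ} (g : K ⟶ L)

theorem cone_fst_inl {i j : ℤ} (h : j + (-1) = i) (h' : i + 1 = j) (x : K.X j) :
    ((fst g).1.v i j h').hom (((inl g).v j i h).hom x) = x :=
  congrArg (fun f => f.hom x) (inl_v_fst_v g j i h')

theorem cone_snd_inl {i j : ℤ} (h : j + (-1) = i) (h' : i + 0 = i) (x : K.X j) :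
    ((snd g).v i i h').hom (((inl g).v j i h).hom x) = 0 :=
  congrArg (fun f => f.hom x) (inl_v_snd_v g j i h)

theorem cone_fst_inr {i j : ℤ} (h' : i + 1 = j) (x : L.X i) :
    ((fst g).1.v i j h').hom (((inr g).f i).hom x) = 0 :=
  congrArg (fun f => f.hom x) (inr_f_fst_v g i j h')

theorem cone_snd_inr {i : ℤ} (h' : i + 0 = i) (x : L.X i) :
    ((snd g).v i i h').hom (((inr g).f i).hom x) = x :=
  congrArg (fun f => f.hom x) (inr_f_snd_v g i)

theorem cone_fst_d {i j l : ℤ} (h : i + 1 = j) (h' : j + 1 = l)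
    (x : (CochainComplex.mappingCone g).X i) :
    ((fst g).1.v j l h').hom (((CochainComplex.mappingCone g).d i j).hom x) =
      -(K.d j l).hom (((fst g).1.v i j h).hom x) :=
  congrArg (fun f => f.hom x) (d_fst_v g i j l h h')

theorem cone_snd_d {i j : ℤ} (h : i + 1 = j) (h₀ : i + 0 = i) (h₁ : j + 0 = j)
    (x : (CochainComplex.mappingCone g).X i) :
    ((snd g).v j j h₁).hom (((CochainComplex.mappingCone g).d i j).hom x) =
      (g.f j).hom (((fst g).1.v i j h).hom x) + (L.d i j).hom (((snd g).v i i h₀).hom x) :=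
  congrArg (fun f => f.hom x) (d_snd_v g i j h)

theorem cone_ext {i j : ℤ} (h : i + 1 = j) {x y : (CochainComplex.mappingCone g).X i}
    (h₁ : ((fst g).1.v i j h).hom x = ((fst g).1.v i j h).hom y)
    (h₂ : ((snd g).v i i (add_zero i)).hom x = ((snd g).v i i (add_zero i)).hom y) : x = y := by
  have e := fun z => congrArg (fun f => f.hom z) (id_X g i j h)
  have e₁ := e x
  have e₂ := e y
  simp only [ModuleCat.hom_add, ModuleCat.hom_comp, LinearMap.add_apply, LinearMap.comp_apply,
    ModuleCat.hom_id, LinearMap.id_apply] at e₁ e₂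
  rw [← e₁, ← e₂, h₁, h₂]

end ConeLemmas

/-- The action on the mapping cone of a morphism. -/
def coneAct {M N : DGModule.{v, u₁, u₂, w} C} (f : Morphism M N) {X Y : C.Obj} {q p n : ℤ}
    (h : q + p = n) : (CochainComplex.mappingCone (f.app Y)).X q →ₗ[k] (C.Hom X Y).X p →ₗ[k]
      (CochainComplex.mappingCone (f.app X)).X n :=
  LinearMap.mk₂ k
    (fun m x =>
      ((CochainComplex.mappingCone.inl (f.app X)).v (n + 1) n (by omega)).hom
        (M.act (show q + 1 + p = n + 1 by omega)
          (((CochainComplex.mappingCone.fst (f.app Y)).1.v q (q + 1) rfl).hom m) x) +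
      ((CochainComplex.mappingCone.inr (f.app X)).f n).hom
        (N.act h (((CochainComplex.mappingCone.snd (f.app Y)).v q q (add_zero q)).hom m) x))
    (by intros; simp only [map_add, LinearMap.add_apply]; abel)
    (by intros; simp only [map_smul, LinearMap.smul_apply, smul_add])
    (by intros; simp only [map_add]; abel)
    (by intros; simp only [map_smul, smul_add])

theorem cone_fst_act {M N : DGModule.{v, u₁, u₂, w} C} (f : Morphism M N) {X Y : C.Obj}
    {q p n : ℤ} (h : q + p = n) (m : (CochainComplex.mappingCone (f.app Y)).X q)
    (x : (C.Hom X Y).X p) :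
    ((CochainComplex.mappingCone.fst (f.app X)).1.v n (n + 1) rfl).hom (coneAct f h m x) =
      M.act (show q + 1 + p = n + 1 by omega)
        (((CochainComplex.mappingCone.fst (f.app Y)).1.v q (q + 1) rfl).hom m) x := by
  simp only [coneAct, LinearMap.mk₂_apply, map_add, cone_fst_inl, cone_fst_inr, add_zero]

theorem cone_snd_act {M N : DGModule.{v, u₁, u₂, w} C} (f : Morphism M N) {X Y : C.Obj}
    {q p n : ℤ} (h : q + p = n) (m : (CochainComplex.mappingCone (f.app Y)).X q)
    (x : (C.Hom X Y).X p) :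
    ((CochainComplex.mappingCone.snd (f.app X)).v n n (add_zero n)).hom (coneAct f h m x) =
      N.act h (((CochainComplex.mappingCone.snd (f.app Y)).v q q (add_zero q)).hom m) x := by
  simp only [coneAct, LinearMap.mk₂_apply, map_add, cone_snd_inl, cone_snd_inr, zero_add]

/-- The mapping cone of a morphism of dg modules: the mapping cone of the chain maps, with
`cone(f)^n = M^{n+1} ⊕ N^n` and the action induced by those on `M` and `N`. -/
def cone {M N : DGModule.{v, u₁, u₂, w} C} (f : Morphism M N) : DGModule.{v, u₁, u₂, w} C where
  obj X := CochainComplex.mappingCone (f.app X)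
  act h := coneAct f h
  act_id {X q} m := by
    refine cone_ext (f.app X) rfl ?_ ?_
    · rw [cone_fst_act, M.act_id]
    · rw [cone_snd_act, N.act_id]
  act_act {X Y Z r q p rq qp n} h₁ h₂ h₃ h₄ m y x := by
    refine cone_ext (f.app X) rfl ?_ ?_
    · rw [cone_fst_act, cone_fst_act, cone_fst_act]
      exact M.act_act _ _ _ _ _ _ _
    · rw [cone_snd_act, cone_snd_act, cone_snd_act]
      exact N.act_act _ _ _ _ _ _ _
  d_act {X Y q p n} h m x := by
    refine cone_ext (f.app X) rfl ?_ ?_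
    · rw [cone_fst_d _ rfl rfl, map_add, lin_units_smul, cone_fst_act, cone_fst_act, cone_fst_act,
        cone_fst_d _ rfl rfl, M.d_act' (show q + 1 + p = n + 1 by omega) rfl rfl rfl, neg_add,
        Int.negOnePow_succ, Units.neg_smul, neg_neg, map_neg, LinearMap.neg_apply]
    · rw [cone_snd_d _ rfl (add_zero n), map_add, lin_units_smul, cone_snd_act, cone_snd_act, cone_snd_act,
        cone_fst_act, cone_snd_d _ rfl (add_zero q), N.d_act' h rfl rfl rfl, f.app_act, map_add,
        LinearMap.add_apply]
      exact (add_assoc _ _ _).symm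

/-- The thick subcategory of the derived category `D(C)` generated by a class `S` of objects, as a
class of dg modules: the smallest class that contains `S` and is closed under isomorphism in `D(C)`
(that is, under quasi-isomorphisms in both directions), shifts, cones and direct summands in `D(C)`
(that is, retracts up to quasi-isomorphism). -/
inductive Thick (S : DGModule.{v, u₁, u₂, w} C → Prop) : DGModule.{v, u₁, u₂, w} C → Prop
  | of (M : DGModule.{v, u₁, u₂, w} C) : S M → Thick S M
  | of_quasiIso {M N : DGModule.{v, u₁, u₂, w} C} (f : Morphism M N) :
      f.IsQuasiIso → Thick S M → Thick S N
  | of_quasiIso' {M N : DGModule.{v, u₁, u₂, w} C} (f : Morphism M N) :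
      f.IsQuasiIso → Thick S N → Thick S M
  | shift (M : DGModule.{v, u₁, u₂, w} C) (a : ℤ) : Thick S M → Thick S (M.shift a)
  | cone {M N : DGModule.{v, u₁, u₂, w} C} (f : Morphism M N) :
      Thick S M → Thick S N → Thick S (DGModule.cone f)
  | retract {M N : DGModule.{v, u₁, u₂, w} C} (i : Morphism M N) (r : Morphism N M) :
      (∀ X : C.Obj, QuasiIso (i.app X ≫ r.app X)) → Thick S N → Thick S M

/-! ### Derived categories -/

/-- A dg module `M` is perfectly valued if the total cohomology `H^*(M(X))` is finite dimensional
for every object `X`. -/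
def IsPerfectlyValued (M : DGModule.{v, u₁, u₂, w} C) : Prop :=
  ∀ X : C.Obj, (∀ n : ℤ, Module.Finite k ((M.obj X).homology n)) ∧
    {n : ℤ | Nontrivial ((M.obj X).homology n)}.Finite

/-- A `D_fd`-generator: a dg module `M` such that the thick subcategory of `D(C)` generated by `M`
is the subcategory `D_fd(C)` of perfectly valued modules. -/
def IsDfdGenerator (M : DGModule.{v, u₁, u₂, w} C) : Prop :=
  ∀ N : DGModule.{v, u₁, u₂, w} C, Thick (fun L => L = M) N ↔ N.IsPerfectlyValued

/-- A dg module `P` is h-projective if `Hom_C(P, N)` is acyclic for every acyclic `N`. -/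
def IsHProjective (P : DGModule.{v, u₁, u₂, w} C) : Prop :=
  ∀ N : DGModule.{v, u₁, u₂, w} C, (∀ X : C.Obj, (N.obj X).Acyclic) → (homComplex P N).Acyclic

/-- An h-projective resolution of `M`: an h-projective dg module with a quasi-isomorphism to `M`.
For such a resolution `P`, the complex `Hom_C(P, N)` is `RHom_C(M, N)` and the dg algebra
`Hom_C(P, P)` is `REnd_C(M)`. -/
structure HProjResolution (M : DGModule.{v, u₁, u₂, w} C) where
  /-- the h-projective module -/
  P : DGModule.{v, u₁, u₂, w} C
  /-- the quasi-isomorphism -/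
  π : Morphism P M
  isHProjective : P.IsHProjective
  isQuasiIso : π.IsQuasiIso

variable (C) in
/-- The objects of the dg category `D_fd(C)`: h-projective perfectly valued modules. -/
def DfdObj : Type max u₁ u₂ v (w + 1) :=
  {M : DGModule.{v, u₁, u₂, w} C // M.IsHProjective ∧ M.IsPerfectlyValued}

variable (C) in
/-- The dg category `D_fd(C)`: the derived dg category of perfectly valued modules, modelled by
h-projective dg modules. -/
def Dfd : DGCat.{v, max u₁ u₂ v (w + 1), max u₁ w} k :=
  (dgCat.{v, u₁, u₂, w} C).full (fun M : DfdObj.{v, u₁, u₂, w} C => M.1)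

end DGModule

/-- A degreewise linear map between complexes (possibly in different universes) that commutes with
the differentials is a quasi-isomorphism if it is bijective on cohomology. -/
def IsQuasiIsoMap {K : CochainComplex (ModuleCat.{u₁} k) ℤ} {L : CochainComplex (ModuleCat.{u₂} k) ℤ}
    (f : ∀ n : ℤ, K.X n →ₗ[k] L.X n) : Prop :=
  (∀ (i j : ℤ) (x : K.X i), (L.d i j).hom (f i x) = f j ((K.d i j).hom x)) ∧
  (∀ (n : ℤ) (x : K.X n), (K.d n (n + 1)).hom x = 0 →
    (∃ y : L.X (n - 1), (L.d (n - 1) n).hom y = f n x) →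
    ∃ z : K.X (n - 1), (K.d (n - 1) n).hom z = x) ∧
  (∀ (n : ℤ) (y : L.X n), (L.d n (n + 1)).hom y = 0 →
    ∃ x : K.X n, (K.d n (n + 1)).hom x = 0 ∧
      ∃ z : L.X (n - 1), (L.d (n - 1) n).hom z = y - f n x)

/-- A dg functor. -/
structure DGFunctor (B : DGCat.{v, u₁, u₂} k) (D : DGCat.{v, u₃, u₄} k) where
  /-- the map on objects -/
  obj : B.Obj → D.Obj
  /-- the linear maps on morphisms -/
  map : ∀ {X Y : B.Obj} (n : ℤ), (B.Hom X Y).X n →ₗ[k] (D.Hom (obj X) (obj Y)).X n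
  map_d : ∀ {X Y : B.Obj} (i j : ℤ) (f : (B.Hom X Y).X i),
    map j (((B.Hom X Y).d i j).hom f) = ((D.Hom (obj X) (obj Y)).d i j).hom (map i f)
  map_id : ∀ X : B.Obj, map 0 (B.id X) = D.id (obj X)
  map_comp : ∀ {X Y Z : B.Obj} {q p n : ℤ} (h : q + p = n) (g : (B.Hom Y Z).X q)
    (f : (B.Hom X Y).X p), map n (B.comp h g f) = D.comp h (map q g) (map p f)

namespace DGFunctor

variable {B : DGCat.{v, u₁, u₂} k} {C : DGCat.{v, u₃, u₄} k}

/-- Let `F` be a dg functor from `B` to dg modules over `C`. The composite of `F` with the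
localisation from dg modules to the derived category `D(C)` is quasi-fully faithful if
`B(a, b) → RHom_C(F a, F b)` is a quasi-isomorphism for all `a` and `b`; here `RHom_C(F a, F b)` is
computed as `Hom_C(P, F b)` for an h-projective resolution `π : P → F a`, and the map is
`x ↦ F(x) ∘ π`. -/
def IsQuasiFullyFaithful (F : DGFunctor B (DGModule.dgCat.{v, u₃, u₄, w} C)) : Prop :=
  ∀ a : B.Obj, ∃ R : DGModule.HProjResolution (F.obj a), ∀ b : B.Obj,
    IsQuasiIsoMap (K := B.Hom a b) (L := DGModule.homComplex R.P (F.obj b))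
      (fun n => ((DGModule.homComp (add_zero n)).flip R.π.toHom).comp (F.map n))

/-- Let `F` be a dg functor from `B` to dg modules over `C`, and let `T` be (the class of objects
of) a thick subcategory of `D(C)`. The induced functor `B → T` is a Morita equivalence if it is
quasi-fully faithful and if its image generates `T` under shifts, cones and direct summands. (As
`T` is pretriangulated and idempotent complete, this means that it induces a quasi-equivalence from
the perfect derived category of `B` to `T`.) -/
def IsMoritaEquivalenceOnto (F : DGFunctor B (DGModule.dgCat.{v, u₃, u₄, w} C))
    (T : DGModule.{v, u₃, u₄, w} C → Prop) : Prop :=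
  (∀ a : B.Obj, T (F.obj a)) ∧ F.IsQuasiFullyFaithful ∧
    ∀ N : DGModule.{v, u₃, u₄, w} C, T N → DGModule.Thick (fun L => ∃ a, L = F.obj a) N

end DGFunctor

/-! ### Evaluation functors -/

section Evaluation

variable (A : DGCat.{v, u₁, u₂} k) {ι : Type u₃} (φ : ι → DGModule.{v, u₁, u₂, w} A)

/-- The opposite of the full dg category of dg `A`-modules on a family `φ` of modules. -/
def opFull : DGCat.{v, u₃, max u₁ w} k := ((DGModule.dgCat.{v, u₁, u₂, w} A).full φ).op

/-- Evaluation at an object `a` of `A`: the right module `i ↦ φ i (a)` over `opFull A φ`. -/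
def evalModule (a : A.Obj) : DGModule.{v, u₃, max u₁ w, w} (opFull A φ) where
  obj i := (φ i).obj a
  act {X Y q p n} h := LinearMap.mk₂ k
    (fun m (f : DGModule.homSubmodule (φ Y) (φ X) p) =>
      (q * p).negOnePow • ((f.1 a).v q n h).hom m)
    (by intros; rw [map_add, smul_add])
    (by intros; rw [map_smul, smul_comm])
    (by
      intros
      rw [← smul_add]
      rfl)
    (by
      intros
      rw [smul_comm]
      rfl)
  act_id {X q} m := by
    change (q * 0).negOnePow • ((Cochain.ofHom (𝟙 ((φ X).obj a))).v q q (add_zero q)).hom m = m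
    simp
  act_act {X Y Z r q p rq qp n} h₁ h₂ h₃ h₄ m y x := by
    change DGModule.homSubmodule (φ Z) (φ Y) q at y
    change DGModule.homSubmodule (φ Y) (φ X) p at x
    change (rq * p).negOnePow • ((x.1 a).v rq n h₂).hom
        ((r * q).negOnePow • ((y.1 a).v r rq h₁).hom m) =
      (r * qp).negOnePow • (((q * p).negOnePow •
        (y.1 a).comp (x.1 a) (show q + p = qp by omega)).v r n h₄).hom m
    rw [Cochain.units_smul_v, Cochain.comp_v _ _ _ r rq n h₁ h₂, hom_units_smul, lin_units_smul,
      smul_smul, smul_smul, ← Int.negOnePow_add, ← Int.negOnePow_add,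
      negOnePow_congr (show Even (rq * p + r * q - (r * qp + q * p)) from ?_)]
    · rfl
    · subst h₁ h₃
      exact ⟨0, by ring⟩
  d_act {X Y q p n} h m x := by
    change DGModule.homSubmodule (φ Y) (φ X) p at x
    change (((φ X).obj a).d n (n + 1)).hom ((q * p).negOnePow • ((x.1 a).v q n h).hom m) =
      ((q + 1) * p).negOnePow • ((x.1 a).v (q + 1) (n + 1) (by omega)).hom
        ((((φ Y).obj a).d q (q + 1)).hom m) +
      q.negOnePow • (q * (p + 1)).negOnePow • ((δ p (p + 1) (x.1 a)).v q (n + 1) (by omega)).hom m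
    rw [δ_v p (p + 1) rfl (x.1 a) q (n + 1) (by omega) n (q + 1) (by omega) rfl]
    simp only [ModuleCat.hom_add, ModuleCat.hom_comp, hom_units_smul, LinearMap.add_apply,
      LinearMap.comp_apply, lin_units_smul, smul_add, smul_smul, ← Int.negOnePow_add]
    rw [negOnePow_congr (show Even (q + q * (p + 1) - q * p) from ⟨q, by ring⟩),
      show (q + (q * (p + 1) + (p + 1))).negOnePow = -((q + 1) * p).negOnePow by
        rw [← Int.negOnePow_succ]; exact negOnePow_congr ⟨q, by ring⟩, Units.neg_smul]
    abel

theorem evalModule_act (a : A.Obj) {i j : ι} {q p n : ℤ} (h : q + p = n)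
    (m : ((φ j).obj a).X q) (f : DGModule.homSubmodule (φ j) (φ i) p) :
    (evalModule A φ a).act (X := i) (Y := j) h m f =
      (q * p).negOnePow • ((f.1 a).v q n h).hom m := rfl

/-- The map `m ↦ (-1)^{|x||m|} m · x` given by a morphism `x : b → a` of degree `n` of `A`. -/
def evalMap {a b : A.Obj} (n : ℤ) :
    (A.Hom b a).X n →ₗ[k] DGModule.homSubmodule (evalModule A φ a) (evalModule A φ b) n where
  toFun x := ⟨fun i => Cochain.mk fun q q' h =>
      ModuleCat.ofHom ((n * q).negOnePow • ((φ i).act h).flip x), by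
    intro i j q p r q' s h h₁ h₂ m f
    change DGModule.homSubmodule (φ j) (φ i) p at f
    change ((φ j).obj a).X q at m
    change (n * r).negOnePow • (φ i).act h₂ ((q * p).negOnePow • ((f.1 a).v q r h).hom m) x =
      (q' * p).negOnePow • ((f.1 b).v q' s (by omega)).hom ((n * q).negOnePow • (φ j).act h₁ m x)
    rw [lin_units_smul₂, lin_units_smul, f.2 b a q n q' r s h₁ h (by omega), smul_smul, smul_smul,
      ← Int.negOnePow_add, ← Int.negOnePow_add,
      negOnePow_congr (show Even (n * r + q * p - (q' * p + n * q)) from ?_)]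
    subst h h₁
    exact ⟨0, by ring⟩⟩
  map_add' x y := Subtype.ext (funext fun i => by
    ext q q' h m
    change (n * q).negOnePow • (φ i).act h m (x + y) =
      (n * q).negOnePow • (φ i).act h m x + (n * q).negOnePow • (φ i).act h m y
    rw [map_add, smul_add])
  map_smul' c x := Subtype.ext (funext fun i => by
    ext q q' h m
    change (n * q).negOnePow • (φ i).act h m (c • x) = c • (n * q).negOnePow • (φ i).act h m x
    rw [map_smul, smul_comm])

theorem evalMap_apply {a b : A.Obj} (n : ℤ) (x : (A.Hom b a).X n) (i : ι) (q q' : ℤ)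
    (h : q + n = q') (m : ((φ i).obj a).X q) :
    (((evalMap A φ n x).1 i).v q q' h).hom m = (n * q).negOnePow • (φ i).act h m x := rfl

theorem evalMap_d {a b : A.Obj} (r : ℤ) (x : (A.Hom b a).X r) (i : ι) (q q' : ℤ)
    (h : q + (r + 1) = q') (m : ((φ i).obj a).X q) :
    ((r + 1) * q).negOnePow • (φ i).act h m (((A.Hom b a).d r (r + 1)).hom x) =
      (((φ i).obj b).d (q + r) q').hom ((r * q).negOnePow • (φ i).act rfl m x) +
      (r + 1).negOnePow • (r * (q + 1)).negOnePow •
        (φ i).act (by omega) ((((φ i).obj a).d q (q + 1)).hom m) x := by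
  rw [lin_units_smul, (φ i).d_act' rfl rfl rfl (by omega), smul_add, smul_smul, smul_smul,
    ← Int.negOnePow_add, ← Int.negOnePow_add,
    show (r + 1 + r * (q + 1)).negOnePow = -(r * q).negOnePow by
      rw [← Int.negOnePow_succ]; exact negOnePow_congr ⟨r, by ring⟩, Units.neg_smul,
    negOnePow_congr (show Even ((r + 1) * q - (r * q + q)) from ⟨0, by ring⟩)]
  abel

/-- The evaluation dg functor `ev : Aᵒᵖ → Mod (opFull A φ)`, `a ↦ (i ↦ φ i (a))`, which sends a
morphism `x` of `A` to the (signed) action `m ↦ (-1)^{|x||m|} m · x`. -/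
def evalFunctor : DGFunctor A.op (DGModule.dgCat.{v, u₃, max u₁ w, w} (opFull A φ)) where
  obj a := evalModule A φ a
  map n := evalMap A φ n
  map_d {a b} r s x := Subtype.ext (funext fun i => by
    change (A.Hom b a).X r at x
    change (evalMap A φ s (((A.Hom b a).d r s).hom x)).1 i = δ r s ((evalMap A φ r x).1 i)
    by_cases hrs : r + 1 = s
    swap
    · rw [δ_shape r s hrs, (A.Hom b a).shape r s hrs]
      ext q q' h m
      change (s * q).negOnePow • (φ i).act h m 0 = 0
      rw [map_zero, smul_zero]
    · subst hrs
      ext q q' h m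
      rw [δ_v r (r + 1) rfl _ q q' h (q + r) (q + 1) (by omega) rfl, ModuleCat.hom_add,
        LinearMap.add_apply, hom_units_smul]
      exact evalMap_d A φ r x i q q' h m)
  map_id a := Subtype.ext (funext fun i => by
    ext q m
    change (0 * q).negOnePow • (φ i).act (add_zero q) m (A.id a) =
      ((Cochain.ofHom (𝟙 ((evalModule A φ a).obj i))).v q q (add_zero q)).hom m
    rw [zero_mul, Int.negOnePow_zero, one_smul, Cochain.ofHom_v]
    exact (φ i).act_id m)
  map_comp {a b c q p n} h y x := Subtype.ext (funext fun i => by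
    change ι at i
    ext r s h' m
    change (A.Hom c b).X q at y
    change (A.Hom b a).X p at x
    change ((φ i).obj a).X r at m
    change (n * r).negOnePow • (φ i).act h' m
        ((q * p).negOnePow • A.comp (show p + q = n by omega) x y) =
      ((((evalMap A φ p x).1 i).comp ((evalMap A φ q y).1 i)
        (show p + q = n by omega)).v r s h').hom m
    rw [Cochain.comp_v _ _ _ r (r + p) s rfl (by omega)]
    change _ = (q * (r + p)).negOnePow • (φ i).act (show r + p + q = s by omega)
      ((p * r).negOnePow • (φ i).act rfl m x) y
    rw [lin_units_smul, lin_units_smul₂,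
      (φ i).act_act rfl (by omega) (show p + q = n by omega) h' m x y, smul_smul,
      smul_smul, ← Int.negOnePow_add, ← Int.negOnePow_add,
      negOnePow_congr (show Even (n * r + q * p - (q * (r + p) + p * r)) from ?_)]
    subst h
    exact ⟨0, by ring⟩)

end Evaluation

/-! ### Reflexivity and derived completeness -/

/-- A dg category `A` is reflexive if the natural functor `ev : Aᵒᵖ → D_fd(D_fd(A)ᵒᵖ)`,
`a ↦ (M ↦ M(a))`, is a Morita equivalence. -/
def DGCat.IsReflexive (A : DGCat.{v, u, u} k) : Prop :=
  DGFunctor.IsMoritaEquivalenceOnto (C := (DGModule.Dfd.{v, u, u, u} A).op)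
    (evalFunctor A (fun M : DGModule.DfdObj.{v, u, u, u} A => M.1)) DGModule.IsPerfectlyValued

namespace DGModule.HProjResolution

/-! In this section `A` is a dg algebra, that is, a dg category with a single object, and `P` is an
h-projective resolution of a dg `A`-module `M`. -/

variable {A : DGCat.{v, u, u} k} [Unique A.Obj] {M : DGModule.{v, u, u, u} A}
  (R : HProjResolution M)

/-- The centraliser `A^!_M = REnd_A(M)ᵒᵖ`: the dg algebra `Hom_A(P, P)ᵒᵖ`, as a dg category with a
single object. -/
def centraliser : DGCat.{v, u, u} k := opFull A (fun _ : PUnit.{u + 1} => R.P)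

instance : Unique R.centraliser.Obj := inferInstanceAs (Unique PUnit.{u + 1})

/-- `M`, or rather its resolution `P`, as a right dg module over `A^!_M`, with action
`m · f = (-1)^{|f||m|} f(m)`. -/
def overCentraliser : DGModule.{v, u, u, u} R.centraliser :=
  evalModule A (fun _ : PUnit.{u + 1} => R.P) default

/-- The derived completion map `A → A^!!_M = REnd_{A^!_M}(M)ᵒᵖ`, induced by the action of `A` on
`M`. For an h-projective resolution `π : Q → M` over `A^!_M`, the complex underlying
`REnd_{A^!_M}(M)` is given by either side of the quasi-isomorphism
`π ∘ - : Hom(Q, Q) → Hom(Q, M)`; here it is taken to be `Hom(Q, M)`, so that the completion map is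
`x ↦ (z ↦ (-1)^{|x||z|} π(z) · x)`. -/
def completionMap (S : HProjResolution R.overCentraliser) (n : ℤ) :
    (A.Hom default default).X n →ₗ[k] (homComplex S.P R.overCentraliser).X n :=
  ((homComp (add_zero n)).flip S.π.toHom).comp (evalMap A (fun _ : PUnit.{u + 1} => R.P) n)

/-- `A` is derived complete with respect to `M`: the derived completion map `A → A^!!_M` is a
quasi-isomorphism. -/
def IsDerivedComplete : Prop :=
  ∃ S : HProjResolution R.overCentraliser,
    IsQuasiIsoMap (K := A.Hom default default) (L := homComplex S.P R.overCentraliser)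
      (R.completionMap S)

end DGModule.HProjResolution

end

/-! Let `P → M` be the given h-projective resolution. Since `M` is perfectly valued, `P` is an
object of `D_fd(A)`, and its endomorphism algebra in `D_fd(A)ᵒᵖ` is `A^!_M`. Every object of
`D_fd(A)` arises from `P` by shifts, cones and retracts up to quasi-isomorphism. A dg module over
`D_fd(A)ᵒᵖ` respects these constructions, so its value at `P` controls all its values. Hence
restriction to `P` is an equivalence from `D(D_fd(A)ᵒᵖ)` to `D(A^!_M)`. It sends evaluation at the
object of `A` to `M` over `A^!_M`, and perfectly valued modules correspond on the two sides. Through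
this equivalence, quasi-full faithfulness of evaluation becomes derived completeness, and generation
by evaluation becomes the statement that `M` is a `D_fd`-generator for `A^!_M`. So reflexivity is
the conjunction of the other two conditions (`isReflexive_iff`), and the three implications follow
at once.

Two constructions carry the argument. First, `dfd_generator`: a property of complexes stable under
the triangulated operations (`IsThickClass`) passes from the value of a module at `P` to its value
everywhere. For acyclicity, applied to cones, this says that quasi-isomorphisms are detected at `P`;
for finite total cohomology, that perfect values are. Second, the derived induction `lind T` of an
`A^!_M`-module `T`, the total module of a bar-type resolution by free modules `V ⊗ Hom(-, P)`. It is
h-projective, its restriction is h-projective and quasi-isomorphic to `T` (`isQuasiIso_lindAug`),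
and restriction is bijective on homomorphisms out of it (`resHom_lind_injective`,
`resHom_lind_surjective`). Hence `isQuasiIsoMap_res_iff`, which compares derived homomorphisms, and
`thick_lind`, which transports thick subcategories. Although `D_fd(A)` is a large category, only
free modules on the single object `P` occur, so resolutions stay in the universe of the given
modules. -/

noncomputable section

variable {k : Type v} [Field k]

/-! ### Cohomology of complexes of vector spaces, in terms of elements -/

namespace IsQuasiIsoMap

variable {K : CochainComplex (ModuleCat.{u₁} k) ℤ} {L : CochainComplex (ModuleCat.{u₂} k) ℤ}
  {f : ∀ n : ℤ, K.X n →ₗ[k] L.X n}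

theorem exists_d_eq (hf : IsQuasiIsoMap f) {i j l : ℤ} (h : i + 1 = j) (h' : j + 1 = l) (x : K.X j)
    (hx : (K.d j l).hom x = 0) (y : L.X i) (hy : (L.d i j).hom y = f j x) :
    ∃ z : K.X i, (K.d i j).hom z = x := by
  obtain rfl : i = j - 1 := by omega
  subst h'
  exact hf.2.1 j x hx ⟨y, hy⟩

theorem exists_cocycle (hf : IsQuasiIsoMap f) {i j l : ℤ} (h : i + 1 = j) (h' : j + 1 = l)
    (y : L.X j) (hy : (L.d j l).hom y = 0) :
    ∃ x : K.X j, (K.d j l).hom x = 0 ∧ ∃ z : L.X i, (L.d i j).hom z = y - f j x := by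
  obtain rfl : i = j - 1 := by omega
  subst h'
  exact hf.2.2 j y hy

end IsQuasiIsoMap

namespace CochainComplex

variable (K L : CochainComplex (ModuleCat.{w} k) ℤ)

theorem d_d_apply (i j l : ℤ) (x : K.X i) : (K.d j l).hom ((K.d i j).hom x) = 0 :=
  congrArg (fun f => f.hom x) (K.d_comp_d i j l)

theorem hom_comm_apply {K L : CochainComplex (ModuleCat.{w} k) ℤ} (f : K ⟶ L) (i j : ℤ)
    (x : K.X i) : (L.d i j).hom ((f.f i).hom x) = (f.f j).hom ((K.d i j).hom x) :=
  (congrArg (fun f => f.hom x) (f.comm i j))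

/-- The inclusion of the cocycles, given by elements, in the object `K.cycles n`. -/
def ofCocycle (n : ℤ) : LinearMap.ker (K.d n (n + 1)).hom →ₗ[k] K.cycles n :=
  (K.liftCycles (A := ModuleCat.of k (LinearMap.ker (K.d n (n + 1)).hom))
    (ModuleCat.ofHom (Submodule.subtype _)) (n + 1) (by simp) (by ext x; exact x.2)).hom

theorem iCycles_ofCocycle (n : ℤ) (x : LinearMap.ker (K.d n (n + 1)).hom) :
    (K.iCycles n).hom (K.ofCocycle n x) = x.1 :=
  congrArg (fun f => f.hom x)
    (K.liftCycles_i (A := ModuleCat.of k (LinearMap.ker (K.d n (n + 1)).hom))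
      (ModuleCat.ofHom (Submodule.subtype _)) (n + 1) (by simp) (by ext x; exact x.2))

theorem iCycles_injective (n : ℤ) : Function.Injective (K.iCycles n).hom :=
  (ModuleCat.mono_iff_injective (K.iCycles n)).1 inferInstance

/-- The cohomology class of a cocycle. -/
def cohomologyClass (n : ℤ) : LinearMap.ker (K.d n (n + 1)).hom →ₗ[k] K.homology n :=
  (K.homologyπ n).hom.comp (K.ofCocycle n)

theorem cohomologyClass_surjective (n : ℤ) : Function.Surjective (K.cohomologyClass n) := by
  intro y
  obtain ⟨c, rfl⟩ := (ModuleCat.epi_iff_surjective (K.homologyπ n)).1 inferInstance y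
  have hc : (K.d n (n + 1)).hom ((K.iCycles n).hom c) = 0 :=
    congrArg (fun f => f.hom c) (K.iCycles_d n (n + 1))
  refine ⟨⟨(K.iCycles n).hom c, hc⟩, congrArg (K.homologyπ n).hom (K.iCycles_injective n ?_)⟩
  exact K.iCycles_ofCocycle n _

theorem cohomologyClass_eq_zero_iff (n : ℤ) (x : LinearMap.ker (K.d n (n + 1)).hom) :
    K.cohomologyClass n x = 0 ↔ ∃ y : K.X (n - 1), (K.d (n - 1) n).hom y = x.1 := by
  have hex : (ShortComplex.mk (K.toCycles (n - 1) n) (K.homologyπ n)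
      (K.toCycles_comp_homologyπ _ _)).Exact :=
    ShortComplex.exact_of_g_is_cokernel _ (K.homologyIsCokernel (n - 1) n (by simp))
  rw [ShortComplex.moduleCat_exact_iff] at hex
  have hi (y : K.X (n - 1)) :
      (K.iCycles n).hom ((K.toCycles (n - 1) n).hom y) = (K.d (n - 1) n).hom y :=
    congrArg (fun f => f.hom y) (K.toCycles_i (n - 1) n)
  constructor
  · intro h
    obtain ⟨y, hy⟩ := hex _ h
    refine ⟨y, ?_⟩
    rw [← K.iCycles_ofCocycle n x, ← hi]
    exact congrArg (K.iCycles n).hom hy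
  · rintro ⟨y, hy⟩
    have : K.ofCocycle n x = (K.toCycles (n - 1) n).hom y :=
      K.iCycles_injective n ((K.iCycles_ofCocycle n x).trans (hy.symm.trans (hi y).symm))
    rw [cohomologyClass, LinearMap.comp_apply, this]
    exact congrArg (fun f => f.hom y) (K.toCycles_comp_homologyπ (n - 1) n)

variable {K L}

theorem homologyMap_cohomologyClass (f : K ⟶ L) (n : ℤ) (x : K.X n)
    (hx : (K.d n (n + 1)).hom x = 0) (hy : (L.d n (n + 1)).hom ((f.f n).hom x) = 0) :
    (HomologicalComplex.homologyMap f n).hom (K.cohomologyClass n ⟨x, hx⟩) =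
      L.cohomologyClass n ⟨(f.f n).hom x, hy⟩ := by
  refine (congrArg (fun g => g.hom (K.ofCocycle n ⟨x, hx⟩))
    (HomologicalComplex.homologyπ_naturality f n)).trans ?_
  refine congrArg (L.homologyπ n).hom (L.iCycles_injective n ?_)
  refine Eq.trans ?_ (L.iCycles_ofCocycle n _).symm
  refine (congrArg (fun g => g.hom (K.ofCocycle n ⟨x, hx⟩))
    (HomologicalComplex.cyclesMap_i f n)).trans ?_
  exact congrArg (f.f n).hom (K.iCycles_ofCocycle n _)

/-- This is the bridge between categorical quasi-isomorphisms and cocycles: after it, diagram chases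
are done with elements. -/
theorem quasiIso_iff_isQuasiIsoMap (f : K ⟶ L) :
    QuasiIso f ↔ IsQuasiIsoMap (fun n => (f.f n).hom) := by
  have key : QuasiIso f ↔ ∀ n, Function.Bijective (HomologicalComplex.homologyMap f n).hom := by
    rw [quasiIso_iff]
    refine forall_congr' fun n => ?_
    rw [quasiIsoAt_iff_isIso_homologyMap, ConcreteCategory.isIso_iff_bijective]
  rw [key]
  have hf (n : ℤ) (x : K.X n) (hx : (K.d n (n + 1)).hom x = 0) :
      (L.d n (n + 1)).hom ((f.f n).hom x) = 0 := by
    rw [hom_comm_apply, hx, map_zero]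
  constructor
  · intro h
    refine ⟨fun i j x => hom_comm_apply f i j x, fun n x hx hy => ?_, fun n y hy => ?_⟩
    · refine (K.cohomologyClass_eq_zero_iff n ⟨x, hx⟩).1 ((h n).1 ?_)
      rw [homologyMap_cohomologyClass f n x hx (hf n x hx)]
      exact ((L.cohomologyClass_eq_zero_iff n _).2 hy).trans (map_zero _).symm
    · obtain ⟨c, hc⟩ := (h n).2 (L.cohomologyClass n ⟨y, hy⟩)
      obtain ⟨⟨x, hx⟩, rfl⟩ := K.cohomologyClass_surjective n c
      refine ⟨x, hx, ?_⟩
      rw [homologyMap_cohomologyClass f n x hx (hf n x hx), eq_comm, ← sub_eq_zero,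
        ← map_sub, cohomologyClass_eq_zero_iff] at hc
      exact hc
  · rintro ⟨-, h₁, h₂⟩ n
    constructor
    · rw [← LinearMap.ker_eq_bot, LinearMap.ker_eq_bot']
      intro c hc
      obtain ⟨⟨x, hx⟩, rfl⟩ := K.cohomologyClass_surjective n c
      rw [homologyMap_cohomologyClass f n x hx (hf n x hx), cohomologyClass_eq_zero_iff] at hc
      exact (K.cohomologyClass_eq_zero_iff n _).2 (h₁ n x hx hc)
    · intro c
      obtain ⟨⟨y, hy⟩, rfl⟩ := L.cohomologyClass_surjective n c
      obtain ⟨x, hx, z, hz⟩ := h₂ n y hy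
      refine ⟨K.cohomologyClass n ⟨x, hx⟩, ?_⟩
      rw [homologyMap_cohomologyClass f n x hx (hf n x hx), eq_comm, ← sub_eq_zero, ← map_sub,
        cohomologyClass_eq_zero_iff]
      exact ⟨z, hz⟩

theorem acyclic_iff_exists : K.Acyclic ↔ ∀ (n : ℤ) (x : K.X n), (K.d n (n + 1)).hom x = 0 →
    ∃ y : K.X (n - 1), (K.d (n - 1) n).hom y = x := by
  rw [HomologicalComplex.acyclic_iff]
  refine forall_congr' fun n => ?_
  rw [K.exactAt_iff' (n - 1) n (n + 1) (by simp) (by simp), ShortComplex.moduleCat_exact_iff]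
  rfl

theorem exists_d_eq_of_acyclic (hK : K.Acyclic) {i j l : ℤ} (h : i + 1 = j) (h' : j + 1 = l)
    (x : K.X j) (hx : (K.d j l).hom x = 0) : ∃ y : K.X i, (K.d i j).hom y = x := by
  obtain rfl : i = j - 1 := by omega
  subst h'
  exact acyclic_iff_exists.1 hK j x hx

theorem acyclic_iff_forall_homology : K.Acyclic ↔ ∀ n, Subsingleton (K.homology n) := by
  rw [HomologicalComplex.acyclic_iff]
  refine forall_congr' fun n => ?_
  rw [HomologicalComplex.exactAt_iff_isZero_homology]
  exact ModuleCat.isZero_iff_subsingleton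

/-! ### Thick classes of complexes. -/

/-- Total cohomology finite dimensional. -/
def IsPerfect (K : CochainComplex (ModuleCat.{w} k) ℤ) : Prop :=
  (∀ n : ℤ, Module.Finite k (K.homology n)) ∧ {n : ℤ | Nontrivial (K.homology n)}.Finite

/-- Families of linear maps of degree `a` which commute with the differentials up to a sign. -/
def IsChainMapUpToSign {a : ℤ} (f : ∀ i j : ℤ, i + a = j → K.X i →ₗ[k] L.X j) : Prop :=
  ∃ ε : ℤˣ, ∀ (i i' j j' : ℤ) (h : i + a = j) (h' : i' + a = j') (x : K.X i),
    (L.d j j').hom (f i j h x) = ε • f i' j' h' ((K.d i i').hom x)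

/-- A class of complexes closed under extensions, shifts and retracts in the derived category: it
contains `L` whenever it contains `K` and `M` and there is a sequence `K → L → M` (of maps of any
degrees) which is exact in the middle on cohomology. -/
structure IsThickClass (Q : CochainComplex (ModuleCat.{w} k) ℤ → Prop) : Prop where
  middle : ∀ {K L M : CochainComplex (ModuleCat.{w} k) ℤ} {b a : ℤ}
    (α : ∀ i j : ℤ, i + b = j → K.X i →ₗ[k] L.X j) (β : ∀ i j : ℤ, i + a = j → L.X i →ₗ[k] M.X j),
    IsChainMapUpToSign α → IsChainMapUpToSign β →
    (∀ (n m : ℤ) (h : n + a = m) (x : L.X n), (L.d n (n + 1)).hom x = 0 →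
      (∃ y : M.X (m - 1), (M.d (m - 1) m).hom y = β n m h x) →
      ∃ (l : ℤ) (h' : l + b = n) (z : K.X l), (K.d l (l + 1)).hom z = 0 ∧
        ∃ y : L.X (n - 1), x = α l n h' z + (L.d (n - 1) n).hom y) →
    Q K → Q M → Q L
  acyclic : ∀ {K : CochainComplex (ModuleCat.{w} k) ℤ}, K.Acyclic → Q K

theorem IsChainMapUpToSign.map_cocycle {a : ℤ} {f : ∀ i j : ℤ, i + a = j → K.X i →ₗ[k] L.X j}
    (hf : IsChainMapUpToSign f) {i j : ℤ} (h : i + a = j) (x : K.X i)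
    (hx : (K.d i (i + 1)).hom x = 0) : (L.d j (j + 1)).hom (f i j h x) = 0 := by
  obtain ⟨ε, hε⟩ := hf
  rw [hε i (i + 1) j (j + 1) h (by omega), hx, map_zero, smul_zero]

theorem IsChainMapUpToSign.map_boundary {a : ℤ} {f : ∀ i j : ℤ, i + a = j → K.X i →ₗ[k] L.X j}
    (hf : IsChainMapUpToSign f) {i j : ℤ} (h : i + a = j) (x : K.X (i - 1)) :
    ∃ y : L.X (j - 1), (L.d (j - 1) j).hom y = f i j h ((K.d (i - 1) i).hom x) := by
  obtain ⟨ε, hε⟩ := hf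
  refine ⟨ε⁻¹ • f (i - 1) (j - 1) (by omega) x, ?_⟩
  rw [lin_units_smul, hε (i - 1) i (j - 1) j _ h, smul_smul, inv_mul_cancel, one_smul]

/-- A cocycle of the middle term has bounding image, hence is cohomologous to the image of a cocycle
of the left term, which bounds. -/
theorem isThickClass_acyclic :
    IsThickClass (HomologicalComplex.Acyclic : CochainComplex (ModuleCat.{w} k) ℤ → Prop) where
  middle {K L M b a} α β hα hβ hex hK hM := by
    rw [acyclic_iff_exists] at hK hM ⊢
    intro n x hx
    obtain ⟨l, h', z, hz, y, rfl⟩ := hex n _ rfl x hx (hM _ _ (hβ.map_cocycle rfl x hx))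
    obtain ⟨z', rfl⟩ := hK l z hz
    obtain ⟨y', hy'⟩ := hα.map_boundary h' z'
    exact ⟨y' + y, by rw [map_add, hy']⟩
  acyclic h := h

/-- The map induced on cohomology by a chain map up to sign. -/
theorem IsChainMapUpToSign.exists_map {a : ℤ} {f : ∀ i j : ℤ, i + a = j → K.X i →ₗ[k] L.X j}
    (hf : IsChainMapUpToSign f) {i j : ℤ} (h : i + a = j) :
    ∃ F : K.homology i →ₗ[k] L.homology j, ∀ x : LinearMap.ker (K.d i (i + 1)).hom,
      F (K.cohomologyClass i x) = L.cohomologyClass j ⟨f i j h x.1, hf.map_cocycle h x.1 x.2⟩ := by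
  let g : LinearMap.ker (K.d i (i + 1)).hom →ₗ[k] L.homology j :=
    (L.cohomologyClass j).comp ((f i j h).restrict (fun x hx => hf.map_cocycle h x hx))
  have hg : LinearMap.ker (K.cohomologyClass i) ≤ LinearMap.ker g := by
    intro x hx
    obtain ⟨y, hy⟩ := (K.cohomologyClass_eq_zero_iff i x).1 hx
    refine (L.cohomologyClass_eq_zero_iff j _).2 ?_
    obtain ⟨z, hz⟩ := hf.map_boundary h y
    exact ⟨z, by rw [hz, hy]; rfl⟩
  let e := (K.cohomologyClass i).quotKerEquivOfSurjective (K.cohomologyClass_surjective i)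
  refine ⟨((LinearMap.ker (K.cohomologyClass i)).liftQ g hg).comp e.symm.toLinearMap, fun x => ?_⟩
  have : e.symm (K.cohomologyClass i x) = Submodule.Quotient.mk x := by
    rw [LinearEquiv.symm_apply_eq]; rfl
  change (LinearMap.ker (K.cohomologyClass i)).liftQ g hg (e.symm _) = _
  rw [this]
  rfl

/-- Exactness in the middle bounds each cohomology space of `L` by one of `K` and one of `M`, and
places the support of its cohomology in a union of two translated finite sets. -/
theorem isThickClass_isPerfect :
    IsThickClass (IsPerfect : CochainComplex (ModuleCat.{w} k) ℤ → Prop) where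
  middle {K L M b a} α β hα hβ hex hK hM := by
    have key : ∀ n : ℤ, ∃ (F : K.homology (n - b) →ₗ[k] L.homology n)
        (G : L.homology n →ₗ[k] M.homology (n + a)), LinearMap.ker G ≤ LinearMap.range F := by
      intro n
      obtain ⟨F, hF⟩ := hα.exists_map (show n - b + b = n by omega)
      obtain ⟨G, hG⟩ := hβ.exists_map (show n + a = n + a from rfl)
      refine ⟨F, G, fun c hc => ?_⟩
      obtain ⟨x, rfl⟩ := L.cohomologyClass_surjective n c
      rw [LinearMap.mem_ker, hG, cohomologyClass_eq_zero_iff] at hc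
      obtain ⟨l, h', z, hz, y, hy⟩ := hex n _ rfl x.1 x.2 hc
      obtain rfl : l = n - b := by omega
      refine ⟨K.cohomologyClass _ ⟨z, hz⟩, ?_⟩
      rw [hF, eq_comm, ← sub_eq_zero, ← map_sub, cohomologyClass_eq_zero_iff]
      exact ⟨y, by rw [AddSubgroupClass.coe_sub, hy]; simp⟩
    refine ⟨fun n => ?_, ?_⟩
    · obtain ⟨F, G, h⟩ := key n
      have := hK.1 (n - b)
      have := hM.1 (n + a)
      -- The cohomology of `L` is an extension of the range of `G` by its kernel, and the kernel
      -- lies in the range of `F`.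
      have : Module.Finite k (LinearMap.ker G) :=
        Module.Finite.of_injective (Submodule.inclusion h) (Submodule.inclusion_injective h)
      exact Module.Finite.of_exact (f := (LinearMap.ker G).subtype) (g := G.rangeRestrict)
        (by intro x; simp [Subtype.ext_iff]) G.surjective_rangeRestrict
    · refine ((hK.2.image (fun n => n + b)).union (hM.2.image (fun n => n - a))).subset ?_
      intro n hn
      obtain ⟨F, G, h⟩ := key n
      by_contra hcon
      simp only [Set.mem_union, Set.mem_image, Set.mem_ofPred_eq, not_or, not_exists, not_and] at hcon
      have h₁ : Subsingleton (K.homology (n - b)) := by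
        rw [← not_nontrivial_iff_subsingleton]
        exact fun h' => hcon.1 _ h' (by omega)
      have h₂ : Subsingleton (M.homology (n + a)) := by
        rw [← not_nontrivial_iff_subsingleton]
        exact fun h' => hcon.2 _ h' (by omega)
      have hn : Nontrivial (L.homology n) := hn
      obtain ⟨c, hc⟩ := exists_ne (0 : L.homology n)
      obtain ⟨z, rfl⟩ := h (show c ∈ LinearMap.ker G from Subsingleton.elim _ _)
      exact hc (by rw [Subsingleton.elim z 0, map_zero])
  acyclic {K} h := by
    rw [acyclic_iff_forall_homology] at h
    refine ⟨fun n => ?_, ?_⟩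
    · have := h n
      infer_instance
    · convert Set.finite_empty
      ext n
      have := h n
      simp only [Set.mem_ofPred_eq, Set.mem_empty_iff_false, iff_false, not_nontrivial_iff_subsingleton]
      exact this

end CochainComplex

/-! ### Closure properties of thick classes. -/

namespace CochainComplex.IsThickClass

open scoped ZeroObject

variable {K L M : CochainComplex (ModuleCat.{w} k) ℤ}
  {Q : CochainComplex (ModuleCat.{w} k) ℤ → Prop}

theorem isChainMapUpToSign_zero (a : ℤ) :
    IsChainMapUpToSign (fun i j (_ : i + a = j) => (0 : K.X i →ₗ[k] L.X j)) :=
  ⟨1, fun i i' j j' h h' x => by simp⟩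

theorem isChainMapUpToSign_ofHom (f : K ⟶ L) :
    IsChainMapUpToSign (fun i j (h : i + 0 = j) => ((Cochain.ofHom f).v i j h).hom) := by
  refine ⟨1, fun i i' j j' h h' x => ?_⟩
  obtain rfl : i = j := by omega
  obtain rfl : i' = j' := by omega
  dsimp only
  rw [one_smul, Cochain.ofHom_v, Cochain.ofHom_v]
  exact hom_comm_apply f i i' x

theorem acyclic_zero :
    (0 : CochainComplex (ModuleCat.{w} k) ℤ).Acyclic := by
  rw [acyclic_iff_exists]
  intro n x _
  have : Subsingleton ((0 : CochainComplex (ModuleCat.{w} k) ℤ).X n) :=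
    ModuleCat.subsingleton_of_isZero
      ((HomologicalComplex.eval _ _ n).map_isZero (Limits.isZero_zero _))
  exact ⟨0, Subsingleton.elim _ _⟩

/-- A thick class contains every complex `L` dominated, on cohomology, by a complex of the class. -/
theorem of_retract (hQ : IsThickClass Q) {b : ℤ}
    (α : ∀ i j : ℤ, i + b = j → K.X i →ₗ[k] L.X j)
    (hα : IsChainMapUpToSign α)
    (h : ∀ (n : ℤ) (x : L.X n), (L.d n (n + 1)).hom x = 0 →
      ∃ (l : ℤ) (h' : l + b = n) (z : K.X l), (K.d l (l + 1)).hom z = 0 ∧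
        ∃ y : L.X (n - 1), x = α l n h' z + (L.d (n - 1) n).hom y)
    (hK : Q K) : Q L :=
  hQ.middle (a := 0) α (fun i j _ => (0 : L.X i →ₗ[k] (0 : CochainComplex (ModuleCat k) ℤ).X j)) hα
    (isChainMapUpToSign_zero 0) (fun n _ _ x hx _ => h n x hx) hK (hQ.acyclic acyclic_zero)

theorem of_quasiIso (hQ : IsThickClass Q) (f : K ⟶ L) (hf : QuasiIso f) (hK : Q K) : Q L := by
  rw [quasiIso_iff_isQuasiIsoMap] at hf
  refine hQ.of_retract _ (isChainMapUpToSign_ofHom f) (fun n x hx => ?_) hK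
  obtain ⟨z, hz, y, hy⟩ := hf.2.2 n x hx
  exact ⟨n, by omega, z, hz, y, by rw [hy, Cochain.ofHom_v]; simp⟩

/-- Injectivity on cohomology alone is exactness of `0 → K → L` in the middle. -/
theorem of_quasiIso' (hQ : IsThickClass Q) (f : K ⟶ L) (hf : QuasiIso f) (hL : Q L) : Q K := by
  rw [quasiIso_iff_isQuasiIsoMap] at hf
  refine hQ.middle (K := 0) (M := L)
    (fun i j (_ : i + 0 = j) => (0 : (0 : CochainComplex (ModuleCat k) ℤ).X i →ₗ[k] K.X j)) _
    (isChainMapUpToSign_zero 0) (isChainMapUpToSign_ofHom f) ?_ (hQ.acyclic acyclic_zero) hL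
  rintro n m h x hx ⟨y, hy⟩
  obtain rfl : n = m := by omega
  obtain ⟨z, hz⟩ := hf.2.1 n x hx ⟨y, by rw [hy, Cochain.ofHom_v]⟩
  exact ⟨n, by omega, 0, by simp, z, by simp [hz]⟩

/-- A thick class contains the middle term of a sequence `K → L → M[1]`, split exact as a
sequence of graded vector spaces, whenever it contains the outer terms. -/
theorem of_split (hQ : IsThickClass Q)
    (r : ∀ i j : ℤ, i + 0 = j → K.X i →ₗ[k] L.X j) (s : ∀ i : ℤ, L.X i →ₗ[k] K.X i)
    (p : ∀ i j : ℤ, i + 1 = j → L.X i →ₗ[k] M.X j) (t : ∀ i j : ℤ, i + (-1) = j → M.X i →ₗ[k] L.X j)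
    (hr : IsChainMapUpToSign r) (hp : IsChainMapUpToSign p) (ε ε' : ℤˣ)
    (hsplit : ∀ (i j : ℤ) (h : i + 1 = j) (x : L.X i),
      x = ε • t j i (by omega) (p i j h x) + r i i (add_zero i) (s i x))
    (hsr : ∀ (i : ℤ) (z : K.X i), s i (r i i (add_zero i) z) = z)
    (ht : ∀ (i j l n : ℤ) (h : i + (-1) = j) (h' : l + (-1) = n) (_ : n = i) (y : M.X i),
      ∃ z : K.X n, t l n h' ((M.d i l).hom y) =
        ε' • (L.d j n).hom (t i j h y) + r n n (add_zero n) z)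
    (hK : Q K) (hM : Q M) : Q L := by
  refine hQ.middle r p hr hp ?_ hK hM
  rintro n m rfl x hx ⟨y, hy⟩
  obtain ⟨z, hz⟩ := ht (n + 1 - 1) (n - 1) (n + 1) n (by omega) (by omega) (by omega) y
  have hxe : x = r n n (add_zero n) (s n x + ε • z) +
      (L.d (n - 1) n).hom (ε • ε' • t (n + 1 - 1) (n - 1) (by omega) y) := by
    conv_lhs => rw [hsplit n (n + 1) rfl x, ← hy, hz]
    simp only [map_add, lin_units_smul, smul_add]
    abel
  -- The new element is closed because its image under `r` is closed, `r` commutes with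
  -- differentials up to sign, and `s` splits `r`.
  refine ⟨n, add_zero n, s n x + ε • z, ?_, _, hxe⟩
  obtain ⟨ε₁, hε⟩ := hr
  have h₁ := hx
  rw [hxe, map_add, CochainComplex.d_d_apply, add_zero,
    hε n (n + 1) n (n + 1) (add_zero n) (add_zero _)] at h₁
  have h₂ : r (n + 1) (n + 1) (add_zero _) ((K.d n (n + 1)).hom (s n x + ε • z)) = 0 := by
    rwa [smul_eq_zero_iff_eq] at h₁
  rw [← hsr _ ((K.d n (n + 1)).hom (s n x + ε • z)), h₂, map_zero]

end CochainComplex.IsThickClass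

namespace DGModule

variable {C : DGCat.{v, u₁, u₂} k} {M N P P' : DGModule.{v, u₁, u₂, w} C}

/-! ### Homomorphisms of graded modules, in terms of elements -/

/-- The components of a morphism of graded modules. -/
def ap {n : ℤ} (f : homSubmodule M N n) (X : C.Obj) {p q : ℤ} (h : p + n = q) :
    (M.obj X).X p →ₗ[k] (N.obj X).X q :=
  ((f.1 X).v p q h).hom

theorem hom_ext {n : ℤ} {f g : homSubmodule M N n}
    (h : ∀ (X : C.Obj) (p q : ℤ) (hpq : p + n = q) (x : (M.obj X).X p),
      ap f X hpq x = ap g X hpq x) : f = g :=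
  Subtype.ext (funext fun X => Cochain.ext _ _ (fun p q hpq =>
    ModuleCat.hom_ext (LinearMap.ext (h X p q hpq))))

/-- A morphism of graded modules given by its components. -/
def mkHom {n : ℤ} (F : ∀ (X : C.Obj) (p q : ℤ), p + n = q → (M.obj X).X p →ₗ[k] (N.obj X).X q)
    (hF : ∀ (X Y : C.Obj) (q p i q' j : ℤ) (h : q + p = i) (h₁ : q + n = q') (h₂ : i + n = j)
      (m : (M.obj Y).X q) (x : (C.Hom X Y).X p),
      F X i j h₂ (M.act h m x) = N.act (show q' + p = j by omega) (F Y q q' h₁ m) x) :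
    homSubmodule M N n :=
  ⟨fun X => Cochain.mk fun p q h => ModuleCat.ofHom (F X p q h), hF⟩

theorem ap_mkHom {n : ℤ}
    (F : ∀ (X : C.Obj) (p q : ℤ), p + n = q → (M.obj X).X p →ₗ[k] (N.obj X).X q) (hF)
    (X : C.Obj) {p q : ℤ} (h : p + n = q) (x : (M.obj X).X p) :
    ap (mkHom (M := M) (N := N) F hF) X h x = F X p q h x := rfl

theorem ap_act {n : ℤ} (f : homSubmodule M N n) {X Y : C.Obj} {q p i q' j : ℤ} (h : q + p = i)
    (h₁ : q + n = q') (h₂ : i + n = j) (h₃ : q' + p = j) (m : (M.obj Y).X q)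
    (x : (C.Hom X Y).X p) : ap f X h₂ (M.act h m x) = N.act h₃ (ap f Y h₁ m) x :=
  f.2 X Y q p i q' j h h₁ h₂ m x

variable (M N) in
/-- The differential of the complex `Hom_C(M, N)`. -/
def hd (n n' : ℤ) : homSubmodule M N n →ₗ[k] homSubmodule M N n' :=
  ((homComplex M N).d n n').hom

theorem ap_hd {n n' : ℤ} (hn : n + 1 = n') (f : homSubmodule M N n) (X : C.Obj) {p q p' q' : ℤ}
    (h : p + n' = q) (hp : p + 1 = p') (hq : q' + 1 = q) (x : (M.obj X).X p) :
    ap (hd M N n n' f) X h x = ((N.obj X).d q' q).hom (ap f X (by omega) x) +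
      n'.negOnePow • ap f X (by omega) (((M.obj X).d p p').hom x) := by
  have := δ_v n n' hn (f.1 X) p q h q' p' (by omega) hp
  have e := congrArg (fun g => g.hom x) this
  refine e.trans ?_
  simp only [ModuleCat.hom_add, LinearMap.add_apply, hom_units_smul]
  rfl

theorem ap_add {n : ℤ} (f g : homSubmodule M N n) (X : C.Obj) {p q : ℤ} (h : p + n = q)
    (x : (M.obj X).X p) : ap (f + g) X h x = ap f X h x + ap g X h x := rfl

theorem ap_sub {n : ℤ} (f g : homSubmodule M N n) (X : C.Obj) {p q : ℤ} (h : p + n = q)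
    (x : (M.obj X).X p) : ap (f - g) X h x = ap f X h x - ap g X h x := rfl

theorem ap_neg {n : ℤ} (f : homSubmodule M N n) (X : C.Obj) {p q : ℤ} (h : p + n = q)
    (x : (M.obj X).X p) : ap (-f) X h x = - ap f X h x := rfl

theorem ap_zero {n : ℤ} (X : C.Obj) {p q : ℤ} (h : p + n = q)
    (x : (M.obj X).X p) : ap (0 : homSubmodule M N n) X h x = 0 := rfl

theorem ap_homComp {q p n : ℤ} (h : q + p = n) (g : homSubmodule N P q) (f : homSubmodule M N p)
    (X : C.Obj) {i j l : ℤ} (h₁ : i + n = l) (h₂ : i + p = j) (h₃ : j + q = l)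
    (x : (M.obj X).X i) : ap (homComp h g f) X h₁ x = ap g X h₃ (ap f X h₂ x) :=
  congrArg (fun g => g.hom x) (Cochain.comp_v (f.1 X) (g.1 X) (show p + q = n by omega) i j l h₂ h₃)

theorem ap_homId (X : C.Obj) {p : ℤ} (x : (M.obj X).X p) :
    ap (homId M) X (add_zero p) x = x := by
  change ((Cochain.ofHom (𝟙 (M.obj X))).v p p (add_zero p)).hom x = x
  rw [Cochain.ofHom_v]
  rfl

theorem ap_toHom (f : Morphism M N) (X : C.Obj) {p : ℤ} (x : (M.obj X).X p) :
    ap f.toHom X (add_zero p) x = ((f.app X).f p).hom x := by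
  change ((Cochain.ofHom (f.app X)).v p p (add_zero p)).hom x = _
  rw [Cochain.ofHom_v]

theorem hd_comp {q p n q' p' n' : ℤ} (h : q + p = n) (hq : q + 1 = q') (hp : p + 1 = p')
    (hn : n + 1 = n') (g : homSubmodule N P q) (f : homSubmodule M N p) :
    hd M P n n' (homComp h g f) = homComp (show q' + p = n' by omega) (hd N P q q' g) f +
      q.negOnePow • homComp (show q + p' = n' by omega) g (hd M N p p' f) := by
  subst hq hp hn
  exact (dgCat C).d_comp h g f

theorem homComp_assoc {r q p rq qp n : ℤ} (h₁ : r + q = rq) (h₂ : rq + p = n)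
    (h₃ : q + p = qp) (h₄ : r + qp = n) (e : homSubmodule P P' r) (g : homSubmodule N P q)
    (f : homSubmodule M N p) : homComp h₂ (homComp h₁ e g) f = homComp h₄ e (homComp h₃ g f) :=
  (dgCat C).assoc h₁ h₂ h₃ h₄ e g f

theorem id_homComp {p : ℤ} (f : homSubmodule M N p) : homComp (zero_add p) (homId N) f = f :=
  (dgCat C).id_comp f

theorem homComp_id {p : ℤ} (f : homSubmodule M N p) : homComp (add_zero p) f (homId M) = f :=
  (dgCat C).comp_id f

theorem hd_homId : hd M M 0 1 (homId M) = 0 := by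
  refine hom_ext fun X p q h x => ?_
  subst h
  rw [ap_hd (zero_add 1) _ X rfl rfl rfl, ap_homId, ap_homId]
  simp [ap_zero]

theorem hd_toHom (f : Morphism M N) : hd M N 0 1 f.toHom = 0 := by
  refine hom_ext fun X p q h x => ?_
  subst h
  rw [ap_hd (zero_add 1) _ X rfl rfl rfl, ap_toHom, ap_toHom, CochainComplex.hom_comm_apply]
  simp [ap_zero]

/-- A closed morphism of degree `0` is a morphism of dg modules. -/
def Morphism.ofClosed (f : homSubmodule M N 0) (hf : hd M N 0 1 f = 0) : Morphism M N where
  app X :=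
    { f := fun p => ModuleCat.ofHom (ap f X (add_zero p))
      comm' := fun p q h => by
        obtain rfl : p + 1 = q := h
        ext x
        have := congrArg (fun g => ap g X rfl x) hf
        simp only [ap_zero] at this
        rw [ap_hd (zero_add 1) _ X rfl rfl rfl] at this
        simp only [Int.negOnePow_one, Units.neg_smul, one_smul, add_neg_eq_zero] at this
        exact this }
  app_act h m x := ap_act f h _ _ h m x

theorem Morphism.toHom_ofClosed (f : homSubmodule M N 0) (hf : hd M N 0 1 f = 0) :
    (Morphism.ofClosed f hf).toHom = f := by
  refine hom_ext fun X p q h x => ?_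
  obtain rfl : p = q := by omega
  rw [ap_toHom]
  rfl

/-- The composition of morphisms of dg modules. -/
def Morphism.comp (f : Morphism M N) (g : Morphism N P) : Morphism M P where
  app X := f.app X ≫ g.app X
  app_act h m x := by
    change ((g.app _).f _).hom (((f.app _).f _).hom _) = _
    rw [f.app_act, g.app_act]
    rfl

theorem Morphism.toHom_comp (f : Morphism M N) (g : Morphism N P) :
    (f.comp g).toHom = homComp (add_zero 0) g.toHom f.toHom := by
  refine hom_ext fun X p q h x => ?_
  obtain rfl : p = q := by omega
  rw [ap_toHom, ap_homComp _ _ _ X (add_zero p) (add_zero p) (add_zero p), ap_toHom, ap_toHom]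
  rfl

theorem Morphism.IsQuasiIso.comp {f : Morphism M N} {g : Morphism N P} (hf : f.IsQuasiIso)
    (hg : g.IsQuasiIso) : (f.comp g).IsQuasiIso := fun X => by
  have := hf X
  have := hg X
  exact inferInstanceAs (QuasiIso (f.app X ≫ g.app X))

/-- A chain map homotopic to a quasi-isomorphism, on one object, is a quasi-isomorphism. -/
theorem quasiIso_of_homotopy (f g : Morphism M N) (h : homSubmodule M N (-1))
    (hh : hd M N (-1) 0 h = f.toHom - g.toHom) (X : C.Obj) (hg : QuasiIso (g.app X)) :
    QuasiIso (f.app X) := by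
  rw [CochainComplex.quasiIso_iff_isQuasiIsoMap] at hg ⊢
  have key : ∀ (n : ℤ) (x : (M.obj X).X n), ((M.obj X).d n (n + 1)).hom x = 0 →
      ((f.app X).f n).hom x = ((g.app X).f n).hom x +
        ((N.obj X).d (n - 1) n).hom (ap h X (by omega) x) := by
    intro n x hx
    have := congrArg (fun g => ap g X (add_zero n) x) hh
    simp only [ap_sub, ap_toHom] at this
    rw [ap_hd (by omega) _ X (add_zero n) rfl (show n - 1 + 1 = n by omega), hx, map_zero,
      smul_zero, add_zero] at this
    rw [this]
    abel
  refine ⟨fun i j x => CochainComplex.hom_comm_apply _ i j x, fun n x hx ⟨y, hy⟩ => ?_,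
    fun n y hy => ?_⟩
  · refine hg.2.1 n x hx ⟨y - ap h X (by omega) x, ?_⟩
    rw [map_sub, hy, key n x hx]
    abel
  · obtain ⟨x, hx, z, hz⟩ := hg.2.2 n y hy
    refine ⟨x, hx, z - ap h X (by omega) x, ?_⟩
    rw [map_sub, hz, key n x hx]
    abel

end DGModule

/-! ### Mapping cones in terms of elements -/

namespace CochainComplex

variable {K L : CochainComplex (ModuleCat.{w} k) ℤ} (g : K ⟶ L)

/-- The element of the mapping cone with given components. -/
def coneMk {i j : ℤ} (h : i + 1 = j) (a : K.X j) (b : L.X i) : (mappingCone g).X i :=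
  ((mappingCone.inl g).v j i (by omega)).hom a + ((mappingCone.inr g).f i).hom b

theorem fst_coneMk {i j : ℤ} (h : i + 1 = j) (a : K.X j) (b : L.X i) :
    ((mappingCone.fst g).1.v i j h).hom (coneMk g h a b) = a := by
  rw [coneMk, map_add, DGModule.cone_fst_inl, DGModule.cone_fst_inr, add_zero]

theorem snd_coneMk {i j : ℤ} (h : i + 1 = j) (a : K.X j) (b : L.X i) :
    ((mappingCone.snd g).v i i (add_zero i)).hom (coneMk g h a b) = b := by
  rw [coneMk, map_add, DGModule.cone_snd_inl, DGModule.cone_snd_inr, zero_add]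

theorem coneMk_fst_snd {i j : ℤ} (h : i + 1 = j) (x : (mappingCone g).X i) :
    coneMk g h (((mappingCone.fst g).1.v i j h).hom x)
      (((mappingCone.snd g).v i i (add_zero i)).hom x) = x :=
  DGModule.cone_ext g h (fst_coneMk g h _ _) (snd_coneMk g h _ _)

theorem exists_coneMk {i j : ℤ} (h : i + 1 = j) (x : (mappingCone g).X i) :
    ∃ a b, x = coneMk g h a b :=
  ⟨_, _, (coneMk_fst_snd g h x).symm⟩

theorem d_coneMk {i j l : ℤ} (h : i + 1 = j) (h' : j + 1 = l) (a : K.X j) (b : L.X i) :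
    ((mappingCone g).d i j).hom (coneMk g h a b) =
      coneMk g h' (-(K.d j l).hom a) ((g.f j).hom a + (L.d i j).hom b) := by
  refine DGModule.cone_ext g h' ?_ ?_
  · rw [DGModule.cone_fst_d g h h', fst_coneMk, fst_coneMk]
  · rw [DGModule.cone_snd_d g h (add_zero i), fst_coneMk, snd_coneMk, snd_coneMk]

theorem coneMk_eq_iff {i j : ℤ} (h : i + 1 = j) (a a' : K.X j) (b b' : L.X i) :
    coneMk g h a b = coneMk g h a' b' ↔ a = a' ∧ b = b' := by
  constructor
  · intro e
    refine ⟨?_, ?_⟩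
    · rw [← fst_coneMk g h a b, e, fst_coneMk]
    · rw [← snd_coneMk g h a b, e, snd_coneMk]
  · rintro ⟨rfl, rfl⟩
    rfl

theorem coneMk_zero {i j : ℤ} (h : i + 1 = j) : coneMk g h 0 0 = 0 := by
  simp [coneMk]

theorem coneMk_add {i j : ℤ} (h : i + 1 = j) (a a' : K.X j) (b b' : L.X i) :
    coneMk g h a b + coneMk g h a' b' = coneMk g h (a + a') (b + b') := by
  simp only [coneMk, map_add]
  abel

theorem coneMk_sub {i j : ℤ} (h : i + 1 = j) (a a' : K.X j) (b b' : L.X i) :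
    coneMk g h a b - coneMk g h a' b' = coneMk g h (a - a') (b - b') := by
  simp only [coneMk, map_sub]
  abel

theorem coneMk_eq_zero_iff {i j : ℤ} (h : i + 1 = j) (a : K.X j) (b : L.X i) :
    coneMk g h a b = 0 ↔ a = 0 ∧ b = 0 := by
  rw [← coneMk_zero g h, coneMk_eq_iff]

/-- A cocycle `(a, b)` of the cone is a cocycle `a` together with a cochain `-b` bounding its image
under `g`. -/
theorem acyclic_mappingCone_iff : (mappingCone g).Acyclic ↔ QuasiIso g := by
  rw [quasiIso_iff_isQuasiIsoMap]
  constructor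
  · intro H
    refine ⟨fun i j x => hom_comm_apply g i j x, fun n x hx ⟨y, hy⟩ => ?_, fun n y hy => ?_⟩
    · obtain ⟨z, hz⟩ := exists_d_eq_of_acyclic H (show n - 1 - 1 + 1 = n - 1 by omega)
        (show n - 1 + 1 = n by omega) (coneMk g (by omega) x (-y)) (by
        rw [d_coneMk g (show n - 1 + 1 = n by omega) rfl, coneMk_eq_zero_iff, map_neg, hy, hx]
        simp)
      obtain ⟨a, b, rfl⟩ := exists_coneMk g (show n - 1 - 1 + 1 = n - 1 by omega) z
      rw [d_coneMk g (show n - 1 - 1 + 1 = n - 1 by omega) (show n - 1 + 1 = n by omega),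
        coneMk_eq_iff] at hz
      exact ⟨-a, by rw [map_neg, hz.1]⟩
    · obtain ⟨z, hz⟩ := exists_d_eq_of_acyclic H (show n - 1 + 1 = n by omega) rfl
        (coneMk g rfl 0 y) (by
        rw [d_coneMk g rfl rfl, coneMk_eq_zero_iff, hy]
        simp)
      obtain ⟨a, b, rfl⟩ := exists_coneMk g (show n - 1 + 1 = n by omega) z
      rw [d_coneMk g (show n - 1 + 1 = n by omega) rfl, coneMk_eq_iff] at hz
      refine ⟨a, by simpa using hz.1, b, ?_⟩
      rw [← hz.2]
      abel
  · intro H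
    rw [acyclic_iff_exists]
    intro n x hx
    obtain ⟨a, b, rfl⟩ := exists_coneMk g rfl x
    rw [d_coneMk g rfl rfl, coneMk_eq_zero_iff, neg_eq_zero] at hx
    obtain ⟨a₂, ha₂⟩ := H.exists_d_eq rfl rfl a hx.1 (-b) (by
      rw [map_neg]
      exact (eq_neg_of_add_eq_zero_left hx.2).symm)
    -- The choice of `a₂` need not be compatible with `b`: the discrepancy `b + g a₂` is a cocycle,
    -- which surjectivity on cohomology replaces by some `g c` up to a boundary. Then `(c - a₂, e)`
    -- bounds `(a, b)`.
    obtain ⟨c, hc, e, he⟩ := H.2.2 n (b + (g.f n).hom a₂) (by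
      rw [map_add, hom_comm_apply, ha₂]
      exact (add_comm _ _).trans hx.2)
    refine ⟨coneMk g (by omega) (c - a₂) e, ?_⟩
    rw [d_coneMk g (show n - 1 + 1 = n by omega) rfl, coneMk_eq_iff]
    refine ⟨?_, ?_⟩
    · rw [map_sub, hc, ha₂]
      simp
    · rw [he, map_sub]
      abel

end CochainComplex

namespace DGModule

open CochainComplex

variable {C : DGCat.{v, u₁, u₂} k} {M N P P' : DGModule.{v, u₁, u₂, w} C}

/-! ### The graded structure of cones and shifts -/

section Cone

variable (f : Morphism M N)

/-- The element of the cone with given components. -/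
def coneElt (X : C.Obj) {i j : ℤ} (h : i + 1 = j) (a : (M.obj X).X j) (b : (N.obj X).X i) :
    ((cone f).obj X).X i := coneMk (f.app X) h a b

theorem exists_coneElt (X : C.Obj) {i j : ℤ} (h : i + 1 = j) (x : ((cone f).obj X).X i) :
    ∃ a b, x = coneElt f X h a b := exists_coneMk (f.app X) h x

theorem coneElt_add (X : C.Obj) {i j : ℤ} (h : i + 1 = j) (a a' : (M.obj X).X j)
    (b b' : (N.obj X).X i) :
    coneElt f X h a b + coneElt f X h a' b' = coneElt f X h (a + a') (b + b') :=
  coneMk_add _ h a a' b b'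

theorem coneElt_sub (X : C.Obj) {i j : ℤ} (h : i + 1 = j) (a a' : (M.obj X).X j)
    (b b' : (N.obj X).X i) :
    coneElt f X h a b - coneElt f X h a' b' = coneElt f X h (a - a') (b - b') :=
  coneMk_sub _ h a a' b b'

theorem coneElt_eq_iff (X : C.Obj) {i j : ℤ} (h : i + 1 = j) (a a' : (M.obj X).X j)
    (b b' : (N.obj X).X i) : coneElt f X h a b = coneElt f X h a' b' ↔ a = a' ∧ b = b' :=
  coneMk_eq_iff _ h a a' b b'

theorem coneElt_eq_zero_iff (X : C.Obj) {i j : ℤ} (h : i + 1 = j) (a : (M.obj X).X j)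
    (b : (N.obj X).X i) : coneElt f X h a b = 0 ↔ a = 0 ∧ b = 0 :=
  coneMk_eq_zero_iff _ h a b

theorem d_coneElt (X : C.Obj) {i j l : ℤ} (h : i + 1 = j) (h' : j + 1 = l) (a : (M.obj X).X j)
    (b : (N.obj X).X i) :
    (((cone f).obj X).d i j).hom (coneElt f X h a b) =
      coneElt f X h' (-((M.obj X).d j l).hom a)
        (((f.app X).f j).hom a + ((N.obj X).d i j).hom b) :=
  d_coneMk _ h h' a b

theorem act_coneElt {X Y : C.Obj} {q p n q' n' : ℤ} (h : q + p = n) (hq : q + 1 = q')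
    (hn : n + 1 = n') (a : (M.obj Y).X q') (b : (N.obj Y).X q) (x : (C.Hom X Y).X p) :
    (cone f).act h (coneElt f Y hq a b) x =
      coneElt f X hn (M.act (by omega) a x) (N.act h b x) := by
  subst hq hn
  refine cone_ext (f.app X) rfl ?_ ?_
  · refine (cone_fst_act f h _ x).trans ?_
    rw [coneElt, fst_coneMk, coneElt, fst_coneMk]
  · refine (cone_snd_act f h _ x).trans ?_
    rw [coneElt, snd_coneMk, coneElt, snd_coneMk]

/-- The inclusion `M → cone(f)` of degree `-1`. -/
def coneInl : homSubmodule M (cone f) (-1) :=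
  mkHom (fun X p q h => ((mappingCone.inl (f.app X)).v p q h).hom) (by
    intro X Y q p i q' j h h₁ h₂ m x
    have e (X : C.Obj) (p q : ℤ) (h : p + (-1) = q) (m : (M.obj X).X p) :
      ((mappingCone.inl (f.app X)).v p q h).hom m = coneElt f X (by omega) m 0 := by
      simp [coneElt, coneMk]
    refine (e X i j h₂ _).trans ?_
    refine Eq.trans ?_ (congrArg (fun z => (cone f).act _ z x) (e Y q q' h₁ m)).symm
    refine Eq.trans ?_ (act_coneElt f (show q' + p = j by omega) (show q' + 1 = q by omega)
      (show j + 1 = i by omega) m 0 x).symm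
    rw [map_zero, LinearMap.zero_apply])

/-- The inclusion `N → cone(f)`. -/
def coneInr : homSubmodule N (cone f) 0 :=
  mkHom (fun X p q h => ((Cochain.ofHom (mappingCone.inr (f.app X))).v p q h).hom) (by
    intro X Y q p i q' j h h₁ h₂ m x
    obtain rfl : q = q' := by omega
    obtain rfl : i = j := by omega
    have e (X : C.Obj) (p : ℤ) (m : (N.obj X).X p) :
      ((Cochain.ofHom (mappingCone.inr (f.app X))).v p p (add_zero p)).hom m =
        coneElt f X rfl 0 m := by
      rw [Cochain.ofHom_v]
      simp [coneElt, coneMk]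
    refine (e X i _).trans ?_
    refine Eq.trans ?_ (congrArg (fun z => (cone f).act _ z x) (e Y q m)).symm
    refine Eq.trans ?_ (act_coneElt f h _ rfl 0 m x).symm
    rw [map_zero, LinearMap.zero_apply])

/-- The projection `cone(f) → M` of degree `1`. -/
def coneFst : homSubmodule (cone f) M 1 :=
  mkHom (fun X p q h => ((mappingCone.fst (f.app X)).1.v p q h).hom) (by
    intro X Y q p i q' j h h₁ h₂ m x
    subst h₁ h₂
    exact cone_fst_act f h m x)

/-- The projection `cone(f) → N` of degree `0`, which does not commute with the differentials. -/
def coneSnd : homSubmodule (cone f) N 0 :=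
  mkHom (fun X p q h => ((mappingCone.snd (f.app X)).v p q h).hom) (by
    intro X Y q p i q' j h h₁ h₂ m x
    obtain rfl : q = q' := by omega
    obtain rfl : i = j := by omega
    exact cone_snd_act f h m x)

theorem ap_coneInl (X : C.Obj) {p q : ℤ} (h : p + (-1) = q) (m : (M.obj X).X p) :
    ap (coneInl f) X h m = coneElt f X (by omega) m 0 := by
  change ((mappingCone.inl (f.app X)).v p q h).hom m = _
  simp [coneElt, coneMk]

theorem ap_coneInr (X : C.Obj) {p : ℤ} (h : p + 0 = p) (m : (N.obj X).X p) :
    ap (coneInr f) X h m = coneElt f X rfl 0 m := by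
  change ((Cochain.ofHom (mappingCone.inr (f.app X))).v p p (add_zero p)).hom m = _
  rw [Cochain.ofHom_v]
  simp [coneElt, coneMk]

theorem ap_coneFst (X : C.Obj) {p q : ℤ} (h : p + 1 = q) (a : (M.obj X).X q) (b : (N.obj X).X p) :
    ap (coneFst f) X h (coneElt f X h a b) = a :=
  fst_coneMk _ h a b

theorem ap_coneSnd (X : C.Obj) {p q : ℤ} (h : p + 1 = q) (h' : p + 0 = p) (a : (M.obj X).X q)
    (b : (N.obj X).X p) : ap (coneSnd f) X h' (coneElt f X h a b) = b :=
  snd_coneMk _ h a b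

theorem coneFst_comp_coneInl :
    homComp (show (1 : ℤ) + (-1) = 0 by omega) (coneFst f) (coneInl f) = homId M := by
  refine hom_ext fun X p q h x => ?_
  obtain rfl : p = q := by omega
  rw [ap_homComp _ _ _ X h (show p + (-1) = p - 1 by omega) (show p - 1 + 1 = p by omega),
    ap_coneInl, ap_coneFst, ap_homId]

theorem coneSnd_comp_coneInr : homComp (add_zero 0) (coneSnd f) (coneInr f) = homId N := by
  refine hom_ext fun X p q h x => ?_
  obtain rfl : p = q := by omega
  rw [ap_homComp _ _ _ X h (add_zero p) (add_zero p), ap_coneInr, ap_coneSnd, ap_homId]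

theorem cone_decomposition :
    homComp (show (-1 : ℤ) + 1 = 0 by omega) (coneInl f) (coneFst f) +
      homComp (add_zero 0) (coneInr f) (coneSnd f) = homId (cone f) := by
  refine hom_ext fun X p q h x => ?_
  obtain rfl : p = q := by omega
  obtain ⟨a, b, rfl⟩ := exists_coneElt f X rfl x
  rw [ap_add, ap_homComp _ _ _ X h rfl (show p + 1 + (-1) = p by omega),
    ap_homComp _ _ _ X h (add_zero p) (add_zero p), ap_coneFst, ap_coneSnd, ap_coneInl, ap_coneInr,
    ap_homId, coneElt_add, add_zero, zero_add]

theorem hd_coneInr : hd N (cone f) 0 1 (coneInr f) = 0 := by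
  refine hom_ext fun X p q h x => ?_
  subst h
  rw [ap_hd (zero_add 1) _ X rfl rfl rfl, ap_coneInr, ap_coneInr, ap_zero, d_coneElt f X rfl rfl]
  simp

theorem hd_coneInl :
    hd M (cone f) (-1) 0 (coneInl f) = homComp (add_zero 0) (coneInr f) f.toHom := by
  refine hom_ext fun X p q h x => ?_
  obtain rfl : p = q := by omega
  rw [ap_hd (by omega) _ X h rfl (show p - 1 + 1 = p by omega), ap_coneInl, ap_coneInl,
    ap_homComp _ _ _ X h (add_zero p) (add_zero p), ap_toHom, ap_coneInr,
    d_coneElt f X (show p - 1 + 1 = p by omega) rfl, Int.negOnePow_zero, one_smul, coneElt_add]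
  simp

theorem hd_coneFst : hd (cone f) M 1 2 (coneFst f) = 0 := by
  refine hom_ext fun X p q h x => ?_
  obtain ⟨a, b, rfl⟩ := exists_coneElt f X rfl x
  rw [ap_hd (by omega) _ X h rfl (show p + 1 + 1 = q by omega), ap_coneFst, ap_zero,
    d_coneElt f X rfl (show p + 1 + 1 = q by omega), ap_coneFst,
    show (2 : ℤ).negOnePow = 1 from rfl, one_smul, add_neg_cancel]

theorem hd_coneSnd : hd (cone f) N 0 1 (coneSnd f) =
    -homComp (zero_add 1) f.toHom (coneFst f) := by
  refine hom_ext fun X p q h x => ?_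
  subst h
  obtain ⟨a, b, rfl⟩ := exists_coneElt f X rfl x
  rw [ap_hd (by omega) _ X rfl rfl rfl, ap_coneSnd, ap_neg,
    ap_homComp _ _ _ X rfl rfl (add_zero _), ap_coneFst, ap_toHom, d_coneElt f X rfl rfl,
    ap_coneSnd _ _ rfl, Int.negOnePow_one, Units.neg_smul, one_smul]
  abel

end Cone

section Shift

variable (M) (a : ℤ)

/-- The identification `M → M[a]`, of degree `-a`. -/
def toShift : homSubmodule M (M.shift a) (-a) :=
  mkHom (fun X p q h => (by
    obtain rfl : p = q + a := by omega
    exact LinearMap.id)) (by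
    intro X Y q p i q' j h h₁ h₂ m x
    obtain rfl : q = q' + a := by omega
    obtain rfl : i = j + a := by omega
    rfl)

/-- The identification `M[a] → M`, of degree `a`. -/
def ofShift : homSubmodule (M.shift a) M a :=
  mkHom (fun X p q h => (by
    subst h
    exact LinearMap.id)) (by
    intro X Y q p i q' j h h₁ h₂ m x
    subst h₁ h₂
    rfl)

theorem ap_toShift (X : C.Obj) {q : ℤ} (h : q + a + -a = q) (x : (M.obj X).X (q + a)) :
    ap (M.toShift a) X h x = x := rfl

theorem ap_ofShift (X : C.Obj) {q : ℤ} (x : ((M.shift a).obj X).X q) :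
    ap (M.ofShift a) X rfl x = x := rfl

theorem toShift_comp_ofShift :
    homComp (neg_add_cancel a) (M.toShift a) (M.ofShift a) = homId (M.shift a) := by
  refine hom_ext fun X p q h x => ?_
  obtain rfl : p = q := by omega
  rw [ap_homComp _ _ _ X h rfl (show p + a + -a = p by omega), ap_homId]
  rfl

theorem hd_ofShift (b : ℤ) : hd (M.shift a) M a b (M.ofShift a) = 0 := by
  by_cases hb : a + 1 = b
  · subst hb
    refine hom_ext fun X p q h x => ?_
    obtain rfl : q = p + 1 + a := by omega
    rw [ap_hd rfl _ X h rfl (show p + a + 1 = p + 1 + a by omega), ap_zero, ap_ofShift, ap_ofShift]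
    change (M.obj X).X (p + a) at x
    change ((M.obj X).d (p + a) (p + 1 + a)).hom x + (a + 1).negOnePow •
      (a.negOnePow • (M.obj X).d (p + a) (p + 1 + a)).hom x = 0
    rw [hom_units_smul, smul_smul, ← Int.negOnePow_add,
      show (a + 1 + a).negOnePow = -1 by
        rw [show a + 1 + a = a + a + 1 by ring, Int.negOnePow_succ, Int.negOnePow_even _ ⟨a, rfl⟩],
      Units.neg_smul, one_smul, add_neg_cancel]
  · exact congrArg (fun g => g.hom (M.ofShift a)) ((homComplex (M.shift a) M).shape a b hb)

theorem hd_toShift (b : ℤ) : hd M (M.shift a) (-a) b (M.toShift a) = 0 := by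
  by_cases hb : -a + 1 = b
  · subst hb
    refine hom_ext fun X p q h x => ?_
    obtain ⟨r, rfl⟩ : ∃ r, p = r + a := ⟨p - a, by omega⟩
    obtain rfl : q = r + 1 := by omega
    rw [ap_hd rfl _ X h (show r + a + 1 = r + 1 + a by omega) rfl, ap_zero, ap_toShift, ap_toShift]
    change (M.obj X).X (r + a) at x
    change (a.negOnePow • (M.obj X).d (r + a) (r + 1 + a)).hom x +
      (-a + 1).negOnePow • ((M.obj X).d (r + a) (r + 1 + a)).hom x = 0
    rw [hom_units_smul, Int.negOnePow_succ, Int.negOnePow_neg, Units.neg_smul, add_neg_cancel]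
  · exact congrArg (fun g => g.hom (M.toShift a)) ((homComplex M (M.shift a)).shape (-a) b hb)

end Shift

end DGModule

/-! ### Leibniz rules, lifting and closure properties of h-projective modules. -/

namespace DGModule

open CochainComplex

variable {C : DGCat.{v, u₁, u₂} k} {M N P P' : DGModule.{v, u₁, u₂, w} C}

theorem units_smul_homComp {q p n : ℤ} (h : q + p = n) (ε : ℤˣ) (g : homSubmodule N P q)
    (f : homSubmodule M N p) : homComp h (ε • g) f = ε • homComp h g f :=
  lin_units_smul₂ (homComp h) ε g f

theorem hd_units_smul {n n' : ℤ} (ε : ℤˣ) (f : homSubmodule M N n) :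
    hd M N n n' (ε • f) = ε • hd M N n n' f :=
  lin_units_smul (hd M N n n') ε f

theorem homComp_sub_left {q p n : ℤ} (h : q + p = n) (g g' : homSubmodule N P q)
    (f : homSubmodule M N p) : homComp h (g - g') f = homComp h g f - homComp h g' f := by
  rw [map_sub, LinearMap.sub_apply]

theorem homComp_add_left {q p n : ℤ} (h : q + p = n) (g g' : homSubmodule N P q)
    (f : homSubmodule M N p) : homComp h (g + g') f = homComp h g f + homComp h g' f := by
  rw [map_add, LinearMap.add_apply]

theorem homComp_neg_left {q p n : ℤ} (h : q + p = n) (g : homSubmodule N P q)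
    (f : homSubmodule M N p) : homComp h (-g) f = -homComp h g f := by
  rw [map_neg, LinearMap.neg_apply]

theorem homComp_zero_left {q p n : ℤ} (h : q + p = n)
    (f : homSubmodule M N p) : homComp h (0 : homSubmodule N P q) f = 0 := by
  rw [map_zero, LinearMap.zero_apply]

/-- The Leibniz rule when the first factor is closed. -/
theorem hd_comp_of_closed_left {q p n q' p' n' : ℤ} (h : q + p = n) (hq : q + 1 = q')
    (hp : p + 1 = p') (hn : n + 1 = n') (g : homSubmodule N P q) (hg : hd N P q q' g = 0)
    (f : homSubmodule M N p) : hd M P n n' (homComp h g f) =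
      q.negOnePow • homComp (show q + p' = n' by omega) g (hd M N p p' f) := by
  rw [hd_comp h hq hp hn, hg, homComp_zero_left, zero_add]

/-- The Leibniz rule when the second factor is closed. -/
theorem hd_comp_of_closed_right {q p n q' p' n' : ℤ} (h : q + p = n) (hq : q + 1 = q')
    (hp : p + 1 = p') (hn : n + 1 = n') (g : homSubmodule N P q)
    (f : homSubmodule M N p) (hf : hd M N p p' f = 0) : hd M P n n' (homComp h g f) =
      homComp (show q' + p = n' by omega) (hd N P q q' g) f := by
  rw [hd_comp h hq hp hn, hf, map_zero, smul_zero, add_zero]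

theorem hd_comp_closed {q p n q' p' n' : ℤ} (h : q + p = n) (hq : q + 1 = q')
    (hp : p + 1 = p') (hn : n + 1 = n') (g : homSubmodule N P q) (hg : hd N P q q' g = 0)
    (f : homSubmodule M N p) (hf : hd M N p p' f = 0) : hd M P n n' (homComp h g f) = 0 := by
  rw [hd_comp_of_closed_left h hq hp hn g hg, hf, map_zero, smul_zero]

theorem coneFst_comp_coneInr (f : Morphism M N) :
    homComp (add_zero 1) (coneFst f) (coneInr f) = 0 := by
  refine hom_ext fun X p q h x => ?_
  rw [ap_homComp _ _ _ X h (add_zero p) h, ap_coneInr, ap_zero]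
  subst h
  exact ap_coneFst f X rfl 0 x

/-! ### Lifting along quasi-isomorphisms -/

theorem acyclic_cone_iff (f : Morphism M N) (X : C.Obj) :
    ((cone f).obj X).Acyclic ↔ QuasiIso (f.app X) :=
  acyclic_mappingCone_iff (f.app X)

theorem IsHProjective.exists_hd_eq (hP : P.IsHProjective) (hN : ∀ X : C.Obj, (N.obj X).Acyclic)
    {i j l : ℤ} (h : i + 1 = j) (h' : j + 1 = l) (f : homSubmodule P N j)
    (hf : hd P N j l f = 0) : ∃ g : homSubmodule P N i, hd P N i j g = f :=
  exists_d_eq_of_acyclic (hP N hN) h h' f hf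

/-- The cone of `s` is acyclic, so `inr ∘ f` bounds some cochain with values in it. The two
components of that cochain are the lift and the homotopy. -/
theorem IsHProjective.exists_lift (hP : P.IsHProjective) (s : Morphism M N) (hs : s.IsQuasiIso)
    {i j l : ℤ} (h : i + 1 = j) (h' : j + 1 = l) (f : homSubmodule P N j)
    (hf : hd P N j l f = 0) : ∃ (g : homSubmodule P M j) (e : homSubmodule P N i),
      hd P M j l g = 0 ∧ hd P N i j e = f - homComp (zero_add j) s.toHom g := by
  obtain ⟨G, hG⟩ := hP.exists_hd_eq (fun X => (acyclic_cone_iff s X).2 (hs X)) h h'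
    (homComp (zero_add j) (coneInr s) f)
    (hd_comp_closed _ (zero_add 1) h' h' _ (hd_coneInr s) _ hf)
  refine ⟨homComp (show 1 + i = j by omega) (coneFst s) G,
    homComp (zero_add i) (coneSnd s) G, ?_, ?_⟩
  · rw [hd_comp_of_closed_left _ rfl h h' _ (hd_coneFst s), hG,
      ← homComp_assoc (add_zero 1) (show 1 + j = l by omega) _ _, coneFst_comp_coneInr,
      homComp_zero_left, smul_zero]
  · rw [hd_comp _ (zero_add 1) h h, hd_coneSnd, hG, homComp_neg_left,
      homComp_assoc (zero_add 1) _ (show 1 + i = j by omega) (zero_add j),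
      ← homComp_assoc (add_zero 0) (zero_add j) (zero_add j) (zero_add j), coneSnd_comp_coneInr,
      id_homComp, Int.negOnePow_zero, one_smul]
    abel

/-- Composition with `s` is injective on cohomology: the pair `(g, -e)` is a cocycle with values in
the acyclic cone of `s`, and minus the first component of a cochain bounding it bounds `g`. -/
theorem IsHProjective.exists_hd_eq_of_comp (hP : P.IsHProjective) (s : Morphism M N)
    (hs : s.IsQuasiIso) {i j l : ℤ} (h : i + 1 = j) (h' : j + 1 = l) (g : homSubmodule P M j)
    (hg : hd P M j l g = 0) (e : homSubmodule P N i)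
    (he : hd P N i j e = homComp (zero_add j) s.toHom g) :
    ∃ e' : homSubmodule P M i, hd P M i j e' = g := by
  obtain ⟨E, hE⟩ := hP.exists_hd_eq (fun X => (acyclic_cone_iff s X).2 (hs X))
    (show i - 1 + 1 = i by omega) h
    (homComp (show -1 + j = i by omega) (coneInl s) g - homComp (zero_add i) (coneInr s) e) (by
      rw [map_sub, hd_comp_of_closed_right _ (show (-1 : ℤ) + 1 = 0 by omega) h' h _ _ hg,
        hd_coneInl, hd_comp_of_closed_left _ (zero_add 1) h h _ (hd_coneInr s), he,
        homComp_assoc (add_zero 0) _ (zero_add j) (zero_add j), Int.negOnePow_zero, one_smul,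
        sub_self])
  refine ⟨-homComp (show 1 + (i - 1) = i by omega) (coneFst s) E, ?_⟩
  rw [map_neg, hd_comp_of_closed_left _ rfl (show i - 1 + 1 = i by omega) h _ (hd_coneFst s), hE,
    map_sub, ← homComp_assoc (show (1 : ℤ) + (-1) = 0 by omega) (zero_add j) _ _,
    coneFst_comp_coneInl, id_homComp,
    ← homComp_assoc (add_zero 1) (show 1 + i = j by omega) _ _, coneFst_comp_coneInr,
    homComp_zero_left, sub_zero, Int.negOnePow_one, Units.neg_smul, one_smul, neg_neg]

/-- Lifting of morphisms of dg modules. -/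
theorem IsHProjective.exists_lift_morphism (hP : P.IsHProjective) (s : Morphism M N)
    (hs : s.IsQuasiIso) (f : Morphism P N) : ∃ (g : Morphism P M) (e : homSubmodule P N (-1)),
      hd P N (-1) 0 e = f.toHom - (g.comp s).toHom := by
  obtain ⟨g, e, hg, he⟩ := hP.exists_lift s hs (show (-1 : ℤ) + 1 = 0 by omega) (zero_add 1)
    f.toHom (hd_toHom f)
  refine ⟨Morphism.ofClosed g hg, e, ?_⟩
  rw [he, Morphism.toHom_comp, Morphism.toHom_ofClosed]

/-- The identity morphism. -/
def Morphism.id (M : DGModule.{v, u₁, u₂, w} C) : Morphism M M where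
  app _ := 𝟙 _
  app_act _ _ _ := rfl

theorem Morphism.toHom_id : (Morphism.id M).toHom = homId M := by
  refine hom_ext fun X p q h x => ?_
  obtain rfl : p = q := by omega
  rw [ap_toHom, ap_homId]
  rfl

/-- A lift of a quasi-isomorphism, on one object, is a quasi-isomorphism. -/
theorem quasiIso_of_lift {s : Morphism M N} (X : C.Obj) (hs : QuasiIso (s.app X)) {f : Morphism P N}
    (hf : QuasiIso (f.app X)) {g : Morphism P M} {e : homSubmodule P N (-1)}
    (he : hd P N (-1) 0 e = f.toHom - (g.comp s).toHom) : QuasiIso (g.app X) := by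
  have := quasiIso_of_homotopy (g.comp s) f (-e) (by rw [map_neg, he]; abel) X hf
  change QuasiIso (g.app X ≫ s.app X) at this
  exact quasiIso_of_comp_right (g.app X) (s.app X)

/-! ### Closure properties of h-projective modules -/

/-- Conjugation by the closed invertible homomorphism `toShift` moves the problem to `M`. -/
theorem IsHProjective.shift (hM : M.IsHProjective) (a : ℤ) : (M.shift a).IsHProjective := by
  intro N hN
  rw [acyclic_iff_exists]
  intro n f hf
  change homSubmodule (M.shift a) N n at f
  change hd (M.shift a) N n (n + 1) f = 0 at hf
  obtain ⟨g, hg⟩ := hM.exists_hd_eq hN (show n - a - 1 + 1 = n - a by omega) rfl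
    (homComp (show n + -a = n - a by omega) f (M.toShift a))
    (hd_comp_closed _ rfl rfl rfl _ hf _ (hd_toShift M a _))
  refine ⟨homComp (show n - a - 1 + a = n - 1 by omega) g (M.ofShift a), ?_⟩
  refine (hd_comp_of_closed_right _ (show n - a - 1 + 1 = n - a by omega) rfl
    (show n - 1 + 1 = n by omega) _ _ (hd_ofShift M a _)).trans ?_
  rw [hg, homComp_assoc _ _ (neg_add_cancel a) (add_zero n), toShift_comp_ofShift, homComp_id]

/-- The bounding cochain is found on `N` first. The restriction of `F` to `M`, corrected by that
cochain composed with `f`, is then closed and bounds as well. -/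
theorem IsHProjective.cone (hM : M.IsHProjective) (hN : N.IsHProjective) (f : Morphism M N) :
    (DGModule.cone f).IsHProjective := by
  intro L hL
  rw [acyclic_iff_exists]
  intro n F hF
  change homSubmodule (DGModule.cone f) L n at F
  change hd (DGModule.cone f) L n (n + 1) F = 0 at hF
  obtain ⟨c, hc⟩ := hN.exists_hd_eq hL (show n - 1 + 1 = n by omega) rfl
    (homComp (add_zero n) F (coneInr f))
    (hd_comp_closed _ rfl (zero_add 1) rfl _ hF _ (hd_coneInr f))
  obtain ⟨b, hb⟩ := hM.exists_hd_eq hL (show n - 1 - 1 + 1 = n - 1 by omega)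
    (show n - 1 + 1 = n by omega)
    (homComp (show n + (-1) = n - 1 by omega) F (coneInl f) -
      n.negOnePow • homComp (add_zero (n - 1)) c f.toHom) (by
    rw [map_sub, hd_comp_of_closed_left _ rfl (show (-1 : ℤ) + 1 = 0 by omega)
      (show n - 1 + 1 = n by omega) _ hF, hd_units_smul, hd_comp_of_closed_right _
      (show n - 1 + 1 = n by omega) (zero_add 1) (show n - 1 + 1 = n by omega) _ _ (hd_toHom f), hc,
      hd_coneInl, ← homComp_assoc (add_zero n) (add_zero n) (add_zero 0) (add_zero n), sub_self])
  refine ⟨homComp (show n - 1 - 1 + 1 = n - 1 by omega) b (coneFst f) +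
    homComp (add_zero (n - 1)) c (coneSnd f), ?_⟩
  change hd (DGModule.cone f) L (n - 1) n _ = F
  rw [map_add, hd_comp_of_closed_right _ (show n - 1 - 1 + 1 = n - 1 by omega) rfl
    (show n - 1 + 1 = n by omega) _ _ (hd_coneFst f), hb,
    hd_comp _ (show n - 1 + 1 = n by omega) (zero_add 1) (show n - 1 + 1 = n by omega), hc,
    hd_coneSnd, map_neg, homComp_sub_left, units_smul_homComp,
    homComp_assoc (show n + (-1) = n - 1 by omega) _ (show (-1 : ℤ) + 1 = 0 by omega) (add_zero n),
    homComp_assoc (add_zero n) _ (add_zero 0) (add_zero n),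
    homComp_assoc (add_zero (n - 1)) _ (zero_add 1) (show n - 1 + 1 = n by omega),
    show n.negOnePow = -(n - 1).negOnePow by rw [← Int.negOnePow_succ, sub_add_cancel],
    Units.neg_smul, smul_neg]
  conv_rhs => rw [← homComp_id F, ← cone_decomposition f, map_add]
  abel

/-- A morphism between cones given by a square which commutes up to homotopy. -/
theorem exists_cone_quasiIso {M' N' : DGModule.{v, u₁, u₂, w} C} (f : Morphism M N)
    (f' : Morphism M' N') (s : Morphism M' M) (t : Morphism N' N) (hs : s.IsQuasiIso)
    (ht : t.IsQuasiIso) (e : homSubmodule M' N (-1))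
    (he : hd M' N (-1) 0 e = (f'.comp t).toHom - (s.comp f).toHom) :
    ∃ c : Morphism (DGModule.cone f') (DGModule.cone f), c.IsQuasiIso := by
  -- The triangular matrix `(a, b) ↦ (s a, t b + e a)`: the homotopy is the off-diagonal entry that
  -- makes it closed.
  let c : homSubmodule (DGModule.cone f') (DGModule.cone f) 0 :=
    homComp (show -1 + 1 = 0 by omega) (coneInl f) (homComp (zero_add 1) s.toHom (coneFst f')) +
    homComp (add_zero 0) (coneInr f) (homComp (add_zero 0) t.toHom (coneSnd f') +
      homComp (show -1 + 1 = 0 by omega) e (coneFst f'))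
  have hc (X : C.Obj) (i j : ℤ) (h : i + 1 = j) (a : (M'.obj X).X j) (b : (N'.obj X).X i) :
      ap c X (add_zero i) (coneElt f' X h a b) = coneElt f X h (((s.app X).f j).hom a)
        (((t.app X).f i).hom b + ap e X (by omega) a) := by
    subst h
    rw [ap_add, ap_homComp _ _ _ X (add_zero i) rfl (show i + 1 + -1 = i by omega),
      ap_homComp _ _ _ X rfl rfl (add_zero _),
      ap_homComp _ _ _ X (add_zero i) (add_zero i) (add_zero i), ap_add,
      ap_homComp _ _ _ X (add_zero i) (add_zero i) (add_zero i),
      ap_homComp _ _ _ X (add_zero i) rfl (show i + 1 + -1 = i by omega), ap_coneFst, ap_coneSnd,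
      ap_toHom, ap_toHom, ap_coneInl, ap_coneInr, coneElt_add, add_zero, zero_add]
  have he' (X : C.Obj) (i j l : ℤ) (h : i + 1 = j) (h' : j + 1 = l) (a : (M'.obj X).X j) :
      ((N.obj X).d i j).hom (ap e X (by omega) a) +
        ap e X (by omega) (((M'.obj X).d j l).hom a) =
      ((t.app X).f j).hom (((f'.app X).f j).hom a) -
        ((f.app X).f j).hom (((s.app X).f j).hom a) := by
    have := congrArg (fun g => ap g X (add_zero j) a) he
    simp only [ap_sub, ap_toHom] at this
    rw [ap_hd (by omega) _ X (add_zero j) h' h, Int.negOnePow_zero, one_smul] at this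
    exact this
  have hcl : hd _ _ 0 1 c = 0 := by
    refine hom_ext fun X p q h x => ?_
    subst h
    obtain ⟨a, b, rfl⟩ := exists_coneElt f' X rfl x
    rw [ap_hd (zero_add 1) _ X rfl rfl rfl, hc, d_coneElt f' X rfl rfl, hc, d_coneElt f X rfl rfl,
      ap_zero, Int.negOnePow_one, Units.neg_smul, one_smul, ← sub_eq_add_neg, coneElt_sub,
      coneElt_eq_zero_iff]
    have h₁ := he' X p (p + 1) (p + 1 + 1) rfl rfl a
    refine ⟨?_, ?_⟩
    · rw [map_neg, hom_comm_apply]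
      abel
    · rw [map_add, map_add, map_neg, hom_comm_apply, eq_sub_of_add_eq h₁]
      abel
  have hs' (X : C.Obj) := (quasiIso_iff_isQuasiIsoMap _).1 (hs X)
  have ht' (X : C.Obj) := (quasiIso_iff_isQuasiIsoMap _).1 (ht X)
  refine ⟨Morphism.ofClosed c hcl, fun X => ?_⟩
  rw [quasiIso_iff_isQuasiIsoMap]
  refine ⟨fun i j x => hom_comm_apply _ i j x, fun n x hx ⟨y, hy⟩ => ?_, fun n y hy => ?_⟩
  · obtain ⟨a, b, rfl⟩ := exists_coneElt f' X rfl x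
    obtain ⟨u, v, rfl⟩ := exists_coneElt f X (show n - 1 + 1 = n by omega) y
    replace hy : _ = ap c X (add_zero n) (coneElt f' X rfl a b) := hy
    rw [d_coneElt f' X rfl rfl, coneElt_eq_zero_iff, neg_eq_zero] at hx
    rw [hc, d_coneElt f X _ rfl, coneElt_eq_iff] at hy
    -- The five lemma by elements. A primitive `a₁` of `a` is adjusted by a cocycle `a₂` until `s
    -- (a₁ - a₂) + u` is a boundary; only then does the second coordinate become a cocycle whose
    -- image under `t` bounds.
    obtain ⟨a₁, ha₁⟩ := (hs' X).exists_d_eq rfl rfl a hx.1 (-u) (by rw [map_neg, hy.1])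
    obtain ⟨a₂, ha₂, r, hr⟩ := (hs' X).exists_cocycle (show n - 1 + 1 = n by omega) rfl
      (((s.app X).f n).hom a₁ + u) (by
        rw [map_add, hom_comm_apply, ha₁, ← hy.1, neg_add_cancel])
    have h₁ := he' X (n - 1) n (n + 1) (by omega) rfl (a₁ - a₂)
    rw [map_sub ((M'.obj X).d n (n + 1)).hom, ha₁, ha₂, sub_zero] at h₁
    obtain ⟨b₁, hb₁⟩ := (ht' X).exists_d_eq (show n - 1 + 1 = n by omega) rfl
      (b + ((f'.app X).f n).hom (a₁ - a₂)) (by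
        rw [map_add, hom_comm_apply, map_sub, ha₁, ha₂, sub_zero]
        exact (add_comm _ _).trans hx.2)
      (((f.app X).f (n - 1)).hom r + v + ap e X (by omega) (a₁ - a₂)) (by
        rw [map_add, map_add, hom_comm_apply, hr, eq_sub_of_add_eq h₁, map_add,
          eq_sub_of_add_eq hy.2.symm, map_sub ((s.app X).f n).hom]
        simp only [map_add, map_sub]
        abel)
    refine ⟨coneElt f' X (by omega) (-(a₁ - a₂)) b₁, ?_⟩
    rw [d_coneElt f' X _ rfl, coneElt_eq_iff, hb₁]
    refine ⟨?_, ?_⟩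
    · rw [map_neg, neg_neg, map_sub, ha₁, ha₂, sub_zero]
    · rw [map_neg]
      abel
  · obtain ⟨a', b', rfl⟩ := exists_coneElt f X rfl y
    rw [d_coneElt f X rfl rfl, coneElt_eq_zero_iff, neg_eq_zero] at hy
    obtain ⟨a, ha, u, hu⟩ := (hs' X).exists_cocycle rfl rfl a' hy.1
    have h₁ := he' X n (n + 1) (n + 1 + 1) rfl rfl a
    rw [ha, map_zero, add_zero] at h₁
    -- Up to the homotopy, `t (f' a)` is `f (s a)`, which bounds because `s a` is cohomologous to
    -- `a'`. So `f' a` is the boundary of some `b`, and `b₂` absorbs the cocycle that remains in the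
    -- second coordinate.
    obtain ⟨b, hb⟩ := (ht' X).exists_d_eq rfl rfl (((f'.app X).f _).hom a)
      (by rw [hom_comm_apply, ha, map_zero])
      (ap e X (by omega) a - b' - ((f.app X).f n).hom u) (by
        rw [map_sub, map_sub, h₁, hom_comm_apply, hu, eq_neg_of_add_eq_zero_right hy.2]
        simp only [map_sub]
        abel)
    obtain ⟨b₂, hb₂, r, hr⟩ := (ht' X).exists_cocycle (show n - 1 + 1 = n by omega) rfl
      (b' + ((f.app X).f n).hom u - ap e X (by omega) a + ((t.app X).f n).hom b) (by
        rw [map_add, hom_comm_apply, hb, map_sub, map_add, h₁, hom_comm_apply, hu,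
          eq_neg_of_add_eq_zero_right hy.2]
        simp only [map_sub]
        abel)
    refine ⟨coneElt f' X rfl a (b₂ - b), ?_, coneElt f X (by omega) (-u) r, ?_⟩
    · rw [d_coneElt f' X rfl rfl, coneElt_eq_zero_iff, ha, map_sub, hb₂, hb]
      simp
    · refine Eq.trans ?_ (congrArg (coneElt f X rfl a' b' - ·) (hc X n (n + 1) rfl a (b₂ - b)).symm)
      rw [d_coneElt f X _ rfl, coneElt_sub, coneElt_eq_iff]
      refine ⟨?_, ?_⟩
      · rw [map_neg, neg_neg, hu]
      · rw [hr, map_neg, map_sub]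
        abel

end DGModule

namespace CochainComplex

/-! ### The tensor product of complexes of vector spaces -/

section Tensor

variable (V W : CochainComplex (ModuleCat.{u} k) ℤ)

/-- The tensor product of two complexes of vector spaces in degree `n`. -/
abbrev TensorX (n : ℤ) : Type u :=
  DirectSum {s : ℤ × ℤ // s.1 + s.2 = n} fun s => TensorProduct k (V.X s.1.1) (W.X s.1.2)

variable {V W}

/-- Pure tensors, as elements of the direct sum. -/
def preTmul {p q n : ℤ} (h : p + q = n) : V.X p →ₗ[k] W.X q →ₗ[k] TensorX V W n :=
  (TensorProduct.mk k (V.X p) (W.X q)).compr₂ (DirectSum.lof k {s : ℤ × ℤ // s.1 + s.2 = n}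
    (fun s => TensorProduct k (V.X s.1.1) (W.X s.1.2)) ⟨(p, q), h⟩)

/-- The universal property of the direct sum of tensor products. -/
def preTensorDesc {Z : Type*} [AddCommGroup Z] [Module k Z] {n : ℤ}
    (F : ∀ p q : ℤ, p + q = n → V.X p →ₗ[k] W.X q →ₗ[k] Z) : TensorX V W n →ₗ[k] Z :=
  DirectSum.toModule k _ Z fun s => TensorProduct.lift (F s.1.1 s.1.2 s.2)

theorem preTensorDesc_tmul {Z : Type*} [AddCommGroup Z] [Module k Z] {n : ℤ}
    (F : ∀ p q : ℤ, p + q = n → V.X p →ₗ[k] W.X q →ₗ[k] Z) {p q : ℤ} (h : p + q = n) (x : V.X p)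
    (y : W.X q) : preTensorDesc F (preTmul h x y) = F p q h x y := by
  simp only [preTensorDesc, preTmul, LinearMap.compr₂_apply, TensorProduct.mk_apply]
  rw [DirectSum.toModule_lof]
  rfl

theorem preTensor_induction {n : ℤ} {motive : TensorX V W n → Prop} (z : TensorX V W n)
    (htmul : ∀ (p q : ℤ) (h : p + q = n) (x : V.X p) (y : W.X q), motive (preTmul h x y))
    (hadd : ∀ z z', motive z → motive z' → motive (z + z')) : motive z := by
  have h0 : motive 0 := by
    have := htmul 0 n (zero_add n) 0 0
    rwa [map_zero] at this
  induction z using DirectSum.induction_on with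
  | zero => exact h0
  | of i t =>
    induction t using TensorProduct.induction_on with
    | zero => rwa [map_zero]
    | tmul x y => exact htmul i.1.1 i.1.2 i.2 x y
    | add t t' ht ht' => rw [map_add]; exact hadd _ _ ht ht'
  | add z z' hz hz' => exact hadd _ _ hz hz'

variable (V W)

/-- The differential of the tensor product. -/
def tensorD (n n' : ℤ) : TensorX V W n →ₗ[k] TensorX V W n' :=
  if hn : n + 1 = n' then preTensorDesc fun p q h => LinearMap.mk₂ k
    (fun x y => preTmul (show p + 1 + q = n' by omega) ((V.d p (p + 1)).hom x) y +
      p.negOnePow • preTmul (show p + (q + 1) = n' by omega) x ((W.d q (q + 1)).hom y))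
    (by intros; simp only [map_add, LinearMap.add_apply, smul_add]; abel)
    (by intros; simp only [map_smul, LinearMap.smul_apply, smul_add]; rw [smul_comm])
    (by intros; simp only [map_add, smul_add]; abel)
    (by intros; simp only [map_smul, smul_add]; rw [smul_comm])
  else 0

variable {V W}

theorem tensorD_tmul {n n' p q p' q' : ℤ} (hn : n + 1 = n') (h : p + q = n) (hp : p + 1 = p')
    (hq : q + 1 = q') (x : V.X p) (y : W.X q) :
    tensorD V W n n' (preTmul h x y) =
      preTmul (show p' + q = n' by omega) ((V.d p p').hom x) y +
      p.negOnePow • preTmul (show p + q' = n' by omega) x ((W.d q q').hom y) := by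
  subst hp hq
  rw [tensorD, dif_pos hn, preTensorDesc_tmul]
  rfl

theorem tensorD_tensorD (i j l : ℤ) (hij : i + 1 = j) (hjl : j + 1 = l) (z : TensorX V W i) :
    tensorD V W j l (tensorD V W i j z) = 0 := by
  induction z using preTensor_induction with
  | htmul p q h x y =>
    rw [tensorD_tmul hij h rfl rfl, map_add, lin_units_smul, tensorD_tmul hjl _ rfl rfl,
      tensorD_tmul hjl _ rfl rfl, d_d_apply, d_d_apply, map_zero, map_zero, smul_zero,
      LinearMap.zero_apply, zero_add, add_zero, Int.negOnePow_succ, Units.neg_smul,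
      neg_add_cancel]
  | hadd z z' hz hz' => rw [map_add, map_add, hz, hz', add_zero]

variable (V W)

/-- The tensor product of two complexes of vector spaces. -/
def tensor : CochainComplex (ModuleCat.{u} k) ℤ where
  X n := ModuleCat.of k (TensorX V W n)
  d n n' := ModuleCat.ofHom (tensorD V W n n')
  shape _ _ h := ModuleCat.hom_ext (dif_neg h)
  d_comp_d' i j l hij hjl := ModuleCat.hom_ext (LinearMap.ext (tensorD_tensorD i j l hij hjl))

variable {V W}

/-- Pure tensors. -/
def tmul {p q n : ℤ} (h : p + q = n) : V.X p →ₗ[k] W.X q →ₗ[k] (tensor V W).X n :=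
  preTmul h

/-- The universal property of the tensor product. -/
def tensorDesc {Z : Type*} [AddCommGroup Z] [Module k Z] {n : ℤ}
    (F : ∀ p q : ℤ, p + q = n → V.X p →ₗ[k] W.X q →ₗ[k] Z) : (tensor V W).X n →ₗ[k] Z :=
  preTensorDesc F

theorem tensorDesc_tmul {Z : Type*} [AddCommGroup Z] [Module k Z] {n : ℤ}
    (F : ∀ p q : ℤ, p + q = n → V.X p →ₗ[k] W.X q →ₗ[k] Z) {p q : ℤ} (h : p + q = n) (x : V.X p)
    (y : W.X q) : tensorDesc F (tmul h x y) = F p q h x y :=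
  preTensorDesc_tmul F h x y

theorem tensor_induction {n : ℤ} {motive : (tensor V W).X n → Prop} (z : (tensor V W).X n)
    (htmul : ∀ (p q : ℤ) (h : p + q = n) (x : V.X p) (y : W.X q), motive (tmul h x y))
    (hadd : ∀ z z', motive z → motive z' → motive (z + z')) : motive z :=
  preTensor_induction z htmul hadd

theorem tensor_d_tmul {n n' p q p' q' : ℤ} (hn : n + 1 = n') (h : p + q = n) (hp : p + 1 = p')
    (hq : q + 1 = q') (x : V.X p) (y : W.X q) :
    ((tensor V W).d n n').hom (tmul h x y) =
      tmul (show p' + q = n' by omega) ((V.d p p').hom x) y +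
      p.negOnePow • tmul (show p + q' = n' by omega) x ((W.d q q').hom y) :=
  tensorD_tmul hn h hp hq x y

end Tensor

/-- An acyclic complex of vector spaces is contractible. -/
theorem exists_contraction {K : CochainComplex (ModuleCat.{u} k) ℤ} (hK : K.Acyclic) :
    ∃ s : ∀ i j : ℤ, j + 1 = i → K.X i →ₗ[k] K.X j, ∀ (i j l : ℤ) (h : j + 1 = i) (h' : i + 1 = l)
      (x : K.X i), (K.d j i).hom (s i j h x) + s l i h' ((K.d i l).hom x) = x := by
  have hsurj (j i : ℤ) (h : j + 1 = i) : ∃ σ : LinearMap.ker (K.d i (i + 1)).hom →ₗ[k] K.X j,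
      ∀ x, (K.d j i).hom (σ x) = x.1 := by
    let f : K.X j →ₗ[k] LinearMap.ker (K.d i (i + 1)).hom :=
      (K.d j i).hom.codRestrict _ (fun x => d_d_apply K _ _ _ x)
    -- Over a field the differential, as a surjection onto the cocycles, has a linear section.
    obtain ⟨σ, hσ⟩ := f.exists_rightInverse_of_surjective (by
      rw [LinearMap.range_eq_top]
      intro x
      obtain ⟨y, hy⟩ := exists_d_eq_of_acyclic hK h rfl x.1 x.2
      exact ⟨y, Subtype.ext hy⟩)
    exact ⟨σ, fun x => congrArg Subtype.val (LinearMap.congr_fun hσ x)⟩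
  choose σ hσ using hsurj
  have hdσ (i : ℤ) (x : K.X i) :
      x - σ i (i + 1) rfl ⟨(K.d i (i + 1)).hom x, d_d_apply K _ _ _ x⟩ ∈
        LinearMap.ker (K.d i (i + 1)).hom := by
    rw [LinearMap.mem_ker, map_sub, hσ, sub_self]
  let D (i : ℤ) : K.X i →ₗ[k] LinearMap.ker (K.d (i + 1) (i + 1 + 1)).hom :=
    (K.d i (i + 1)).hom.codRestrict _ (fun x => d_d_apply K _ _ _ x)
  -- The map `id - σ d` projects onto the cocycles, where `σ` is defined; on boundaries it is the
  -- identity, so `s d = σ d`.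
  refine ⟨fun i j h => (σ j i h).comp ((LinearMap.id - (σ i (i + 1) rfl).comp (D i)).codRestrict _
    (hdσ i)), ?_⟩
  rintro i j l h rfl x
  change (K.d j i).hom (σ j i h _) + σ i (i + 1) rfl _ = x
  rw [hσ]
  change x - σ i (i + 1) rfl ⟨(K.d i (i + 1)).hom x, _⟩ + σ i (i + 1) rfl _ = x
  rw [sub_add_eq_add_sub, sub_eq_iff_eq_add, add_right_inj]
  congr 1
  refine Subtype.ext ?_
  change (K.d i (i + 1)).hom x - σ (i + 1) (i + 1 + 1) rfl ⟨(K.d (i + 1) (i + 1 + 1)).hom _, _⟩ = _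
  rw [sub_eq_self]
  convert map_zero (σ (i + 1) (i + 1 + 1) rfl)
  exact Subtype.ext (d_d_apply K _ _ _ x)

end CochainComplex

/-! ### The Leibniz rule and identities in a dg category. -/

namespace DGCat

variable (C : DGCat.{v, u₁, u₂} k)

theorem d_comp' {X Y Z : C.Obj} {q p n q' p' n' : ℤ} (h : q + p = n) (hq : q + 1 = q')
    (hp : p + 1 = p') (hn : n + 1 = n') (g : (C.Hom Y Z).X q) (f : (C.Hom X Y).X p) :
    ((C.Hom X Z).d n n').hom (C.comp h g f) =
      C.comp (by omega) (((C.Hom Y Z).d q q').hom g) f +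
        q.negOnePow • C.comp (by omega) g (((C.Hom X Y).d p p').hom f) := by
  subst hq hp hn
  exact C.d_comp h g f

/-- Applied to `id ∘ id`, the Leibniz rule gives `d id = d id + d id`. -/
theorem d_id (X : C.Obj) (n : ℤ) : ((C.Hom X X).d 0 n).hom (C.id X) = 0 := by
  by_cases hn : 0 + 1 = n
  · obtain rfl : n = 1 := by omega
    have := C.d_comp' (add_zero 0) (zero_add 1) (zero_add 1) (zero_add 1) (C.id X) (C.id X)
    rw [C.comp_id, C.comp_id, C.id_comp, Int.negOnePow_zero, one_smul] at this
    exact left_eq_add.1 this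
  · rw [(C.Hom X X).shape 0 n hn]
    rfl

end DGCat

namespace DGModule

open CochainComplex

variable {C : DGCat.{v, u₁, u} k}

/-! ### Free modules -/

section Free

variable (V : CochainComplex (ModuleCat.{u} k) ℤ) (P : C.Obj)

/-- The action on a free module. -/
def freeAct {X Y : C.Obj} {q p n : ℤ} (h : q + p = n) :
    (tensor V (C.Hom Y P)).X q →ₗ[k] (C.Hom X Y).X p →ₗ[k] (tensor V (C.Hom X P)).X n :=
  tensorDesc fun a b hab => LinearMap.mk₂ k
    (fun v f => (tmul (show a + (b + p) = n by omega) v).comp (C.comp rfl f))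
    (by intros; rw [map_add, LinearMap.add_comp])
    (by intros; rw [map_smul, LinearMap.smul_comp])
    (by intros; rw [map_add, LinearMap.comp_add])
    (by intros; rw [map_smul, LinearMap.comp_smul])

theorem freeAct_tmul {X Y : C.Obj} {q p n a b c : ℤ} (h : q + p = n) (hab : a + b = q)
    (hc : b + p = c) (v : V.X a) (f : (C.Hom Y P).X b) (x : (C.Hom X Y).X p) :
    freeAct V P h (tmul hab v f) x = tmul (show a + c = n by omega) v (C.comp hc f x) := by
  subst hc
  rw [freeAct, tensorDesc_tmul]
  rfl

/-- The free module `V ⊗ Hom(-, P)`. -/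
def freeMod : DGModule.{v, u₁, u, u} C where
  obj X := tensor V (C.Hom X P)
  act h := freeAct V P h
  act_id {X q} m := by
    induction m using tensor_induction with
    | htmul a b h v f => rw [freeAct_tmul V P _ h (add_zero b), C.comp_id]
    | hadd z z' hz hz' => rw [map_add, LinearMap.add_apply, hz, hz']
  act_act {X Y Z r q p rq qp n} h₁ h₂ h₃ h₄ m y x := by
    induction m using tensor_induction with
    | htmul a b h v f =>
      rw [freeAct_tmul V P _ h rfl, freeAct_tmul V P _ _ rfl, freeAct_tmul V P _ h
        (show b + qp = b + q + p by omega), C.assoc rfl rfl h₃ (by omega)]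
    | hadd z z' hz hz' => simp only [map_add, LinearMap.add_apply, hz, hz']
  d_act {X Y q p n} h m x := by
    induction m using tensor_induction with
    | htmul a b hab v f =>
      rw [freeAct_tmul V P _ hab rfl, tensor_d_tmul rfl _ rfl rfl, tensor_d_tmul rfl hab rfl rfl,
        map_add, LinearMap.add_apply, lin_units_smul₂, freeAct_tmul V P _ _ rfl,
        freeAct_tmul V P _ _ (show b + 1 + p = b + p + 1 by omega),
        freeAct_tmul V P _ _ (show b + (p + 1) = b + p + 1 by omega),
        C.d_comp' rfl rfl rfl rfl, map_add, lin_units_smul, smul_add, smul_smul,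
        ← Int.negOnePow_add, hab]
      exact (add_assoc _ _ _).symm
    | hadd z z' hz hz' =>
      simp only [map_add, LinearMap.add_apply, hz, hz', smul_add]
      abel

variable {V P}

/-- Pure tensors in a free module. -/
def ftmul {X : C.Obj} {p q n : ℤ} (h : p + q = n) :
    V.X p →ₗ[k] (C.Hom X P).X q →ₗ[k] ((freeMod V P).obj X).X n :=
  tmul h

theorem ftmul_eq_act {X : C.Obj} {p q n : ℤ} (h : p + q = n) (x : V.X p) (y : (C.Hom X P).X q) :
    ftmul h x y = (freeMod V P).act h (ftmul (add_zero p) x (C.id P)) y := by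
  refine Eq.trans ?_ (freeAct_tmul V P h (add_zero p) (zero_add q) x (C.id P) y).symm
  rw [C.id_comp]
  rfl

theorem act_ftmul {X Y : C.Obj} {q p n a b c : ℤ} (h : q + p = n) (hab : a + b = q)
    (hc : b + p = c) (v : V.X a) (f : (C.Hom Y P).X b) (x : (C.Hom X Y).X p) :
    (freeMod V P).act h (ftmul hab v f) x =
      ftmul (show a + c = n by omega) v (C.comp hc f x) :=
  freeAct_tmul V P h hab hc v f x

theorem free_induction {X : C.Obj} {n : ℤ} {motive : ((freeMod V P).obj X).X n → Prop}
    (z : ((freeMod V P).obj X).X n)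
    (htmul : ∀ (p q : ℤ) (h : p + q = n) (x : V.X p) (y : (C.Hom X P).X q), motive (ftmul h x y))
    (hadd : ∀ z z', motive z → motive z' → motive (z + z')) : motive z :=
  tensor_induction z htmul hadd

theorem d_ftmul {X : C.Obj} {n n' p q p' q' : ℤ} (hn : n + 1 = n') (h : p + q = n)
    (hp : p + 1 = p') (hq : q + 1 = q') (x : V.X p) (y : (C.Hom X P).X q) :
    (((freeMod V P).obj X).d n n').hom (ftmul h x y) =
      ftmul (show p' + q = n' by omega) ((V.d p p').hom x) y +
      p.negOnePow • ftmul (show p + q' = n' by omega) x (((C.Hom X P).d q q').hom y) :=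
  tensor_d_tmul hn h hp hq x y

theorem d_ftmul_id {p p' n : ℤ} (hp : p + 1 = p') (h : p + 0 = n) (h' : p' + 0 = p') (x : V.X p) :
    (((freeMod V P).obj P).d n p').hom (ftmul h x (C.id P)) =
      ftmul h' ((V.d p p').hom x) (C.id P) := by
  rw [d_ftmul (by omega) h hp (zero_add 1), C.d_id, map_zero, smul_zero, add_zero]

/-- Linear maps out of a free module. -/
def freeDesc {Z : Type*} [AddCommGroup Z] [Module k Z] {X : C.Obj} {n : ℤ}
    (F : ∀ p q : ℤ, p + q = n → V.X p →ₗ[k] (C.Hom X P).X q →ₗ[k] Z) :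
    ((freeMod V P).obj X).X n →ₗ[k] Z :=
  tensorDesc F

theorem freeDesc_ftmul {Z : Type*} [AddCommGroup Z] [Module k Z] {X : C.Obj} {n : ℤ}
    (F : ∀ p q : ℤ, p + q = n → V.X p →ₗ[k] (C.Hom X P).X q →ₗ[k] Z) {p q : ℤ} (h : p + q = n)
    (x : V.X p) (y : (C.Hom X P).X q) : freeDesc F (ftmul h x y) = F p q h x y :=
  tensorDesc_tmul F h x y

/-- The morphism from a free module determined by its values on generators. -/
def freeExtend {N : DGModule.{v, u₁, u, u} C} {n : ℤ}
    (g : ∀ a b : ℤ, a + n = b → V.X a →ₗ[k] (N.obj P).X b) : homSubmodule (freeMod V P) N n :=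
  mkHom (fun X p q h => freeDesc fun a b hab => LinearMap.mk₂ k
    (fun v f => N.act (show a + n + b = q by omega) (g a (a + n) rfl v) f)
    (by intros; rw [map_add, map_add, LinearMap.add_apply])
    (by intros; rw [map_smul, map_smul, LinearMap.smul_apply])
    (by intros; rw [map_add])
    (by intros; rw [map_smul])) (by
    intro X Y q p i q' j h h₁ h₂ m x
    induction m using free_induction with
    | htmul a b hab v f =>
      rw [act_ftmul h hab rfl, freeDesc_ftmul, freeDesc_ftmul]
      exact (N.act_act _ _ _ _ _ _ _).symm
    | hadd z z' hz hz' => rw [map_add, LinearMap.add_apply, map_add, hz, hz', map_add, map_add,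
        LinearMap.add_apply])

theorem ap_freeExtend {N : DGModule.{v, u₁, u, u} C} {n : ℤ}
    (g : ∀ a b : ℤ, a + n = b → V.X a →ₗ[k] (N.obj P).X b) {X : C.Obj} {a b c p q : ℤ}
    (h : p + n = q) (hab : a + b = p) (hc : a + n = c) (v : V.X a) (f : (C.Hom X P).X b) :
    ap (freeExtend g) X h (ftmul hab v f) = N.act (show c + b = q by omega) (g a c hc v) f := by
  subst hc
  rw [freeExtend, ap_mkHom, freeDesc_ftmul]
  rfl

/-- The elements `v ⊗ id` generate a free module. -/
theorem free_hom_ext {N : DGModule.{v, u₁, u, u} C} {n : ℤ} {F G : homSubmodule (freeMod V P) N n}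
    (h : ∀ (a b : ℤ) (hab : a + n = b) (v : V.X a),
      ap F P hab (ftmul (add_zero a) v (C.id P)) = ap G P hab (ftmul (add_zero a) v (C.id P))) :
    F = G := by
  refine hom_ext fun X p q hpq z => ?_
  induction z using free_induction with
  | htmul a b hab v f =>
    rw [ftmul_eq_act, ap_act F hab rfl hpq (by omega), ap_act G hab rfl hpq (by omega), h]
  | hadd z z' hz hz' => rw [map_add, map_add, hz, hz']

-- By the Yoneda lemma, homomorphisms out of `V ⊗ Hom(-, P)` are graded linear maps `V → N(P)`. An
-- acyclic `N(P)` is contractible over a field, and the contraction applied after a cocycle bounds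
-- it.
variable (V P) in
theorem isHProjective_freeMod : (freeMod V P).IsHProjective := by
  intro N hN
  rw [acyclic_iff_exists]
  intro n F hF
  change homSubmodule (freeMod V P) N n at F
  change hd (freeMod V P) N n (n + 1) F = 0 at hF
  obtain ⟨s, hs⟩ := exists_contraction (hN P)
  let g (a b : ℤ) (h : a + (n - 1) = b) : V.X a →ₗ[k] (N.obj P).X b :=
    ((s (a + n) b (by omega)).comp (ap F P rfl)).comp ((ftmul (add_zero a)).flip (C.id P))
  refine ⟨freeExtend g, ?_⟩
  change hd (freeMod V P) N (n - 1) n (freeExtend g) = F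
  refine free_hom_ext fun a b hab v => ?_
  subst hab
  rw [ap_hd (by omega) _ P rfl rfl (show a + n - 1 + 1 = a + n by omega),
    d_ftmul_id rfl _ (add_zero _), ap_freeExtend g _ _ (show a + (n - 1) = a + n - 1 by omega),
    ap_freeExtend g _ _ (show a + 1 + (n - 1) = a + n by omega), N.act_id, N.act_id]
  change ((N.obj P).d _ _).hom (s (a + n) _ _ (ap F P rfl (ftmul (add_zero a) v (C.id P)))) +
    n.negOnePow • s (a + 1 + n) _ _ (ap F P rfl (ftmul (add_zero (a + 1)) _ (C.id P))) = _
  have h₁ := congrArg (fun G => ap G P (show a + (n + 1) = a + 1 + n by omega)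
    (ftmul (add_zero a) v (C.id P))) hF
  rw [ap_hd rfl _ P _ rfl (show a + n + 1 = a + 1 + n by omega), d_ftmul_id rfl _ (add_zero _),
    ap_zero, Int.negOnePow_succ, Units.neg_smul, ← sub_eq_add_neg, sub_eq_zero] at h₁
  have h₂ := hs (a + n) (a + n - 1) (a + 1 + n) (by omega) (by omega)
    (ap F P rfl (ftmul (add_zero a) v (C.id P)))
  refine Eq.trans ?_ h₂
  congr 1
  rw [← lin_units_smul]
  exact congrArg _ h₁.symm

/-- The morphism from a free module determined by a chain map. -/
def freeLift {N : DGModule.{v, u₁, u, u} C} (g : V ⟶ N.obj P) : Morphism (freeMod V P) N :=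
  Morphism.ofClosed (freeExtend fun a b h => ((Cochain.ofHom g).v a b h).hom) (by
    refine free_hom_ext fun a b hab v => ?_
    subst hab
    rw [ap_hd (by omega) _ P rfl rfl rfl, d_ftmul_id rfl _ (add_zero _),
      ap_freeExtend _ _ _ (add_zero a), ap_freeExtend _ _ _ (add_zero (a + 1)), N.act_id, N.act_id,
      Cochain.ofHom_v, Cochain.ofHom_v, hom_comm_apply, ap_zero]
    simp)

theorem freeLift_ftmul {N : DGModule.{v, u₁, u, u} C} (g : V ⟶ N.obj P) {X : C.Obj} {a b p : ℤ}
    (hab : a + b = p) (v : V.X a) (f : (C.Hom X P).X b) :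
    (((freeLift g).app X).f p).hom (ftmul hab v f) = N.act hab ((g.f a).hom v) f := by
  refine (ap_freeExtend (fun a b h => ((Cochain.ofHom g).v a b h).hom) (add_zero p) hab (add_zero a)
    v f).trans ?_
  rw [Cochain.ofHom_v]

end Free

end DGModule

namespace CochainComplex

/-! ### The total complex of a sequence of complexes -/

section Total

variable (K : ℕ → CochainComplex (ModuleCat.{w} k) ℤ) (D : ∀ i, K (i + 1) ⟶ K i)

/-- The total complex in degree `n`. -/
abbrev TotalX (n : ℤ) : Type w :=
  DirectSum {s : ℕ × ℤ // s.2 = n + s.1} fun s => (K s.1.1).X s.1.2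

variable {K}

/-- The inclusion of a summand in the direct sum. -/
def preInc (i : ℕ) {q n : ℤ} (h : q = n + i) : (K i).X q →ₗ[k] TotalX K n :=
  DirectSum.lof k {s : ℕ × ℤ // s.2 = n + s.1} (fun s => (K s.1.1).X s.1.2) ⟨(i, q), h⟩

/-- Linear maps out of the direct sum. -/
def preTotalDesc {Z : Type*} [AddCommGroup Z] [Module k Z] {n : ℤ}
    (F : ∀ (i : ℕ) (q : ℤ), q = n + i → (K i).X q →ₗ[k] Z) : TotalX K n →ₗ[k] Z :=
  DirectSum.toModule k _ Z fun s => F s.1.1 s.1.2 s.2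

theorem preTotalDesc_inc {Z : Type*} [AddCommGroup Z] [Module k Z] {n : ℤ}
    (F : ∀ (i : ℕ) (q : ℤ), q = n + i → (K i).X q →ₗ[k] Z) (i : ℕ) {q : ℤ} (h : q = n + i)
    (x : (K i).X q) : preTotalDesc F (preInc i h x) = F i q h x := by
  rw [preTotalDesc, preInc, DirectSum.toModule_lof]

theorem preTotal_induction {n : ℤ} {motive : TotalX K n → Prop} (z : TotalX K n)
    (hinc : ∀ (i : ℕ) (q : ℤ) (h : q = n + i) (x : (K i).X q), motive (preInc i h x))
    (hadd : ∀ z z', motive z → motive z' → motive (z + z')) : motive z := by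
  induction z using DirectSum.induction_on with
  | zero =>
    have := hinc 0 (n + (0 : ℕ)) rfl 0
    rwa [map_zero] at this
  | of i x => exact hinc i.1.1 i.1.2 i.2 x
  | add z z' hz hz' => exact hadd _ _ hz hz'

/-- The component of the differential given by the maps of the sequence. -/
def preLower : ∀ (i : ℕ) {q n' : ℤ}, q + 1 = n' + i → ((K i).X q →ₗ[k] TotalX K n')
  | 0, _, _, _ => 0
  | i + 1, q, n', h => (preInc i (show q = n' + i by push_cast at h; omega)).comp ((D i).f q).hom

/-- The differential of the total complex. -/
def totalD (n n' : ℤ) : TotalX K n →ₗ[k] TotalX K n' :=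
  if hn : n + 1 = n' then preTotalDesc fun i q h =>
    (LinearMap.lsmul k _ (((i : ℤ).negOnePow : ℤ) : k)).comp
      ((preInc i (show q + 1 = n' + i by omega)).comp ((K i).d q (q + 1)).hom) +
      preLower D i (show q + 1 = n' + i by omega)
  else 0

theorem negOnePow_cast_succ (i : ℕ) : ((i + 1 : ℕ) : ℤ).negOnePow = -(i : ℤ).negOnePow := by
  rw [← Int.negOnePow_succ]
  rfl

theorem cast_units_smul {V : Type*} [AddCommGroup V] [Module k V] (ε : ℤˣ) (x : V) :
    ((ε : ℤ) : k) • x = ε • x := by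
  rcases Int.units_eq_one_or ε with rfl | rfl <;> simp

theorem totalD_inc {n n' : ℤ} (hn : n + 1 = n') (i : ℕ) {q q' : ℤ} (h : q = n + i)
    (hq : q + 1 = q') (x : (K i).X q) :
    totalD D n n' (preInc i h x) = (i : ℤ).negOnePow • preInc i (show q' = n' + i by omega)
      (((K i).d q q').hom x) + preLower D i (show q + 1 = n' + i by omega) x := by
  subst hq
  rw [totalD, dif_pos hn, preTotalDesc_inc, LinearMap.add_apply, LinearMap.comp_apply,
    LinearMap.lsmul_apply, cast_units_smul]
  rfl

variable (hD : ∀ (i : ℕ) (q : ℤ) (x : (K (i + 1 + 1)).X q),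
  ((D i).f q).hom (((D (i + 1)).f q).hom x) = 0)

-- The sign `(-1)^i` on the internal differential makes the mixed terms cancel; the rest vanishes by
-- `d d = 0` and `D D = 0`.
include hD in
theorem totalD_totalD (a b c : ℤ) (hab : a + 1 = b) (hbc : b + 1 = c) (z : TotalX K a) :
    totalD D b c (totalD D a b z) = 0 := by
  induction z using preTotal_induction with
  | hinc i q h x =>
    rw [totalD_inc D hab i h rfl, map_add, lin_units_smul, totalD_inc D hbc i _ rfl, d_d_apply,
      map_zero, smul_zero, zero_add]
    -- Two lowering steps are possible only from index at least `2`, so the two bottom indices are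
    -- separate cases.
    match i with
    | 0 => simp [preLower]
    | 1 =>
      simp only [preLower, LinearMap.comp_apply]
      rw [totalD_inc D hbc 0 _ rfl, ← hom_comm_apply]
      simp [preLower]
    | i + 1 + 1 =>
      simp only [preLower, LinearMap.comp_apply]
      rw [totalD_inc D hbc (i + 1) _ rfl, ← hom_comm_apply]
      simp only [preLower, LinearMap.comp_apply, hD, map_zero, add_zero]
      rw [negOnePow_cast_succ, Units.neg_smul, neg_add_cancel]
  | hadd z z' hz hz' => rw [map_add, map_add, hz, hz', add_zero]

/-- The total complex of a sequence of complexes and chain maps with vanishing composites. -/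
def total : CochainComplex (ModuleCat.{w} k) ℤ where
  X n := ModuleCat.of k (TotalX K n)
  d n n' := ModuleCat.ofHom (totalD D n n')
  shape _ _ h := ModuleCat.hom_ext (dif_neg h)
  d_comp_d' i j l hij hjl := ModuleCat.hom_ext (LinearMap.ext (totalD_totalD D hD i j l hij hjl))

end Total

end CochainComplex

/-! ### The total dg module of a sequence of dg modules. -/

namespace DGModule

open CochainComplex

variable {C : DGCat.{v, u₁, u₂} k}

/-- A sequence of dg modules and morphisms with vanishing composites. -/
structure Resolving (C : DGCat.{v, u₁, u₂} k) where
  /-- the dg modules -/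
  F : ℕ → DGModule.{v, u₁, u₂, w} C
  /-- the morphisms -/
  D : ∀ i, Morphism (F (i + 1)) (F i)
  D_D : ∀ (i : ℕ) (X : C.Obj) (q : ℤ) (x : ((F (i + 1 + 1)).obj X).X q),
    (((D i).app X).f q).hom ((((D (i + 1)).app X).f q).hom x) = 0

namespace Resolving

variable (S : Resolving.{v, u₁, u₂, w} C)

/-- The complexes underlying the total dg module. -/
def totalObj (X : C.Obj) : CochainComplex (ModuleCat.{w} k) ℤ :=
  CochainComplex.total (K := fun i => (S.F i).obj X) (fun i => (S.D i).app X) (fun i => S.D_D i X)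

variable {S}

/-- The inclusion of a summand. -/
def inc (i : ℕ) {X : C.Obj} {q n : ℤ} (h : q = n + i) :
    ((S.F i).obj X).X q →ₗ[k] (S.totalObj X).X n :=
  preInc (K := fun i => (S.F i).obj X) i h

/-- Linear maps out of the total complex. -/
def totalDesc {Z : Type*} [AddCommGroup Z] [Module k Z] {X : C.Obj} {n : ℤ}
    (F : ∀ (i : ℕ) (q : ℤ), q = n + i → ((S.F i).obj X).X q →ₗ[k] Z) :
    (S.totalObj X).X n →ₗ[k] Z :=
  preTotalDesc (K := fun i => (S.F i).obj X) F

theorem totalDesc_inc {Z : Type*} [AddCommGroup Z] [Module k Z] {X : C.Obj} {n : ℤ}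
    (F : ∀ (i : ℕ) (q : ℤ), q = n + i → ((S.F i).obj X).X q →ₗ[k] Z) (i : ℕ) {q : ℤ}
    (h : q = n + i) (x : ((S.F i).obj X).X q) : totalDesc F (inc i h x) = F i q h x :=
  preTotalDesc_inc (K := fun i => (S.F i).obj X) F i h x

theorem total_induction {X : C.Obj} {n : ℤ} {motive : (S.totalObj X).X n → Prop}
    (z : (S.totalObj X).X n)
    (hinc : ∀ (i : ℕ) (q : ℤ) (h : q = n + i) (x : ((S.F i).obj X).X q), motive (inc i h x))
    (hadd : ∀ z z', motive z → motive z' → motive (z + z')) : motive z :=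
  preTotal_induction (K := fun i => (S.F i).obj X) z hinc hadd

theorem d_inc_zero {X : C.Obj} {n n' : ℤ} (hn : n + 1 = n') {q q' : ℤ} (h : q = n + (0 : ℕ))
    (hq : q + 1 = q') (x : ((S.F 0).obj X).X q) :
    ((S.totalObj X).d n n').hom (inc 0 h x) =
      inc 0 (show q' = n' + (0 : ℕ) by omega) ((((S.F 0).obj X).d q q').hom x) := by
  refine (totalD_inc (K := fun i => (S.F i).obj X) (fun i => (S.D i).app X) hn 0 h hq x).trans ?_
  simp [preLower]
  rfl

theorem d_inc_succ {X : C.Obj} {n n' : ℤ} (hn : n + 1 = n') (i : ℕ) {q q' : ℤ}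
    (h : q = n + (i + 1 : ℕ)) (hq : q + 1 = q') (x : ((S.F (i + 1)).obj X).X q) :
    ((S.totalObj X).d n n').hom (inc (i + 1) h x) =
      -((i : ℤ).negOnePow • inc (i + 1) (show q' = n' + (i + 1 : ℕ) by omega)
        ((((S.F (i + 1)).obj X).d q q').hom x)) +
      inc i (show q = n' + i by push_cast at h; omega) ((((S.D i).app X).f q).hom x) := by
  refine (totalD_inc (K := fun i => (S.F i).obj X) (fun i => (S.D i).app X) hn (i + 1) h hq
    x).trans ?_
  rw [negOnePow_cast_succ, Units.neg_smul]
  rfl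

/-- The action on the total dg module. -/
def totalAct {X Y : C.Obj} {q p n : ℤ} (h : q + p = n) :
    (S.totalObj Y).X q →ₗ[k] (C.Hom X Y).X p →ₗ[k] (S.totalObj X).X n :=
  totalDesc fun i r hr => LinearMap.mk₂ k
    (fun m x => inc i (show r + p = n + i by omega) ((S.F i).act rfl m x))
    (by intros; rw [map_add, LinearMap.add_apply, map_add])
    (by intros; rw [map_smul, LinearMap.smul_apply, map_smul])
    (by intros; rw [map_add, map_add])
    (by intros; rw [map_smul, map_smul])

theorem totalAct_inc {X Y : C.Obj} {q p n r s : ℤ} (h : q + p = n) (i : ℕ) (hr : r = q + i)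
    (hs : r + p = s) (m : ((S.F i).obj Y).X r) (x : (C.Hom X Y).X p) :
    totalAct h (inc i hr m) x = inc i (show s = n + i by omega) ((S.F i).act hs m x) := by
  subst hs
  rw [totalAct, totalDesc_inc]
  rfl

variable (S)

/-- The total dg module of a sequence of dg modules. -/
def total : DGModule.{v, u₁, u₂, w} C where
  obj X := S.totalObj X
  act h := totalAct h
  act_id {X q} m := by
    induction m using total_induction with
    | hinc i r h x => rw [totalAct_inc _ i h (add_zero r), DGModule.act_id]
    | hadd z z' hz hz' => rw [map_add, LinearMap.add_apply, hz, hz']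
  act_act {X Y Z r q p rq qp n} h₁ h₂ h₃ h₄ m y x := by
    induction m using total_induction with
    | hinc i s h m =>
      rw [totalAct_inc _ i h rfl, totalAct_inc _ i _ rfl, totalAct_inc _ i h
        (show s + qp = s + q + p by omega), DGModule.act_act _ _ _ h₃]
    | hadd z z' hz hz' => simp only [map_add, LinearMap.add_apply, hz, hz']
  d_act {X Y q p n} h m x := by
    induction m using total_induction with
    | hinc i r hr m =>
      match i with
      | 0 =>
        rw [totalAct_inc _ 0 hr rfl, d_inc_zero rfl _ rfl, d_inc_zero rfl _ rfl,
          totalAct_inc _ 0 _ (show r + 1 + p = r + p + 1 by omega),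
          totalAct_inc _ 0 _ (show r + (p + 1) = r + p + 1 by omega),
          (S.F 0).d_act' rfl rfl rfl rfl, map_add, lin_units_smul]
        simp only [Nat.cast_zero, add_zero] at hr
        rw [show r.negOnePow = q.negOnePow by rw [hr]]
      | i + 1 =>
        rw [totalAct_inc _ (i + 1) hr rfl, d_inc_succ rfl i _ rfl, d_inc_succ rfl i _ rfl,
          map_add, map_neg, LinearMap.add_apply, LinearMap.neg_apply, lin_units_smul₂,
          totalAct_inc _ (i + 1) _ (show r + 1 + p = r + p + 1 by omega),
          totalAct_inc _ (i + 1) _ (show r + (p + 1) = r + p + 1 by omega),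
          totalAct_inc _ i _ rfl,
          (S.F (i + 1)).d_act' rfl rfl rfl rfl, map_add, lin_units_smul, smul_add, smul_smul,
          (S.D i).app_act, ← Int.negOnePow_add, show q.negOnePow = -((i : ℤ) + r).negOnePow by
            rw [← Int.negOnePow_succ]
            exact negOnePow_congr ⟨-i - 1, by push_cast at hr; rw [hr]; ring⟩, Units.neg_smul]
        abel
    | hadd z z' hz hz' =>
      simp only [map_add, LinearMap.add_apply, hz, hz', smul_add]
      abel

end Resolving

end DGModule

/-! ### Homomorphisms out of total modules. -/

namespace DGModule

open CochainComplex

variable {C : DGCat.{v, u₁, u₂} k}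

namespace Resolving

variable (S : Resolving.{v, u₁, u₂, w} C)

section Retyped

variable {S}

/-- The inclusion of a summand of the total module. -/
def tinc (i : ℕ) {X : C.Obj} {q n : ℤ} (h : q = n + i) :
    ((S.F i).obj X).X q →ₗ[k] (S.total.obj X).X n :=
  inc i h

/-- Linear maps out of the total module. -/
def tdesc {Z : Type*} [AddCommGroup Z] [Module k Z] {X : C.Obj} {n : ℤ}
    (F : ∀ (i : ℕ) (q : ℤ), q = n + i → ((S.F i).obj X).X q →ₗ[k] Z) :
    (S.total.obj X).X n →ₗ[k] Z :=
  totalDesc F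

theorem tdesc_tinc {Z : Type*} [AddCommGroup Z] [Module k Z] {X : C.Obj} {n : ℤ}
    (F : ∀ (i : ℕ) (q : ℤ), q = n + i → ((S.F i).obj X).X q →ₗ[k] Z) (i : ℕ) {q : ℤ}
    (h : q = n + i) (x : ((S.F i).obj X).X q) : tdesc F (tinc i h x) = F i q h x :=
  totalDesc_inc F i h x

theorem tinc_induction {X : C.Obj} {n : ℤ} {motive : (S.total.obj X).X n → Prop}
    (z : (S.total.obj X).X n)
    (hinc : ∀ (i : ℕ) (q : ℤ) (h : q = n + i) (x : ((S.F i).obj X).X q), motive (tinc i h x))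
    (hadd : ∀ z z', motive z → motive z' → motive (z + z')) : motive z :=
  total_induction z hinc hadd

theorem d_tinc_zero {X : C.Obj} {n n' : ℤ} (hn : n + 1 = n') {q q' : ℤ} (h : q = n + (0 : ℕ))
    (hq : q + 1 = q') (x : ((S.F 0).obj X).X q) :
    ((S.total.obj X).d n n').hom (tinc 0 h x) =
      tinc 0 (show q' = n' + (0 : ℕ) by omega) ((((S.F 0).obj X).d q q').hom x) :=
  d_inc_zero hn h hq x

theorem d_tinc_succ {X : C.Obj} {n n' : ℤ} (hn : n + 1 = n') (i : ℕ) {q q' : ℤ}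
    (h : q = n + (i + 1 : ℕ)) (hq : q + 1 = q') (x : ((S.F (i + 1)).obj X).X q) :
    ((S.total.obj X).d n n').hom (tinc (i + 1) h x) =
      -((i : ℤ).negOnePow • tinc (i + 1) (show q' = n' + (i + 1 : ℕ) by omega)
        ((((S.F (i + 1)).obj X).d q q').hom x)) +
      tinc i (show q = n' + i by push_cast at h; omega) ((((S.D i).app X).f q).hom x) :=
  d_inc_succ hn i h hq x

theorem act_tinc {X Y : C.Obj} {q p n r s : ℤ} (h : q + p = n) (i : ℕ) (hr : r = q + i)
    (hs : r + p = s) (m : ((S.F i).obj Y).X r) (x : (C.Hom X Y).X p) :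
    S.total.act h (tinc i hr m) x = tinc i (show s = n + i by omega) ((S.F i).act hs m x) :=
  totalAct_inc h i hr hs m x

end Retyped

/-- The inclusion of a summand, as a homomorphism of graded modules. -/
def incH (i : ℕ) : homSubmodule (S.F i) S.total (-i) :=
  mkHom (fun X _ _ h => tinc i (by omega)) (by
    intro X Y q p j q' l h h₁ h₂ m x
    exact (act_tinc (by omega) i (by omega) h m x).symm)

theorem ap_incH (i : ℕ) (X : C.Obj) {p q : ℤ} (h : p + -(i : ℤ) = q) (x : ((S.F i).obj X).X p) :
    ap (S.incH i) X h x = tinc i (by omega) x :=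
  ap_mkHom _ _ X h x

variable {S} in
/-- Homomorphisms of graded modules out of the total module. -/
def totalHom {N : DGModule.{v, u₁, u₂, w} C} {n : ℤ}
    (f : ∀ i : ℕ, homSubmodule (S.F i) N (n - i)) : homSubmodule S.total N n :=
  mkHom (fun X p q h => tdesc fun i r hr => ap (f i) X (by omega)) (by
    intro X Y q p j q' l h h₁ h₂ m x
    induction m using tinc_induction with
    | hinc i r hr m =>
      rw [act_tinc h i hr rfl, tdesc_tinc, tdesc_tinc]
      exact ap_act _ _ _ _ _ _ _
    | hadd z z' hz hz' => rw [map_add, LinearMap.add_apply, map_add, hz, hz', map_add, map_add,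
        LinearMap.add_apply])

variable {S} in
theorem ap_totalHom {N : DGModule.{v, u₁, u₂, w} C} {n : ℤ}
    (f : ∀ i : ℕ, homSubmodule (S.F i) N (n - i)) (X : C.Obj) {p q r : ℤ} (h : p + n = q) (i : ℕ)
    (hr : r = p + i) (x : ((S.F i).obj X).X r) :
    ap (totalHom f) X h (tinc i hr x) = ap (f i) X (by omega) x :=
  (ap_mkHom _ _ X h _).trans (tdesc_tinc _ _ _ _)

theorem hd_incH_zero (n : ℤ) : hd (S.F 0) S.total (-(0 : ℕ)) n (S.incH 0) = 0 := by
  by_cases hn : -((0 : ℕ) : ℤ) + 1 = n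
  · refine hom_ext fun X p q h x => ?_
    rw [ap_hd hn _ X h rfl (show q - 1 + 1 = q by omega), ap_incH, ap_incH]
    rw [d_tinc_zero (show q - 1 + 1 = q by omega) _ rfl, ap_zero,
      show n.negOnePow = -1 by rw [← hn, Int.negOnePow_succ]; rfl, Units.neg_smul, one_smul,
      add_neg_cancel]
  · exact Subtype.ext (funext fun X => δ_shape _ n hn ((S.incH 0).1 X))

/-- The total module is an iterated cone: the inclusion of each summand is closed only up to the map
to the preceding summand. -/
theorem hd_incH_succ (i : ℕ) :
    hd (S.F (i + 1)) S.total (-(i + 1 : ℕ)) (-i) (S.incH (i + 1)) =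
      homComp (add_zero _) (S.incH i) (S.D i).toHom := by
  refine hom_ext fun X p q h x => ?_
  rw [ap_hd (by push_cast; omega) _ X h rfl (show q - 1 + 1 = q by omega), ap_incH, ap_incH,
    ap_homComp _ _ _ _ _ (add_zero p) h, ap_toHom, ap_incH]
  rw [d_tinc_succ (show q - 1 + 1 = q by omega) i _ rfl, Int.negOnePow_neg]
  abel

theorem totalHom_hom_ext {N : DGModule.{v, u₁, u₂, w} C} {n : ℤ} {f g : homSubmodule S.total N n}
    (h : ∀ i : ℕ, homComp (show n + -(i : ℤ) = n - i by omega) f (S.incH i) =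
      homComp (show n + -(i : ℤ) = n - i by omega) g (S.incH i)) : f = g := by
  refine hom_ext fun X p q hpq x => ?_
  induction x using tinc_induction with
  | hinc i r hr x =>
    have := congrArg (fun f => ap f X (show r + (n - i) = q by omega) x) (h i)
    rw [ap_homComp _ _ _ _ _ (show r + -(i : ℤ) = p by omega) hpq,
      ap_homComp _ _ _ _ _ (show r + -(i : ℤ) = p by omega) hpq, ap_incH] at this
    exact this
  | hadd z z' hz hz' => rw [map_add, map_add, hz, hz']

theorem totalHom_comp_incH {N : DGModule.{v, u₁, u₂, w} C} {n : ℤ}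
    (f : ∀ i : ℕ, homSubmodule (S.F i) N (n - i)) (i : ℕ) :
    homComp (show n + -(i : ℤ) = n - i by omega) (totalHom f) (S.incH i) = f i := by
  refine hom_ext fun X p q hpq x => ?_
  rw [ap_homComp _ _ _ _ _ rfl (show p + -(i : ℤ) + n = q by omega), ap_incH]
  exact ap_totalHom _ _ _ _ _ _

theorem D_comp_D (i : ℕ) :
    homComp (add_zero 0) (S.D i).toHom (S.D (i + 1)).toHom = 0 := by
  refine hom_ext fun X p q hpq x => ?_
  obtain rfl : p = q := by omega
  rw [ap_homComp _ _ _ _ _ (add_zero p) (add_zero p), ap_toHom, ap_toHom, S.D_D, ap_zero]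

-- A cocycle out of the total module is a family of cochains on the summands. A bounding family is
-- built by recursion on the index, each stage being solvable by h-projectivity of one summand. A
-- direct sum has no convergence condition on maps out of it, so an infinite recursion is harmless.
variable {S} in
theorem isHProjective_total (hS : ∀ i, (S.F i).IsHProjective) : S.total.IsHProjective := by
  intro N hN
  rw [acyclic_iff_exists]
  intro n f hf
  change homSubmodule S.total N n at f
  change hd S.total N n (n + 1) f = 0 at hf
  change ∃ g : homSubmodule S.total N (n - 1), hd S.total N (n - 1) n g = f
  let F (i : ℕ) : homSubmodule (S.F i) N (n - i) := homComp (by omega) f (S.incH i)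
  have hF₀ : hd (S.F 0) N (n - (0 : ℕ)) (n + 1 - (0 : ℕ)) (F 0) = 0 :=
    hd_comp_closed _ rfl rfl (by omega) f hf _ (S.hd_incH_zero _)
  have hF (i : ℕ) : hd (S.F (i + 1)) N (n - (i + 1 : ℕ)) (n - i) (F (i + 1)) =
      n.negOnePow • homComp (add_zero (n - i)) (F i) (S.D i).toHom := by
    rw [hd_comp_of_closed_left _ rfl (show -((i + 1 : ℕ) : ℤ) + 1 = -i by push_cast; omega)
      -- Closedness of `f` turns the boundary of the next component into the preceding component
      -- composed with the map of the sequence.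
      (by push_cast; omega) f hf, hd_incH_succ]
    congr 1
    exact (homComp_assoc _ _ _ _ _ _ _).symm
  -- The invariant is weaker than `d h = F i`: equality is needed only after composing with the next
  -- map `D i`, which is what makes the next right-hand side closed. It is preserved because the
  -- correction term contains `D ∘ D = 0`.
  let I (i : ℕ) (h : homSubmodule (S.F i) N (n - 1 - i)) : Prop :=
    homComp (add_zero (n - i)) (hd (S.F i) N (n - 1 - i) (n - i) h) (S.D i).toHom =
      homComp (add_zero (n - i)) (F i) (S.D i).toHom
  obtain ⟨h₀, hh₀⟩ := (hS 0).exists_hd_eq hN (show n - 1 - (0 : ℕ) + 1 = n - (0 : ℕ) by omega)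
    (by omega) (F 0) hF₀
  have step (i : ℕ) (h : homSubmodule (S.F i) N (n - 1 - i)) (hI : I i h) :
      ∃ h' : homSubmodule (S.F (i + 1)) N (n - 1 - (i + 1 : ℕ)), I (i + 1) h' ∧
        hd (S.F (i + 1)) N (n - 1 - (i + 1 : ℕ)) (n - (i + 1 : ℕ)) h' = F (i + 1) +
          (n - 1).negOnePow • homComp (show n - 1 - i + 0 = n - (i + 1 : ℕ) by push_cast; omega) h
            (S.D i).toHom := by
    obtain ⟨h', hh'⟩ := (hS (i + 1)).exists_hd_eq hN
      (show n - 1 - (i + 1 : ℕ) + 1 = n - (i + 1 : ℕ) by omega)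
      (show n - (i + 1 : ℕ) + 1 = n - i by push_cast; omega) (F (i + 1) +
          (n - 1).negOnePow • homComp (show n - 1 - i + 0 = n - (i + 1 : ℕ) by push_cast; omega) h
            (S.D i).toHom) (by
        rw [map_add, hF, hd_units_smul,
          hd_comp_of_closed_right _ (show n - 1 - (i : ℤ) + 1 = n - i by omega) (zero_add 1)
            (by push_cast; omega) _ _ (hd_toHom _), hI, show (n - 1).negOnePow = -n.negOnePow by
            rw [← Int.negOnePow_succ]; exact negOnePow_congr ⟨-1, by ring⟩, Units.neg_smul,
          add_neg_cancel])
    refine ⟨h', ?_, hh'⟩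
    change homComp _ (hd _ _ _ _ h') _ = _
    rw [hh', homComp_add_left, units_smul_homComp, homComp_assoc _ _ (add_zero 0) (by push_cast; omega),
      D_comp_D, map_zero, smul_zero, add_zero]
  choose next hnext using step
  let seq (i : ℕ) : {h : homSubmodule (S.F i) N (n - 1 - i) // I i h} :=
    Nat.rec ⟨h₀, by change homComp _ (hd _ _ _ _ h₀) _ = _; rw [hh₀]⟩
      (fun i h => ⟨next i h.1 h.2, (hnext i h.1 h.2).1⟩) i
  have hseq (i : ℕ) : hd (S.F (i + 1)) N (n - 1 - (i + 1 : ℕ)) (n - (i + 1 : ℕ)) (seq (i + 1)).1 =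
      F (i + 1) + (n - 1).negOnePow •
        homComp (show n - 1 - i + 0 = n - (i + 1 : ℕ) by push_cast; omega) (seq i).1
          (S.D i).toHom := (hnext i (seq i).1 (seq i).2).2
  refine ⟨totalHom fun i => (seq i).1, S.totalHom_hom_ext fun i => ?_⟩
  match i with
  | 0 =>
    refine Eq.trans ?_ hh₀
    rw [← hd_comp_of_closed_right (show n - 1 + -((0 : ℕ) : ℤ) = n - 1 - (0 : ℕ) by omega)
      (by omega) rfl (by omega) _ _ (S.hd_incH_zero _), totalHom_comp_incH]
    rfl
  | i + 1 =>
    have := hd_comp (show n - 1 + -((i + 1 : ℕ) : ℤ) = n - 1 - (i + 1 : ℕ) by omega)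
      (show n - 1 + 1 = n by omega) (show -((i + 1 : ℕ) : ℤ) + 1 = -i by push_cast; omega)
      (show n - 1 - (i + 1 : ℕ) + 1 = n - (i + 1 : ℕ) by omega)
      (totalHom fun i => (seq i).1) (S.incH (i + 1))
    rw [totalHom_comp_incH, hseq, hd_incH_succ, ← homComp_assoc (show n - 1 + -(i : ℤ) = n - 1 - i by
      omega) (by push_cast; omega), totalHom_comp_incH, add_left_inj] at this
    exact this.symm

end Resolving

end DGModule

namespace DGModule

open CochainComplex

/-! ### Kernels -/

section Kernel

variable {C : DGCat.{v, u₁, u₂} k} {M N : DGModule.{v, u₁, u₂, w} C} (f : Morphism M N)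

/-- The kernel of a morphism of dg modules. -/
def kerMod : DGModule.{v, u₁, u₂, w} C where
  obj X :=
    { X n := ModuleCat.of k (LinearMap.ker ((f.app X).f n).hom)
      d n n' := ModuleCat.ofHom (((M.obj X).d n n').hom.restrict (fun x hx => by
        rw [LinearMap.mem_ker] at hx ⊢
        rw [← hom_comm_apply, hx, map_zero]))
      shape n n' h := ModuleCat.hom_ext (LinearMap.ext fun x => Subtype.ext (by
        change ((M.obj X).d n n').hom x.1 = 0
        rw [(M.obj X).shape n n' h]
        rfl))
      d_comp_d' _ _ _ _ _ := ModuleCat.hom_ext (LinearMap.ext fun x => Subtype.ext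
        (d_d_apply _ _ _ _ x.1)) }
  act {X Y q p n} h := LinearMap.mk₂ k
    (fun (m : LinearMap.ker ((f.app Y).f q).hom) x =>
      (⟨M.act h m.1 x, by rw [LinearMap.mem_ker, f.app_act, m.2, map_zero, LinearMap.zero_apply]⟩ :
        LinearMap.ker ((f.app X).f n).hom))
    (fun m m' x => Subtype.ext (by
      change M.act h (m.1 + m'.1) x = M.act h m.1 x + M.act h m'.1 x
      rw [map_add, LinearMap.add_apply]))
    (fun c m x => Subtype.ext (by
      change M.act h (c • m.1) x = c • M.act h m.1 x
      rw [map_smul, LinearMap.smul_apply]))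
    (fun m x x' => Subtype.ext (map_add _ _ _))
    (fun c m x => Subtype.ext (map_smul _ _ _))
  act_id m := Subtype.ext (M.act_id m.1)
  act_act h₁ h₂ h₃ h₄ m y x := Subtype.ext (M.act_act h₁ h₂ h₃ h₄ m.1 y x)
  d_act {X Y q p n} h m x := Subtype.ext (M.d_act h m.1 x)

/-- The inclusion of the kernel. -/
def kerInc : Morphism (kerMod f) M where
  app X :=
    { f n := ModuleCat.ofHom (LinearMap.ker ((f.app X).f n).hom).subtype
      comm' _ _ _ := rfl }
  app_act _ _ _ := rfl

theorem app_kerInc {X : C.Obj} {n : ℤ} (x : ((kerMod f).obj X).X n) :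
    ((f.app X).f n).hom ((((kerInc f).app X).f n).hom x) = 0 :=
  x.2

theorem kerInc_injective {X : C.Obj} {n : ℤ} {x y : ((kerMod f).obj X).X n}
    (h : (((kerInc f).app X).f n).hom x = (((kerInc f).app X).f n).hom y) : x = y :=
  Subtype.ext h

/-- Linear maps into the kernel. -/
def kerLift {V : Type*} [AddCommGroup V] [Module k V] {X : C.Obj} {n : ℤ}
    (g : V →ₗ[k] (M.obj X).X n) (hg : ∀ v, ((f.app X).f n).hom (g v) = 0) :
    V →ₗ[k] ((kerMod f).obj X).X n :=
  g.codRestrict (LinearMap.ker ((f.app X).f n).hom) hg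

end Kernel

/-! ### Augmentations of total modules -/

namespace Resolving

variable {C : DGCat.{v, u₁, u₂} k} {S : Resolving.{v, u₁, u₂, w} C}
  {N : DGModule.{v, u₁, u₂, w} C} (ε : Morphism (S.F 0) N)
  (hε : ∀ (X : C.Obj) (q : ℤ) (x : ((S.F 1).obj X).X q),
    ((ε.app X).f q).hom ((((S.D 0).app X).f q).hom x) = 0)

/-- The components of an augmentation. -/
def augComp : ∀ i : ℕ, homSubmodule (S.F i) N (0 - i)
  | 0 => ε.toHom
  | _ + 1 => 0

theorem ap_totalHom_augComp_zero {X : C.Obj} {n q n' : ℤ} (h : q = n + (0 : ℕ)) (h' : n + 0 = n')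
    (h'' : q + 0 = n') (x : ((S.F 0).obj X).X q) :
    ap (totalHom (augComp ε)) X h' (tinc 0 h x) = ap ε.toHom X h'' x :=
  ap_totalHom _ X _ 0 h x

theorem ap_totalHom_augComp_succ {X : C.Obj} {n q n' : ℤ} (i : ℕ) (h : q = n + (i + 1 : ℕ))
    (h' : n + 0 = n') (x : ((S.F (i + 1)).obj X).X q) :
    ap (totalHom (augComp ε)) X h' (tinc (i + 1) h x) = 0 :=
  (ap_totalHom _ X _ (i + 1) h x).trans (ap_zero X _ x)

include hε in
theorem hd_totalHom_augComp : hd S.total N 0 1 (totalHom (augComp ε)) = 0 := by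
  refine hom_ext fun X p q h x => ?_
  rw [ap_hd (zero_add 1) _ X h rfl (show q - 1 + 1 = q by omega), ap_zero]
  induction x using tinc_induction with
  | hinc i r hr x =>
    match i with
    | 0 =>
      rw [d_tinc_zero rfl _ rfl, ap_totalHom_augComp_zero ε _ _ (show r + 0 = q - 1 by simp at hr; omega),
        ap_totalHom_augComp_zero ε _ _ (show r + 1 + 0 = q by simp at hr; omega),
        ← ap_hd (zero_add 1) ε.toHom X (show r + 1 = q by simp at hr; omega) rfl (by omega),
        hd_toHom, ap_zero]
    | 0 + 1 =>
      rw [d_tinc_succ rfl 0 _ rfl, ap_totalHom_augComp_succ, map_zero, map_add, map_neg,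
        lin_units_smul, ap_totalHom_augComp_succ, ap_totalHom_augComp_zero ε _ _
        (show r + 0 = q by simp at hr; omega)]
      obtain rfl : r = q := by simp at hr; omega
      rw [ap_toHom, hε]
      simp
    | i + 1 + 1 =>
      rw [d_tinc_succ rfl (i + 1) _ rfl, ap_totalHom_augComp_succ, map_zero, map_add, map_neg,
        lin_units_smul, ap_totalHom_augComp_succ, ap_totalHom_augComp_succ]
      simp
  | hadd z z' hz hz' =>
    simp only [map_add, smul_add]
    rw [add_add_add_comm, hz, hz', add_zero]

/-- The morphism out of the total module given by an augmentation. -/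
def aug : Morphism S.total N :=
  Morphism.ofClosed (totalHom (augComp ε)) (hd_totalHom_augComp ε hε)

theorem aug_tinc_zero {X : C.Obj} {n : ℤ} (h : n = n + (0 : ℕ)) (x : ((S.F 0).obj X).X n) :
    (((aug ε hε).app X).f n).hom (tinc 0 h x) = ((ε.app X).f n).hom x :=
  (ap_totalHom_augComp_zero ε h (add_zero n) (add_zero n) x).trans (ap_toHom ε X x)

theorem aug_tinc_succ {X : C.Obj} {n q : ℤ} (i : ℕ) (h : q = n + (i + 1 : ℕ))
    (x : ((S.F (i + 1)).obj X).X q) : (((aug ε hε).app X).f n).hom (tinc (i + 1) h x) = 0 :=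
  ap_totalHom_augComp_succ ε i h (add_zero n) x

section Contraction

variable {X : C.Obj} (σ : ∀ q : ℤ, (N.obj X).X q →ₗ[k] ((S.F 0).obj X).X q)
  (τ : ∀ (i : ℕ) (q : ℤ), ((S.F i).obj X).X q →ₗ[k] ((S.F (i + 1)).obj X).X q)

/-- The homotopy on the total module given by a contraction of the augmented sequence. -/
def totalHomotopy (n n' : ℤ) (h : n' + 1 = n) : (S.total.obj X).X n →ₗ[k] (S.total.obj X).X n' :=
  tdesc fun i q hq => (tinc (i + 1) (show q = n' + (i + 1 : ℕ) by push_cast; omega)).comp (τ i q)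

theorem totalHomotopy_tinc {n n' : ℤ} (h : n' + 1 = n) (i : ℕ) {q : ℤ} (hq : q = n + i)
    (x : ((S.F i).obj X).X q) :
    totalHomotopy τ n n' h (tinc i hq x) =
      tinc (i + 1) (show q = n' + (i + 1 : ℕ) by push_cast; omega) (τ i q x) :=
  tdesc_tinc _ _ _ _

variable
  (hτd : ∀ (i : ℕ) (q q' : ℤ) (x : ((S.F i).obj X).X q),
    (((S.F (i + 1)).obj X).d q q').hom (τ i q x) = τ i q' ((((S.F i).obj X).d q q').hom x))
  (hτ₀ : ∀ (q : ℤ) (x : ((S.F 0).obj X).X q),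
    (((S.D 0).app X).f q).hom (τ 0 q x) = x - σ q (((ε.app X).f q).hom x))
  (hτ : ∀ (i : ℕ) (q : ℤ) (x : ((S.F (i + 1)).obj X).X q),
    (((S.D (i + 1)).app X).f q).hom (τ (i + 1) q x) + τ i q ((((S.D i).app X).f q).hom x) = x)

-- The maps `τ` commute with the internal differentials, whose contributions cancel by the
-- alternating sign. What remains is `D τ + τ D`, the identity except for `σ ε` at the bottom.
include hτd hτ₀ hτ in
theorem d_totalHomotopy {n n' m : ℤ} (h : n' + 1 = n) (h' : n + 1 = m) (hn : n = n + (0 : ℕ))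
    (z : (S.total.obj X).X n) :
    ((S.total.obj X).d n' n).hom (totalHomotopy τ n n' h z) +
      totalHomotopy τ m n (by omega) (((S.total.obj X).d n m).hom z) =
        z - tinc 0 hn (σ n ((((aug ε hε).app X).f n).hom z)) := by
  induction z using tinc_induction with
  | hinc i q hq x =>
    match i with
    | 0 =>
      obtain rfl : q = n := by simpa using hq
      rw [totalHomotopy_tinc, d_tinc_succ h 0 _ rfl, d_tinc_zero h' _ rfl, totalHomotopy_tinc, hτd,
        hτ₀, aug_tinc_zero, map_sub]
      simp
    | i + 1 =>
      rw [totalHomotopy_tinc, d_tinc_succ h (i + 1) _ rfl, d_tinc_succ h' i _ rfl, map_add, map_neg,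
        lin_units_smul, totalHomotopy_tinc, totalHomotopy_tinc, hτd, aug_tinc_succ, map_zero,
        map_zero, sub_zero, negOnePow_cast_succ, Units.neg_smul]
      conv_rhs => rw [← hτ i q x, map_add]
      abel
  | hadd z z' hz hz' =>
    simp only [map_add]
    rw [add_add_add_comm, hz, hz']
    abel

variable
  (hσd : ∀ (q q' : ℤ) (x : (N.obj X).X q),
    (((S.F 0).obj X).d q q').hom (σ q x) = σ q' (((N.obj X).d q q').hom x))
  (hεσ : ∀ (q : ℤ) (x : (N.obj X).X q), ((ε.app X).f q).hom (σ q x) = x)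

-- The section `σ`, placed in the bottom summand, inverts the augmentation up to homotopy. The
-- contraction is merely linear and is required at `X` alone; it need not respect the module action.
include hτd hτ₀ hτ hσd hεσ in
theorem quasiIso_aug : QuasiIso ((aug ε hε).app X) := by
  rw [quasiIso_iff_isQuasiIsoMap]
  refine ⟨fun i j x => hom_comm_apply _ i j x, fun n x hx hy => ?_, fun n y hy => ?_⟩
  · obtain ⟨y, hy⟩ := hy
    have := d_totalHomotopy ε hε σ τ hτd hτ₀ hτ (show n - 1 + 1 = n by omega) rfl (by simp) x
    rw [hx, map_zero, add_zero, eq_sub_iff_add_eq] at this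
    refine ⟨totalHomotopy τ n (n - 1) (by omega) x + tinc 0 (by simp) (σ (n - 1) y), ?_⟩
    rw [map_add, d_tinc_zero (by omega) _ (show n - 1 + 1 = n by omega), hσd, hy]
    exact this
  · refine ⟨tinc 0 (by simp) (σ n y), ?_, 0, ?_⟩
    · rw [d_tinc_zero rfl _ rfl, hσd, hy, map_zero, map_zero]
    · rw [aug_tinc_zero, hεσ, map_zero, sub_self]

end Contraction

end Resolving

end DGModule

/-- The dg algebra of endomorphisms of an object of a dg category. -/
abbrev DGCat.corner (C : DGCat.{v, u₁, u₂} k) (P : C.Obj) : DGCat.{v, u, u₂} k :=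
  C.full (fun _ : PUnit.{u + 1} => P)

/-- The object of the dg algebra of endomorphisms of an object. -/
def DGCat.pt (C : DGCat.{v, u₁, u₂} k) (P : C.Obj) : (C.corner P).Obj :=
  PUnit.unit

namespace DGModule

open CochainComplex

theorem Morphism.toHom_injective {C : DGCat.{v, u₁, u₂} k} {M N : DGModule.{v, u₁, u₂, w} C}
    {f g : Morphism M N} (h : f.toHom = g.toHom) : f = g := by
  have : f.app = g.app := funext fun X => by
    ext n x
    have := congrArg (fun F => ap F X (add_zero n) x) h
    rwa [ap_toHom, ap_toHom] at this
  cases f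
  cases g
  congr

/-! ### Restriction to the endomorphisms of an object -/

section Res

variable {C : DGCat.{v, u₁, u₂} k} (P : C.Obj)

/-- The restriction of a dg module to the endomorphisms of an object. -/
def res (N : DGModule.{v, u₁, u₂, w} C) : DGModule.{v, u, u₂, w} (C.corner P) where
  obj _ := N.obj P
  act h := N.act h
  act_id := N.act_id
  act_act := N.act_act
  d_act := N.d_act

variable {P} {M N : DGModule.{v, u₁, u₂, w} C}

/-- The restriction of a homomorphism of graded modules. -/
def resHom {n : ℤ} : homSubmodule M N n →ₗ[k] homSubmodule (res.{v, u} P M) (res P N) n where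
  toFun f := ⟨fun _ => f.1 P, fun _ _ => f.2 P P⟩
  map_add' _ _ := rfl
  map_smul' _ _ := rfl

theorem hd_resHom {n n' : ℤ} (f : homSubmodule M N n) :
    hd _ _ n n' (resHom.{v, u} (P := P) f) = resHom (hd M N n n' f) :=
  rfl

/-- The restriction of a morphism. -/
def resMor (f : Morphism M N) : Morphism (res.{v, u} P M) (res P N) where
  app _ := f.app P
  app_act h := f.app_act h

theorem toHom_resMor (f : Morphism M N) : (resMor.{v, u} (P := P) f).toHom = resHom f.toHom :=
  rfl

/-- The restriction of a sequence of dg modules. -/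
def Resolving.res (S : Resolving.{v, u₁, u₂, w} C) : Resolving.{v, u, u₂, w} (C.corner P) where
  F i := DGModule.res P (S.F i)
  D i := resMor (S.D i)
  D_D i _ := S.D_D i P

end Res

/-! ### Derived induction from the endomorphisms of an object. -/

section Tower

variable {C : DGCat.{v, u₁, u} k} (P : C.Obj)

/-- The counit of the free module adjunction. -/
def counit (T : DGModule.{v, u, u, u} (C.corner P)) :
    Morphism (freeMod (C := C.corner P) (T.obj (C.pt P)) (C.pt P)) T :=
  freeLift (𝟙 _)

/-- The iterated kernels of the counits. -/
def tower (T : DGModule.{v, u, u, u} (C.corner P)) : ℕ → DGModule.{v, u, u, u} (C.corner P)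
  | 0 => T
  | i + 1 => kerMod (counit P (tower T i))

variable {P} (T : DGModule.{v, u, u, u} (C.corner P))

theorem counit_ftmul {X : (C.corner P).Obj} {a b p : ℤ} (hab : a + b = p)
    (t : (T.obj (C.pt P)).X a) (f : ((C.corner P).Hom X (C.pt P)).X b) :
    (((counit P T).app X).f p).hom (ftmul hab t f) = T.act hab t f :=
  freeLift_ftmul _ hab t f

/-- The inclusion of the next stage of the tower. -/
def towerInc (i : ℕ) : Morphism (tower P T (i + 1))
    (freeMod (C := C.corner P) ((tower P T i).obj (C.pt P)) (C.pt P)) :=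
  kerInc (counit P (tower P T i))

/-- The inclusion of the next stage of the tower, as a chain map to a free module. -/
def towerIncP (i : ℕ) : (tower P T (i + 1)).obj (C.pt P) ⟶
    (freeMod ((tower P T i).obj (C.pt P)) P).obj P :=
  (towerInc T i).app (C.pt P)

/-- The counit, as a chain map from a free module. -/
def counitP (i : ℕ) : (freeMod ((tower P T i).obj (C.pt P)) P).obj P ⟶
    (tower P T i).obj (C.pt P) :=
  (counit P (tower P T i)).app (C.pt P)

theorem towerIncP_act (i : ℕ) {q p n : ℤ} (h : q + p = n)
    (t : ((tower P T (i + 1)).obj (C.pt P)).X q) (f : (C.Hom P P).X p) :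
    ((towerIncP T i).f n).hom ((tower P T (i + 1)).act (X := C.pt P) h t f) =
      (freeMod ((tower P T i).obj (C.pt P)) P).act h (((towerIncP T i).f q).hom t) f :=
  (towerInc T i).app_act (X := C.pt P) h t f

theorem counitP_ftmul (i : ℕ) {a b p : ℤ} (hab : a + b = p)
    (t : ((tower P T i).obj (C.pt P)).X a) (f : (C.Hom P P).X b) :
    ((counitP T i).f p).hom (ftmul hab t f) = (tower P T i).act (X := C.pt P) hab t f :=
  counit_ftmul (tower P T i) (X := C.pt P) hab t f

theorem counitP_towerIncP (i : ℕ) {n : ℤ} (t : ((tower P T (i + 1)).obj (C.pt P)).X n) :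
    ((counitP T i).f n).hom (((towerIncP T i).f n).hom t) = 0 :=
  app_kerInc (counit P (tower P T i)) t

/-- The maps of the resolution. -/
def lindD (i : ℕ) : Morphism (freeMod ((tower P T (i + 1)).obj (C.pt P)) P)
    (freeMod ((tower P T i).obj (C.pt P)) P) :=
  freeLift (towerIncP T i)

theorem lindD_ftmul (i : ℕ) {X : C.Obj} {a b p : ℤ} (hab : a + b = p)
    (t : ((tower P T (i + 1)).obj (C.pt P)).X a) (f : (C.Hom X P).X b) :
    (((lindD T i).app X).f p).hom (ftmul hab t f) =
      (freeMod ((tower P T i).obj (C.pt P)) P).act hab (((towerIncP T i).f a).hom t) f :=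
  freeLift_ftmul _ hab t f

/-- At `P` the map of the resolution is the counit followed by the inclusion of a kernel. This
yields both the vanishing of composites and exactness there. -/
theorem lindD_eq (i : ℕ) {p : ℤ} (z : ((freeMod ((tower P T (i + 1)).obj (C.pt P)) P).obj P).X p) :
    (((lindD T i).app P).f p).hom z =
      ((towerIncP T i).f p).hom (((counitP T (i + 1)).f p).hom z) := by
  induction z using free_induction with
  | htmul a b hab t f => rw [lindD_ftmul, counitP_ftmul, towerIncP_act]
  | hadd z z' hz hz' => simp only [map_add, hz, hz']

/-- The sequence of free modules resolving a module. -/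
def lindSeq : Resolving.{v, u₁, u, u} C where
  F i := freeMod ((tower P T i).obj (C.pt P)) P
  D i := lindD T i
  D_D i X q x := by
    induction x using free_induction with
    | htmul a b hab t f =>
      rw [lindD_ftmul, (lindD T i).app_act, lindD_eq, counitP_towerIncP, map_zero, map_zero,
        LinearMap.zero_apply]
    | hadd z z' hz hz' => rw [map_add, map_add, hz, hz', add_zero]

/-- The derived induction of a module along the inclusion of the endomorphisms of an object. -/
def lind : DGModule.{v, u₁, u, u} C := (lindSeq T).total

theorem isHProjective_lind : (lind T).IsHProjective :=
  Resolving.isHProjective_total fun _ => isHProjective_freeMod _ _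

/-- The restriction of a free module on `P` is by definition the free module over the endomorphism
algebra of `P`, and restriction commutes with total modules. -/
theorem isHProjective_res_lind : (res.{v, u} P (lind T)).IsHProjective :=
  Resolving.isHProjective_total (S := (lindSeq T).res (P := P))
    fun i => isHProjective_freeMod (C := C.corner P) ((tower P T i).obj (C.pt P)) (C.pt P)

theorem counit_lindD (X : (C.corner P).Obj) (q : ℤ)
    (x : ((freeMod ((tower P T 1).obj (C.pt P)) P).obj P).X q) :
    (((counit P T).app X).f q).hom ((((lindD T 0).app P).f q).hom x) = 0 :=
  (congrArg ((counitP T 0).f q).hom (lindD_eq T 0 x)).trans (counitP_towerIncP T 0 _)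

/-- The augmentation of the resolution. -/
def lindAug : Morphism (res.{v, u} P (lind T)) T :=
  Resolving.aug (S := (lindSeq T).res (P := P)) (counit P T) (counit_lindD T)

/-- The section of the counit. -/
def counitSection (i : ℕ) (q : ℤ) : ((tower P T i).obj (C.pt P)).X q →ₗ[k]
    ((freeMod ((tower P T i).obj (C.pt P)) P).obj P).X q :=
  (ftmul (add_zero q)).flip (C.id P)

theorem counitP_counitSection (i : ℕ) (q : ℤ) (t : ((tower P T i).obj (C.pt P)).X q) :
    ((counitP T i).f q).hom (counitSection T i q t) = t :=
  (counitP_ftmul T i (add_zero q) t (C.id P)).trans ((tower P T i).act_id (X := C.pt P) t)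

theorem d_counitSection (i : ℕ) (q q' : ℤ) (t : ((tower P T i).obj (C.pt P)).X q) :
    (((freeMod ((tower P T i).obj (C.pt P)) P).obj P).d q q').hom (counitSection T i q t) =
      counitSection T i q' ((((tower P T i).obj (C.pt P)).d q q').hom t) := by
  by_cases h : q + 1 = q'
  · exact d_ftmul_id h (add_zero q) (add_zero q') t
  · rw [HomologicalComplex.shape _ q q' h, HomologicalComplex.shape _ q q' h]
    exact (map_zero (counitSection T i q')).symm

/-- The projection to the kernel of the counit. -/
def kerProj (i : ℕ) (q : ℤ) : ((freeMod ((tower P T i).obj (C.pt P)) P).obj P).X q →ₗ[k]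
    ((tower P T (i + 1)).obj (C.pt P)).X q :=
  kerLift (counit P (tower P T i)) (LinearMap.id - (counitSection T i q).comp
    ((counitP T i).f q).hom) (fun x => by
    change ((counitP T i).f q).hom (x - counitSection T i q (((counitP T i).f q).hom x)) = 0
    rw [map_sub, counitP_counitSection, sub_self])

theorem towerIncP_kerProj (i : ℕ) (q : ℤ)
    (x : ((freeMod ((tower P T i).obj (C.pt P)) P).obj P).X q) :
    ((towerIncP T i).f q).hom (kerProj T i q x) =
      x - counitSection T i q (((counitP T i).f q).hom x) :=
  rfl

theorem towerIncP_injective (i : ℕ) {q : ℤ} {t t' : ((tower P T (i + 1)).obj (C.pt P)).X q}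
    (h : ((towerIncP T i).f q).hom t = ((towerIncP T i).f q).hom t') : t = t' :=
  kerInc_injective _ h

theorem kerProj_towerIncP (i : ℕ) (q : ℤ) (t : ((tower P T (i + 1)).obj (C.pt P)).X q) :
    kerProj T i q (((towerIncP T i).f q).hom t) = t :=
  towerIncP_injective T i (by
    rw [towerIncP_kerProj, counitP_towerIncP, map_zero, sub_zero])

theorem d_kerProj (i : ℕ) (q q' : ℤ)
    (x : ((freeMod ((tower P T i).obj (C.pt P)) P).obj P).X q) :
    (((tower P T (i + 1)).obj (C.pt P)).d q q').hom (kerProj T i q x) = kerProj T i q'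
      ((((freeMod ((tower P T i).obj (C.pt P)) P).obj P).d q q').hom x) :=
  towerIncP_injective T i (by
    rw [← hom_comm_apply, towerIncP_kerProj, towerIncP_kerProj, map_sub, d_counitSection,
      hom_comm_apply])

/-- The section `t ↦ t ⊗ id` splits each counit linearly. Projecting to the kernel and then applying
the next section contracts the augmented sequence at `P`. -/
theorem isQuasiIso_lindAug : (lindAug T).IsQuasiIso := fun X =>
  Resolving.quasiIso_aug (S := (lindSeq T).res (P := P)) (counit P T) (counit_lindD T)
    (X := X) (fun q => counitSection T 0 q)
    (fun i q => (counitSection T (i + 1) q).comp (kerProj T i q))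
    (fun i q q' x => by
      change ((freeMod ((tower P T i).obj (C.pt P)) P).obj P).X q at x
      exact (d_counitSection T (i + 1) q q' (kerProj T i q x)).trans
        (congrArg (counitSection T (i + 1) q') (d_kerProj T i q q' x)))
    (fun q x => by
      refine (lindD_eq T 0 (counitSection T 1 q (kerProj T 0 q x))).trans ?_
      rw [counitP_counitSection]
      exact towerIncP_kerProj T 0 q x)
    (fun i q x => by
      change ((freeMod ((tower P T (i + 1)).obj (C.pt P)) P).obj P).X q at x
      change (((lindD T (i + 1)).app P).f q).hom (counitSection T (i + 2) q (kerProj T (i + 1) q x)) +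
        counitSection T (i + 1) q (kerProj T i q ((((lindD T i).app P).f q).hom x)) = x
      rw [lindD_eq, lindD_eq, counitP_counitSection, towerIncP_kerProj, kerProj_towerIncP,
        sub_add_cancel])
    (fun q q' x => d_counitSection T 0 q q' x)
    (fun q x => counitP_counitSection T 0 q x)

/-! ### Extension of homomorphisms out of the derived induction -/

variable {N : DGModule.{v, u₁, u, u} C} {n : ℤ}

/-- All generators of the free summands live at `P`. -/
theorem resHom_lind_injective {f g : homSubmodule (lind T) N n}
    (h : resHom.{v, u} (P := P) f = resHom g) : f = g := by
  refine (lindSeq T).totalHom_hom_ext fun i => ?_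
  refine free_hom_ext fun a b hab v => ?_
  refine (ap_homComp _ f _ P hab rfl (by omega) _).trans
    (Eq.trans ?_ (ap_homComp _ g _ P hab rfl (by omega) _).symm)
  exact congrArg (fun F => ap F (C.pt P) (show a + -(i : ℤ) + n = b by omega) (ap
    ((lindSeq T).incH i) P rfl (ftmul (add_zero a) v (C.id P)))) h

/-- Each free summand lets the values of `g` on its generators at `P` be extended over all of `C`;
linearity of `g` over the endomorphisms of `P` shows that the extension restricts to `g`. -/
theorem resHom_lind_surjective (g : homSubmodule (res.{v, u} P (lind T)) (res P N) n) :
    ∃ f : homSubmodule (lind T) N n, resHom f = g := by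
  let g' {p q : ℤ} (h : p + n = q) : ((lindSeq T).total.obj P).X p →ₗ[k] (N.obj P).X q :=
    ap g (C.pt P) h
  have hg' {q p i q' j : ℤ} (h : q + p = i) (h₁ : q + n = q') (h₂ : i + n = j) (h₃ : q' + p = j)
      (m : ((lindSeq T).total.obj P).X q) (x : (C.Hom P P).X p) :
      g' h₂ ((lindSeq T).total.act h m x) = N.act h₃ (g' h₁ m) x :=
    ap_act g (X := C.pt P) (Y := C.pt P) h h₁ h₂ h₃ m x
  let F (i : ℕ) : homSubmodule ((lindSeq T).F i) N (n - i) :=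
    freeExtend fun a b hab => ((g' (show a - i + n = b by omega)).comp
      (Resolving.tinc i (by omega))).comp ((ftmul (add_zero a)).flip (C.id P))
  refine ⟨Resolving.totalHom F, hom_ext fun X p q h x => ?_⟩
  change ((lindSeq T).total.obj P).X p at x
  change ap (Resolving.totalHom F) P h x = g' h x
  induction x using Resolving.tinc_induction with
  | hinc i r hr x =>
    rw [Resolving.ap_totalHom]
    change ((freeMod ((tower P T i).obj (C.pt P)) P).obj P).X r at x
    induction x using free_induction with
    | htmul a b hab v f =>
      refine (ap_freeExtend _ _ hab rfl v f).trans ?_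
      refine (hg' (show a - i + b = p by omega) (by omega) h (by omega) _ f).symm.trans ?_
      congr 1
      rw [Resolving.act_tinc _ i _ hab]
      congr 1
      exact (ftmul_eq_act hab v f).symm
    | hadd z z' hz hz' =>
      refine (map_add (ap (F i) P _) z z').trans ?_
      refine (congrArg₂ (· + ·) hz hz').trans ?_
      rw [← map_add]
      exact congrArg (g' h) ((Resolving.tinc (S := lindSeq T) (X := P) (n := p) i hr).map_add z z').symm
  | hadd z z' hz hz' => rw [map_add, map_add, hz, hz']

/-- A morphism from the restriction of the derived induction extends. -/
theorem exists_resMor_eq (g : Morphism (res.{v, u} P (lind T)) (res P N)) :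
    ∃ f : Morphism (lind T) N, resMor f = g := by
  obtain ⟨f, hf⟩ := resHom_lind_surjective T g.toHom
  refine ⟨Morphism.ofClosed f (resHom_lind_injective T ?_), Morphism.toHom_injective ?_⟩
  · rw [← hd_resHom, hf, hd_toHom, map_zero]
  · rw [toHom_resMor, Morphism.toHom_ofClosed, hf]

end Tower

end DGModule

namespace DGModule

open CochainComplex

/-! ### Homotopic morphisms -/

section Homotopic

variable {C : DGCat.{v, u₁, u₂} k} {M N P : DGModule.{v, u₁, u₂, w} C}

/-- Two morphisms of dg modules are homotopic if their difference is a boundary. -/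
def Morphism.Homotopic (f g : Morphism M N) : Prop :=
  ∃ e : homSubmodule M N (-1), hd M N (-1) 0 e = f.toHom - g.toHom

namespace Morphism.Homotopic

theorem symm {f g : Morphism M N} (h : f.Homotopic g) : g.Homotopic f := by
  obtain ⟨e, he⟩ := h
  exact ⟨-e, by rw [map_neg, he, neg_sub]⟩

theorem trans {f g h : Morphism M N} (h₁ : f.Homotopic g) (h₂ : g.Homotopic h) :
    f.Homotopic h := by
  obtain ⟨e, he⟩ := h₁
  obtain ⟨e', he'⟩ := h₂
  exact ⟨e + e', by rw [map_add, he, he', sub_add_sub_cancel]⟩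

theorem comp_right {f g : Morphism M N} (h : f.Homotopic g) (a : Morphism N P) :
    (f.comp a).Homotopic (g.comp a) := by
  obtain ⟨e, he⟩ := h
  refine ⟨homComp (zero_add (-1)) a.toHom e, ?_⟩
  rw [hd_comp_of_closed_left _ (zero_add 1) (neg_add_cancel 1) (neg_add_cancel 1) _ (hd_toHom a), he,
    Morphism.toHom_comp, Morphism.toHom_comp, map_sub]
  simp

theorem comp_left (a : Morphism P M) {f g : Morphism M N} (h : f.Homotopic g) :
    (a.comp f).Homotopic (a.comp g) := by
  obtain ⟨e, he⟩ := h
  refine ⟨homComp (add_zero (-1)) e a.toHom, ?_⟩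
  rw [hd_comp_of_closed_right _ (neg_add_cancel 1) (zero_add 1) (neg_add_cancel 1) _ _ (hd_toHom a),
    he, Morphism.toHom_comp, Morphism.toHom_comp, homComp_sub_left]

theorem quasiIso {f g : Morphism M N} (h : f.Homotopic g) {X : C.Obj} (hg : QuasiIso (g.app X)) :
    QuasiIso (f.app X) := by
  obtain ⟨e, he⟩ := h
  exact quasiIso_of_homotopy f g e he X hg

end Morphism.Homotopic

/-- Two-out-of-three at a single object, as the zero-homotopy case of `quasiIso_of_lift`. -/
theorem Morphism.quasiIso_of_comp {f : Morphism M N} {g : Morphism N P} {X : C.Obj}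
    (hg : QuasiIso (g.app X)) (h : QuasiIso ((f.comp g).app X)) : QuasiIso (f.app X) :=
  quasiIso_of_lift X hg h (g := f) (e := 0) (by rw [map_zero, sub_self])

theorem Morphism.comp_assoc {Q : DGModule.{v, u₁, u₂, w} C} (f : Morphism M N) (g : Morphism N P)
    (h : Morphism P Q) : (f.comp g).comp h = f.comp (g.comp h) := rfl

theorem IsHProjective.exists_homotopic (hP : P.IsHProjective) (s : Morphism M N)
    (hs : s.IsQuasiIso) (f : Morphism P N) : ∃ g : Morphism P M, (g.comp s).Homotopic f := by
  obtain ⟨g, e, he⟩ := hP.exists_lift_morphism s hs f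
  exact ⟨g, Morphism.Homotopic.symm ⟨e, he⟩⟩

/-- The shift of a morphism. -/
def Morphism.shift (f : Morphism M N) (a : ℤ) : Morphism (M.shift a) (N.shift a) where
  app X := (CochainComplex.shiftFunctor (ModuleCat k) a).map (f.app X)
  app_act {X Y q p n} h m x :=
    f.app_act (show q + a + p = n + a by omega) (m : (M.obj Y).X (q + a)) x

theorem Morphism.IsQuasiIso.shift {f : Morphism M N} (hf : f.IsQuasiIso) (a : ℤ) :
    (f.shift a).IsQuasiIso := fun X =>
  (CochainComplex.quasiIso_shift_iff (f.app X) a).2 (hf X)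

end Homotopic

/-! ### Resolutions over dg algebras -/

/-- With a single object, restriction to it loses nothing, so derived induction is already a
resolution functor. -/
theorem exists_quasiIso_isHProjective (A : DGCat.{v, u₁, u} k) [Unique A.Obj]
    (T : DGModule.{v, u₁, u, u} A) :
    ∃ (L : DGModule.{v, u₁, u, u} A) (f : Morphism L T), L.IsHProjective ∧ f.IsQuasiIso := by
  obtain ⟨f, hf⟩ := exists_resMor_eq (res.{v, u} (default : A.Obj) T) (lindAug _)
  refine ⟨_, f, isHProjective_lind _, fun X => ?_⟩
  obtain rfl := Subsingleton.elim default X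
  have : QuasiIso ((resMor.{v, u} (P := default) f).app (A.pt default)) := by
    rw [hf]
    exact isQuasiIso_lindAug _ _
  exact this

/-! ### Modules over opposite categories of modules -/

section Push

variable {A : DGCat.{v, u₁, u₂} k} {ι : Type u₃} {φ : ι → DGModule.{v, u₁, u₂, w} A}
  (N : DGModule.{v, u₃, max u₁ w, u₄} (opFull A φ)) {i j l : ι}

/-- The action of a homomorphism `φ i → φ j` on a module over `opFull A φ`. -/
def push {n p q : ℤ} (h : p + n = q) :
    homSubmodule (φ i) (φ j) n →ₗ[k] (N.obj i).X p →ₗ[k] (N.obj j).X q :=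
  (N.act (X := j) (Y := i) h).flip

theorem push_homId {p : ℤ} (m : (N.obj i).X p) :
    N.push (add_zero p) (homId (φ i)) m = m :=
  N.act_id m

theorem push_push {a b c p q r : ℤ} (hc : b + a = c) (h₁ : p + a = q) (h₂ : q + b = r)
    (h₃ : p + c = r) (f : homSubmodule (φ i) (φ j) a) (g : homSubmodule (φ j) (φ l) b)
    (m : (N.obj i).X p) :
    N.push h₂ g (N.push h₁ f m) = (a * b).negOnePow • N.push h₃ (homComp hc g f) m := by
  refine (N.act_act (X := l) (Y := j) (Z := i) h₁ h₂ (show a + b = c by omega) h₃ m f g).trans ?_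
  exact lin_units_smul (N.act (X := l) (Y := i) h₃ m) _ _

theorem d_push {a a' p q p' q' : ℤ} (h : p + a = q) (ha : a + 1 = a') (hp : p + 1 = p')
    (hq : q + 1 = q') (f : homSubmodule (φ i) (φ j) a) (m : (N.obj i).X p) :
    ((N.obj j).d q q').hom (N.push h f m) =
      N.push (show p' + a = q' by omega) f (((N.obj i).d p p').hom m) +
        p.negOnePow • N.push (show p + a' = q' by omega) (hd _ _ a a' f) m :=
  N.d_act' (X := j) (Y := i) h hp ha hq m f

theorem isChainMapUpToSign_push {a b : ℤ} (hb : a + 1 = b) (f : homSubmodule (φ i) (φ j) a)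
    (hf : hd _ _ a b f = 0) :
    IsChainMapUpToSign (fun p q (h : p + a = q) => N.push h f) := by
  refine ⟨1, fun p p' q q' h h' m => ?_⟩
  by_cases hp : p + 1 = p'
  · rw [N.d_push h hb hp (by omega), hf, map_zero, LinearMap.zero_apply, smul_zero, add_zero,
      one_smul]
  · rw [HomologicalComplex.shape _ p p' hp, HomologicalComplex.shape _ q q' (by
      change ¬ q + 1 = q'
      omega), one_smul]
    exact (map_zero (N.push h' f)).symm

variable {N} {Q : CochainComplex (ModuleCat.{u₄} k) ℤ → Prop}

/-- Dg functors preserve homotopy retracts. Opposite degrees are allowed so that the lemma also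
covers shifts. -/
theorem push_of_retract (hQ : IsThickClass Q) {n n' : ℤ} (hn : n + n' = 0)
    (a : homSubmodule (φ j) (φ i) n) (b : homSubmodule (φ i) (φ j) n')
    (ha : hd _ _ n (n + 1) a = 0) (hb : hd _ _ n' (n' + 1) b = 0) (e : homSubmodule (φ i) (φ i) (-1))
    (he : hd _ _ (-1) 0 e = homComp hn a b - homId (φ i)) (h : Q (N.obj j)) : Q (N.obj i) := by
  refine hQ.of_retract _ (N.isChainMapUpToSign_push rfl a ha) (fun p x hx => ?_) h
  -- The factor `(-1)^{n'n}` cancels the sign of composition in the opposite category.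
  refine ⟨p - n, by omega, (n' * n).negOnePow • N.push (by omega) b x, ?_,
    -(p.negOnePow • N.push (by omega) e x), ?_⟩
  · rw [lin_units_smul, N.d_push _ rfl rfl (by omega), hx, hb, map_zero, map_zero,
      LinearMap.zero_apply, smul_zero, add_zero, smul_zero]
  · rw [lin_units_smul, N.push_push hn _ _ (add_zero p), smul_smul,
      Int.units_mul_self, one_smul, map_neg, lin_units_smul,
      N.d_push _ (neg_add_cancel 1) rfl (show p - 1 + 1 = p by omega), hx, map_zero, zero_add,
      smul_smul, Int.units_mul_self, one_smul, he, map_sub, LinearMap.sub_apply, push_homId]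
    abel

/-- A cone is characterised by its injections and projections and equations among them, which every
dg functor preserves. So `N` takes it to an extension of complexes that splits as graded spaces. -/
theorem push_of_cone (hQ : IsThickClass Q) (f : Morphism (φ i) (φ j)) (hl : φ l = cone f)
    (hi : Q (N.obj i)) (hj : Q (N.obj j)) : Q (N.obj l) := by
  -- The structure maps are moved along `hl` all at once, since `N` is evaluated at the index `l`
  -- and not at the module `cone f`.
  obtain ⟨inl, inr, fst, snd, h₁, h₂, h₃, h₄, h₅, h₆⟩ : ∃ (inl : homSubmodule (φ i) (φ l) (-1))
      (inr : homSubmodule (φ j) (φ l) 0) (fst : homSubmodule (φ l) (φ i) 1)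
      (snd : homSubmodule (φ l) (φ j) 0),
      homComp (neg_add_cancel 1) inl fst + homComp (add_zero 0) inr snd = homId (φ l) ∧
      homComp (add_zero 0) snd inr = homId (φ j) ∧ hd _ _ 0 1 inr = 0 ∧ hd _ _ 1 2 fst = 0 ∧
      hd _ _ (-1) 0 inl = homComp (add_zero 0) inr f.toHom ∧ hd _ _ 0 1 f.toHom = 0 := by
    rw [hl]
    exact ⟨coneInl f, coneInr f, coneFst f, coneSnd f, cone_decomposition f,
      coneSnd_comp_coneInr f, hd_coneInr f, hd_coneFst f, hd_coneInl f, hd_toHom f⟩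
  refine hQ.of_split (fun p q h => N.push h inr) (fun p => N.push (add_zero p) snd)
    (fun p q h => N.push h fst) (fun p q h => N.push h inl)
    (N.isChainMapUpToSign_push (zero_add 1) inr h₃)
    (N.isChainMapUpToSign_push one_add_one_eq_two fst h₄) (-1) 1 (fun p q h x => ?_) (fun p z => ?_)
    ?_ hj hi
  · rw [N.push_push (neg_add_cancel 1) _ _ (add_zero p),
      N.push_push (add_zero 0) _ _ (add_zero p)]
    conv_lhs => rw [← N.push_homId x, ← h₁, map_add, LinearMap.add_apply]
    simp
  · rw [N.push_push (add_zero 0) _ _ (add_zero p), h₂, push_homId]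
    simp
  · rintro p q r s h h' rfl y
    -- The injection `inl` is not closed: its differential `inr ∘ f` is the defect.
    refine ⟨-(s.negOnePow • N.push (add_zero s) f.toHom y), ?_⟩
    rw [N.d_push h (neg_add_cancel 1) (show s + 1 = r by omega) (by omega), h₅, map_neg,
      lin_units_smul, N.push_push (add_zero 0) _ _ (add_zero s)]
    simp

end Push

end DGModule

namespace DGModule

open CochainComplex

/-! ### Modules over `D_fd(A)ᵒᵖ` are determined by their value at a generator -/

section Generator

variable {A : DGCat.{v, u, u} k} {M : DGModule.{v, u, u, u} A}

/-- The dg category `D_fd(A)ᵒᵖ`. -/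
abbrev dfdOp (A : DGCat.{v, u, u} k) : DGCat.{v, max v (u + 1), u} k :=
  opFull A (fun L : DfdObj.{v, u, u, u} A => L.1)

variable {N : DGModule.{v, max v (u + 1), u, u₄} (dfdOp A)}
  {Q : CochainComplex (ModuleCat.{u₄} k) ℤ → Prop}

/-- If `T` is a retract up to quasi-isomorphism of `T'` then a resolution of `T` inherits any thick
property from a resolution of `T'`. -/
theorem dfd_retract (hQ : IsThickClass Q) {T T' : DGModule.{v, u, u, u} A} {L L' : DfdObj A}
    (π : Morphism L.1 T) (hπ : π.IsQuasiIso) (π' : Morphism L'.1 T') (hπ' : π'.IsQuasiIso)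
    (i : Morphism T T') (r : Morphism T' T) (hr : (i.comp r).IsQuasiIso) (h : Q (N.obj L')) :
    Q (N.obj L) := by
  obtain ⟨a, ha⟩ := L.2.1.exists_homotopic π' hπ' (π.comp i)
  obtain ⟨b, hb⟩ := L'.2.1.exists_homotopic π hπ (π'.comp r)
  have hab : (a.comp b).IsQuasiIso := fun X => Morphism.quasiIso_of_comp (hπ X) <|
    Morphism.Homotopic.quasiIso ((hb.comp_left a).trans (ha.comp_right r)) (hπ.comp hr X)
  obtain ⟨c, e, he⟩ := L.2.1.exists_homotopic (a.comp b) hab (Morphism.id L.1)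
  refine push_of_retract hQ (add_zero 0) b.toHom (c.comp a).toHom (hd_toHom _)
    (hd_toHom _) e ?_ h
  rw [he, ← Morphism.toHom_id, ← Morphism.comp_assoc, Morphism.toHom_comp _ b]

/-- Since `N` is defined only on h-projective modules, the induction over the thick subcategory
asserts that each of its members has some resolution at which `Q` holds. An arbitrary object is
finally compared with the resolution found for it, as a retract through identities. -/
theorem dfd_generator (hM : M.IsDfdGenerator) (hQ : IsThickClass Q) [Unique A.Obj]
    {P : DfdObj A} (π : Morphism P.1 M) (hπ : π.IsQuasiIso) (h : Q (N.obj P)) (L : DfdObj A) :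
    Q (N.obj L) := by
  have key (T : DGModule.{v, u, u, u} A) (hT : Thick (fun L => L = M) T) :
      ∃ (L : DfdObj A) (f : Morphism L.1 T), f.IsQuasiIso ∧ Q (N.obj L) := by
    induction hT with
    | of T hT =>
      subst hT
      exact ⟨P, π, hπ, h⟩
    | of_quasiIso g hg _ ih =>
      obtain ⟨L, f, hf, hL⟩ := ih
      exact ⟨L, f.comp g, hf.comp hg, hL⟩
    | of_quasiIso' g hg _ ih =>
      obtain ⟨L, f, hf, hL⟩ := ih
      obtain ⟨f', hf'⟩ := L.2.1.exists_homotopic g hg f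
      exact ⟨L, f', fun X => Morphism.quasiIso_of_comp (hg X) (hf'.quasiIso (hf X)), hL⟩
    | shift T a _ ih =>
      obtain ⟨L, f, hf, hL⟩ := ih
      -- Perfect values of the shift are read off from `hM`, which identifies them with membership
      -- in a thick subcategory.
      let L' : DfdObj A := ⟨L.1.shift a, L.2.1.shift a, (hM _).1 (.shift _ _ ((hM _).2 L.2.2))⟩
      refine ⟨L', f.shift a, hf.shift a, ?_⟩
      exact push_of_retract (i := L') (j := L) hQ (neg_add_cancel a) (L.1.toShift a) (L.1.ofShift a)
        (hd_toShift _ _ _) (hd_ofShift _ _ _) 0 (by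
          rw [map_zero]
          exact (sub_eq_zero.2 (toShift_comp_ofShift L.1 a)).symm) hL
    | cone g _ _ ih₁ ih₂ =>
      obtain ⟨L₁, f₁, hf₁, hL₁⟩ := ih₁
      obtain ⟨L₂, f₂, hf₂, hL₂⟩ := ih₂
      obtain ⟨g', hg'⟩ := L₁.2.1.exists_homotopic f₂ hf₂ (f₁.comp g)
      obtain ⟨e, he⟩ := hg'
      obtain ⟨c, hc⟩ := exists_cone_quasiIso g g' f₁ f₂ hf₁ hf₂ e he
      let L : DfdObj A := ⟨cone g', L₁.2.1.cone L₂.2.1 g',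
        (hM _).1 (.cone _ ((hM _).2 L₁.2.2) ((hM _).2 L₂.2.2))⟩
      exact ⟨L, c, hc, push_of_cone (i := L₁) (j := L₂) (l := L) hQ g' rfl hL₁ hL₂⟩
    | @retract T T' i r hir hT' ih =>
      obtain ⟨L', f', hf', hL'⟩ := ih
      -- Unlike a shift or a cone, a retract receives no resolution from the induction, so a new one
      -- is taken.
      obtain ⟨L, f, hL, hf⟩ := exists_quasiIso_isHProjective A T
      let L₀ : DfdObj A := ⟨L, hL, (hM _).1 (.of_quasiIso' f hf (.retract i r hir hT'))⟩
      exact ⟨L₀, f, hf, dfd_retract (L := L₀) hQ f hf f' hf' i r hir hL'⟩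
  obtain ⟨L', f, hf, hL'⟩ := key L.1 ((hM _).2 L.2.2)
  exact dfd_retract (T := L.1) hQ (Morphism.id _) (fun X => inferInstanceAs (QuasiIso (𝟙 _))) f hf
    (Morphism.id _) (Morphism.id _)
    (fun X => inferInstanceAs (QuasiIso (𝟙 _ ≫ 𝟙 _))) hL'

/-- A morphism of modules over `D_fd(A)ᵒᵖ` is a quasi-isomorphism if it is so at a resolution of the
generator. -/
theorem dfd_isQuasiIso (hM : M.IsDfdGenerator) [Unique A.Obj]
    {P : DfdObj A} (π : Morphism P.1 M) (hπ : π.IsQuasiIso)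
    {N' : DGModule.{v, max v (u + 1), u, u₄} (dfdOp A)} (f : Morphism N N')
    (hf : QuasiIso (f.app P)) : f.IsQuasiIso := fun L =>
  (acyclic_cone_iff f L).1
    (dfd_generator hM isThickClass_acyclic π hπ ((acyclic_cone_iff f P).2 hf) L)

theorem dfd_isPerfectlyValued (hM : M.IsDfdGenerator) [Unique A.Obj]
    {P : DfdObj A} (π : Morphism P.1 M) (hπ : π.IsQuasiIso) (h : IsPerfect (N.obj P)) :
    N.IsPerfectlyValued := fun L =>
  dfd_generator hM isThickClass_isPerfect π hπ h L

end Generator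

end DGModule

/-- Being a quasi-isomorphism is invariant under isomorphisms of the target. -/
theorem isQuasiIsoMap_comp_iff {K : CochainComplex (ModuleCat.{u₁} k) ℤ}
    {L : CochainComplex (ModuleCat.{u₂} k) ℤ} {L' : CochainComplex (ModuleCat.{u₃} k) ℤ}
    (f : ∀ n : ℤ, K.X n →ₗ[k] L.X n) (g : ∀ n : ℤ, L.X n →ₗ[k] L'.X n)
    (hg : ∀ n, Function.Bijective (g n))
    (hd : ∀ i j x, (L'.d i j).hom (g i x) = g j ((L.d i j).hom x)) :
    IsQuasiIsoMap (fun n => (g n).comp (f n)) ↔ IsQuasiIsoMap f := by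
  refine and_congr (forall₃_congr fun i j x => ?_)
    (and_congr (forall₃_congr fun n x hx => ?_) (forall_congr' fun n => ?_))
  · change (L'.d i j).hom (g i (f i x)) = g j (f j _) ↔ _
    rw [hd, (hg j).1.eq_iff]
  · refine imp_congr_left ⟨?_, ?_⟩
    · rintro ⟨y, hy⟩
      obtain ⟨y, rfl⟩ := (hg _).2 y
      rw [hd] at hy
      exact ⟨y, (hg n).1 hy⟩
    · rintro ⟨y, hy⟩
      exact ⟨g _ y, by rw [hd, hy]; rfl⟩
  · rw [(hg n).2.forall]
    refine forall_congr' fun y => imp_congr ?_ (exists_congr fun x => and_congr_right fun _ => ?_)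
    · rw [hd, ← map_zero (g (n + 1)), (hg _).1.eq_iff]
    · rw [(hg _).2.exists]
      refine exists_congr fun z => ?_
      change (L'.d (n - 1) n).hom (g (n - 1) z) = g n y - g n (f n x) ↔ _
      rw [hd, ← map_sub, (hg n).1.eq_iff]

namespace DGModule

open CochainComplex

/-! ### Thick subcategories and thick properties of complexes -/

/-- Evaluation at `X` is itself a module over the opposite of the category of all dg modules, so the
shift and cone cases are instances of the `push` lemmas. -/
theorem Thick.of_isThickClass {C : DGCat.{v, u₁, u₂} k}
    {Q : CochainComplex (ModuleCat.{w} k) ℤ → Prop} (hQ : IsThickClass Q)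
    {S : DGModule.{v, u₁, u₂, w} C → Prop} {X : C.Obj} (hS : ∀ L, S L → Q (L.obj X))
    {T : DGModule.{v, u₁, u₂, w} C} (hT : Thick S T) : Q (T.obj X) := by
  induction hT with
  | of T hT => exact hS T hT
  | of_quasiIso f hf _ ih => exact hQ.of_quasiIso _ (hf X) ih
  | of_quasiIso' f hf _ ih => exact hQ.of_quasiIso' _ (hf X) ih
  | shift T a _ ih =>
    exact push_of_retract (N := evalModule C (fun T => T) X) (i := T.shift a) (j := T) hQ
      (neg_add_cancel a) (T.toShift a) (T.ofShift a) (hd_toShift _ _ _) (hd_ofShift _ _ _) 0 (by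
        rw [map_zero]
        exact (sub_eq_zero.2 (toShift_comp_ofShift T a)).symm) ih
  | @cone T T' f _ _ ih₁ ih₂ =>
    exact push_of_cone (N := evalModule C (fun T => T) X) (i := T) (j := T') (l := DGModule.cone f) hQ f rfl
      ih₁ ih₂
  | retract i r hir _ ih =>
    refine hQ.of_retract _ (IsThickClass.isChainMapUpToSign_ofHom (r.app X)) (fun n x hx => ?_) ih
    obtain ⟨z, hz, y, hy⟩ := ((quasiIso_iff_isQuasiIsoMap _).1 (hir X)).2.2 n x hx
    refine ⟨n, add_zero n, ((i.app X).f n).hom z, ?_, y, ?_⟩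
    · rw [hom_comm_apply, hz, map_zero]
    · rw [hy, Cochain.ofHom_v]
      exact (add_sub_cancel _ _).symm

theorem Thick.res {C : DGCat.{v, u₁, u₂} k} (P : C.Obj)
    {S : DGModule.{v, u₁, u₂, w} C → Prop} {S' : DGModule.{v, u, u₂, w} (C.corner P) → Prop}
    (hS : ∀ L, S L → S' (res P L)) {T : DGModule.{v, u₁, u₂, w} C} (hT : Thick S T) :
    Thick S' (DGModule.res P T) := by
  induction hT with
  | of T hT => exact .of _ (hS T hT)
  | of_quasiIso f hf _ ih => exact .of_quasiIso (resMor f) (fun _ => hf P) ih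
  | of_quasiIso' f hf _ ih => exact .of_quasiIso' (resMor f) (fun _ => hf P) ih
  | shift T a _ ih => exact .shift _ a ih
  | cone f _ _ ih₁ ih₂ => exact .cone (resMor f) ih₁ ih₂
  | retract i r hir _ ih => exact .retract (resMor i) (resMor r) (fun _ => hir P) ih

/-! ### Independence of the choice of a resolution -/

section Independence

variable {C : DGCat.{v, u₁, u₂} k} {M N P : DGModule.{v, u₁, u₂, w} C} {n : ℤ}

theorem hd_shape {i j : ℤ} (hij : ¬ i + 1 = j) (f : homSubmodule M N i) : hd M N i j f = 0 :=
  Subtype.ext (funext fun X => δ_shape i j hij (f.1 X))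

/-- Two homomorphisms of graded modules are cohomologous if their difference is a boundary. -/
def Cohomologous (f g : homSubmodule M N n) : Prop :=
  ∃ e : homSubmodule M N (n - 1), hd M N (n - 1) n e = f - g

namespace Cohomologous

theorem trans {f g h : homSubmodule M N n} (h₁ : Cohomologous f g) (h₂ : Cohomologous g h) :
    Cohomologous f h := by
  obtain ⟨e, he⟩ := h₁
  obtain ⟨e', he'⟩ := h₂
  exact ⟨e + e', by rw [map_add, he, he', sub_add_sub_cancel]⟩

theorem comp {f g : homSubmodule M N n} (h : Cohomologous f g) (a : Morphism P M) :
    Cohomologous (homComp (add_zero n) f a.toHom) (homComp (add_zero n) g a.toHom) := by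
  obtain ⟨e, he⟩ := h
  exact ⟨homComp (add_zero (n - 1)) e a.toHom, by
    rw [hd_comp_of_closed_right _ (show n - 1 + 1 = n by omega) (zero_add 1) (by omega) _ _
      (hd_toHom a), he, homComp_sub_left]⟩

theorem of_homotopic {f : homSubmodule M N n} (hf : hd M N n (n + 1) f = 0) {a b : Morphism P M}
    (h : a.Homotopic b) :
    Cohomologous (homComp (add_zero n) f a.toHom) (homComp (add_zero n) f b.toHom) := by
  obtain ⟨e, he⟩ := h
  refine ⟨n.negOnePow • homComp (show n + -1 = n - 1 by omega) f e, ?_⟩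
  rw [hd_units_smul, hd_comp_of_closed_left _ rfl (neg_add_cancel 1) (by omega) f hf, he, smul_smul,
    Int.units_mul_self, one_smul, map_sub]

end Cohomologous

/-- The map `x ↦ α(x) ∘ π` to `RHom(M, N)`, computed by a resolution `π` of `M`. -/
def resolutionMap {K : CochainComplex (ModuleCat.{u₃} k) ℤ}
    (α : ∀ n : ℤ, K.X n →ₗ[k] homSubmodule M N n) (R : HProjResolution M) (n : ℤ) :
    K.X n →ₗ[k] (homComplex R.P N).X n :=
  ((homComp (add_zero n)).flip R.π.toHom).comp (α n)

/-- Two resolutions of `M` are homotopy equivalent over `M`. This matters because quasi-full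
faithfulness and derived completeness are stated with some resolution, and results for different
ones must be compared. -/
theorem isQuasiIsoMap_of_resolution {K : CochainComplex (ModuleCat.{u₃} k) ℤ}
    (α : ∀ n : ℤ, K.X n →ₗ[k] homSubmodule M N n)
    (hα : ∀ (i j : ℤ) (x : K.X i), hd M N i j (α i x) = α j ((K.d i j).hom x))
    (R R' : HProjResolution M) (h : IsQuasiIsoMap (resolutionMap α R)) :
    IsQuasiIsoMap (resolutionMap α R') := by
  obtain ⟨c, hc⟩ := R'.isHProjective.exists_homotopic R.π R.isQuasiIso R'.π
  obtain ⟨c', hc'⟩ := R.isHProjective.exists_homotopic R'.π R'.isQuasiIso R.π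
  refine ⟨fun i j x => ?_, fun n x hx hy => ?_, fun n y hy => ?_⟩
  · change hd R'.P N i j (homComp (add_zero i) (α i x) R'.π.toHom) = homComp (add_zero j) (α j _) R'.π.toHom
    by_cases hij : i + 1 = j
    · rw [hd_comp_of_closed_right _ hij (zero_add 1) hij _ _ (hd_toHom _), hα]
    · rw [K.shape i j hij]
      change _ = homComp (add_zero j) (α j 0) _
      rw [map_zero, map_zero, LinearMap.zero_apply]
      exact hd_shape hij _
  · have hαx : hd M N n (n + 1) (α n x) = 0 := by rw [hα, hx, map_zero]
    obtain ⟨y, hy⟩ := hy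
    change homSubmodule R'.P N (n - 1) at y
    change hd R'.P N (n - 1) n y = homComp (add_zero n) (α n x) R'.π.toHom at hy
    refine h.2.1 n x hx ?_
    change ∃ y : homSubmodule R.P N (n - 1), hd R.P N (n - 1) n y =
      homComp (add_zero n) (α n x) R.π.toHom
    obtain ⟨e, he⟩ := Cohomologous.of_homotopic hαx hc'.symm
    refine ⟨e + homComp (add_zero (n - 1)) y c'.toHom, ?_⟩
    rw [map_add, he, hd_comp_of_closed_right _ (show n - 1 + 1 = n by omega) (zero_add 1) (by omega)
      _ _ (hd_toHom c'), hy, homComp_assoc _ _ (add_zero 0) (add_zero n), Morphism.toHom_comp]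
    exact sub_add_cancel _ _
  · change homSubmodule R'.P N n at y
    change hd R'.P N n (n + 1) y = 0 at hy
    change ∃ x : K.X n, (K.d n (n + 1)).hom x = 0 ∧
      Cohomologous y (homComp (add_zero n) (α n x) R'.π.toHom)
    obtain ⟨x, hx, hxy⟩ := h.2.2 n (homComp (add_zero n) y c'.toHom)
      (hd_comp_closed _ rfl (zero_add 1) rfl _ hy _ (hd_toHom c'))
    change Cohomologous (homComp (add_zero n) y c'.toHom) (homComp (add_zero n) (α n x) R.π.toHom)
      at hxy
    have hαx : hd M N n (n + 1) (α n x) = 0 := by rw [hα, hx, map_zero]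
    refine ⟨x, hx, ?_⟩
    -- Both morphisms lift `R'.π` through the quasi-isomorphism `R'.π` up to homotopy, and such
    -- lifts are unique up to homotopy.
    have h₁ : (Morphism.id R'.P).Homotopic (c.comp c') := by
      obtain ⟨e, he⟩ : ((c.comp c').comp R'.π).Homotopic R'.π := (hc'.comp_left c).trans hc
      obtain ⟨e', he'⟩ := R'.isHProjective.exists_hd_eq_of_comp R'.π R'.isQuasiIso
        (show (-1 : ℤ) + 1 = 0 by omega) (zero_add 1) ((c.comp c').toHom - homId _)
        (by rw [map_sub, hd_toHom, hd_homId, sub_self]) e (by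
          rw [he, map_sub, homComp_id, Morphism.toHom_comp])
      exact Morphism.Homotopic.symm ⟨e', by rw [he', Morphism.toHom_id]⟩
    have h₂ := Cohomologous.of_homotopic hy h₁
    rw [Morphism.toHom_id, homComp_id, Morphism.toHom_comp,
      ← homComp_assoc (add_zero n) (add_zero n)] at h₂
    refine (h₂.trans (hxy.comp c)).trans ?_
    rw [homComp_assoc _ _ (add_zero 0) (add_zero n), ← Morphism.toHom_comp]
    exact Cohomologous.of_homotopic hαx hc

end Independence

end DGModule

namespace DGModule

open CochainComplex

/-! ### Modules with quasi-isomorphic restrictions -/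

section ResQuasiIso

variable {C : DGCat.{v, u₁, u₂} k} {P : C.Obj} {N N' : DGModule.{v, u₁, u₂, w} C}
  {T T' : DGModule.{v, u, u₂, w} (C.corner P)}
  {s : Morphism (res P N) T} {t : Morphism (res P N') T'}

theorem exists_res_shift_quasiIso (hs : s.IsQuasiIso) (a : ℤ) :
    ∃ c : Morphism (res P (N.shift a)) (T.shift a), c.IsQuasiIso :=
  ⟨s.shift a, hs.shift a⟩

theorem exists_res_cone_quasiIso (hs : s.IsQuasiIso) (ht : t.IsQuasiIso) (f : Morphism T T')
    (g : Morphism N N') (h : ((resMor g).comp t).Homotopic (s.comp f)) :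
    ∃ c : Morphism (res P (cone g)) (cone f), c.IsQuasiIso := by
  obtain ⟨e, he⟩ := h
  exact exists_cone_quasiIso f (resMor g) s t hs ht e he

theorem quasiIso_app_of_res (hs : s.IsQuasiIso) (ht : t.IsQuasiIso) {f : Morphism T T'}
    (hf : f.IsQuasiIso) {g : Morphism N N'} (h : ((resMor g).comp t).Homotopic (s.comp f)) :
    QuasiIso (g.app P) :=
  Morphism.quasiIso_of_comp (f := resMor g) (ht (C.pt P)) (h.quasiIso (hs.comp hf (C.pt P)))

theorem quasiIso_app_comp_of_res (hs : s.IsQuasiIso) {i : Morphism T T'} {r : Morphism T' T}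
    (hir : (i.comp r).IsQuasiIso) {i' : Morphism N N'} {r' : Morphism N' N}
    (hi : ((resMor i').comp t).Homotopic (s.comp i))
    (hr : ((resMor r').comp s).Homotopic (t.comp r)) : QuasiIso ((i'.comp r').app P) :=
  quasiIso_app_of_res hs hs hir (g := i'.comp r')
    ((hr.comp_left (resMor i')).trans (hi.comp_right r))

end ResQuasiIso

/-! ### Functoriality of the derived induction -/

section Lind

variable {C : DGCat.{v, u₁, u} k} {P : C.Obj} {T T' : DGModule.{v, u, u, u} (C.corner P)}

/-- The lift exists over the endomorphisms of `P` because the restricted induction is h-projective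
there; it then extends over `C`. -/
theorem exists_lind_map (f : Morphism T T') :
    ∃ g : Morphism (lind T) (lind T'),
      ((resMor g).comp (lindAug T')).Homotopic ((lindAug T).comp f) := by
  obtain ⟨g, hg⟩ := (isHProjective_res_lind T).exists_homotopic (lindAug T')
    (isQuasiIso_lindAug T') ((lindAug T).comp f)
  obtain ⟨g', rfl⟩ := exists_resMor_eq T g
  exact ⟨g', hg⟩

theorem exists_lind_comparison {N : DGModule.{v, u₁, u, u} C} (s : Morphism (res P N) T)
    (hs : s.IsQuasiIso) : ∃ g : Morphism (lind T) N, QuasiIso (g.app P) := by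
  obtain ⟨g, hg⟩ := (isHProjective_res_lind T).exists_homotopic s hs (lindAug T)
  obtain ⟨g', rfl⟩ := exists_resMor_eq T g
  exact ⟨g', Morphism.quasiIso_of_comp (f := resMor g') (hs (C.pt P))
    (hg.quasiIso (isQuasiIso_lindAug T (C.pt P)))⟩

/-- If quasi-isomorphisms over `C` are detected at `P`, then the derived induction preserves thick
subcategories. -/
theorem thick_lind (hC : ∀ {N N' : DGModule.{v, u₁, u, u} C} (f : Morphism N N'),
      QuasiIso (f.app P) → f.IsQuasiIso) {S : DGModule.{v, u₁, u, u} C → Prop}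
    {S' : DGModule.{v, u, u, u} (C.corner P) → Prop} (hS : ∀ T, S' T → ∃ N, S N ∧ res P N = T)
    (hT : Thick S' T) : Thick S (lind T) := by
  -- It is enough to find some module in the thick subcategory whose restriction maps
  -- quasi-isomorphically to `T`: the comparison from `lind T` to it is a quasi-isomorphism by
  -- detection at `P`.
  have key {T : DGModule.{v, u, u, u} (C.corner P)} {N : DGModule.{v, u₁, u, u} C} (hN : Thick S N)
      (s : Morphism (res P N) T) (hs : s.IsQuasiIso) : Thick S (lind T) := by
    obtain ⟨g, hg⟩ := exists_lind_comparison s hs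
    exact .of_quasiIso' g (hC g hg) hN
  induction hT with
  | of T hT =>
    obtain ⟨N, hN, rfl⟩ := hS T hT
    exact key (.of N hN) (Morphism.id _) (fun X => inferInstanceAs (QuasiIso (𝟙 _)))
  | @of_quasiIso T T' f hf _ ih =>
    exact key ih ((lindAug T).comp f) ((isQuasiIso_lindAug T).comp hf)
  | @of_quasiIso' T T' f hf _ ih =>
    obtain ⟨g, hg⟩ := exists_lind_map f
    exact .of_quasiIso' g (hC g (quasiIso_app_of_res (isQuasiIso_lindAug T) (isQuasiIso_lindAug T')
      hf hg)) ih
  | shift T a _ ih =>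
    obtain ⟨c, hc⟩ := exists_res_shift_quasiIso (isQuasiIso_lindAug T) a
    exact key (.shift _ a ih) c hc
  | @cone T T' f _ _ ih₁ ih₂ =>
    obtain ⟨g, hg⟩ := exists_lind_map f
    obtain ⟨c, hc⟩ := exists_res_cone_quasiIso (isQuasiIso_lindAug T) (isQuasiIso_lindAug T') f g hg
    exact key (.cone g ih₁ ih₂) c hc
  | @retract T T' i r hir _ ih =>
    obtain ⟨i', hi⟩ := exists_lind_map i
    obtain ⟨r', hr⟩ := exists_lind_map r
    exact .retract i' r' (hC (i'.comp r')
      (quasiIso_app_comp_of_res (isQuasiIso_lindAug T) hir hi hr)) ih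

/-- The restriction of a family of homomorphisms. -/
def resFamily {K : CochainComplex (ModuleCat.{u₃} k) ℤ} {N N' : DGModule.{v, u₁, u, u} C}
    (α : ∀ n : ℤ, K.X n →ₗ[k] homSubmodule N N' n) (n : ℤ) :
    K.X n →ₗ[k] homSubmodule (res.{v, u} P N) (res P N') n :=
  resHom.comp (α n)

/-- If quasi-isomorphisms over `C` are detected at `P`, then every module over `C` has an h-projective
resolution by a derived induction. -/
theorem exists_lind_resolution (hC : ∀ {N N' : DGModule.{v, u₁, u, u} C} (f : Morphism N N'),
      QuasiIso (f.app P) → f.IsQuasiIso) (N : DGModule.{v, u₁, u, u} C) :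
    ∃ π : Morphism (lind (res.{v, u} P N)) N, resMor π = lindAug (res P N) ∧ π.IsQuasiIso := by
  obtain ⟨π, hπ⟩ := exists_resMor_eq (res.{v, u} P N) (lindAug _)
  refine ⟨π, hπ, hC π ?_⟩
  change QuasiIso ((resMor.{v, u} (P := P) π).app (C.pt P))
  rw [hπ]
  exact isQuasiIso_lindAug _ _

/-- This is full faithfulness of derived restriction, relative to `K`. The induction of `res P N`
resolves `N`, its restriction resolves `res P N`, and between these two restriction is bijective on
homomorphisms. Other resolutions are reached by independence. -/
theorem isQuasiIsoMap_res_iff (hC : ∀ {N N' : DGModule.{v, u₁, u, u} C} (f : Morphism N N'),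
      QuasiIso (f.app P) → f.IsQuasiIso) {K : CochainComplex (ModuleCat.{u₃} k) ℤ}
    {N N' : DGModule.{v, u₁, u, u} C} (α : ∀ n : ℤ, K.X n →ₗ[k] homSubmodule N N' n)
    (hα : ∀ (i j : ℤ) (x : K.X i), hd N N' i j (α i x) = α j ((K.d i j).hom x))
    (S : HProjResolution N) (S' : HProjResolution (res.{v, u} P N)) :
    IsQuasiIsoMap (resolutionMap α S) ↔ IsQuasiIsoMap (resolutionMap (resFamily α) S') := by
  obtain ⟨π, hπ, hπ'⟩ := exists_lind_resolution hC N
  let S₁ : HProjResolution N := ⟨_, π, isHProjective_lind _, hπ'⟩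
  let S₂ : HProjResolution (res.{v, u} P N) :=
    ⟨_, resMor π, isHProjective_res_lind _, by rw [hπ]; exact isQuasiIso_lindAug _⟩
  have h₁ : IsQuasiIsoMap (resolutionMap (resFamily α) S₂) ↔ IsQuasiIsoMap (resolutionMap α S₁) :=
    isQuasiIsoMap_comp_iff (K := K) (L := homComplex S₁.P N') (L' := homComplex S₂.P (res P N'))
      (resolutionMap α S₁) (fun n => (resHom.{v, u} (P := P) : homSubmodule S₁.P N' n →ₗ[k] _))
      (fun _ => ⟨fun _ _ => resHom_lind_injective _, resHom_lind_surjective _⟩) (fun _ _ _ => rfl)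
  have h₂ (i j : ℤ) (x : K.X i) : hd (res.{v, u} P N) (res P N') i j (resFamily α i x) =
      resFamily α j ((K.d i j).hom x) := congrArg resHom (hα i j x)
  exact Iff.trans ⟨isQuasiIsoMap_of_resolution α hα S S₁, isQuasiIsoMap_of_resolution α hα S₁ S⟩
    (h₁.symm.trans ⟨isQuasiIsoMap_of_resolution _ h₂ S₂ S', isQuasiIsoMap_of_resolution _ h₂ S' S₂⟩)

end Lind

/-! ### Reflexivity -/

section Reflexive

variable {A : DGCat.{v, u, u} k} [Unique A.Obj] {M : DGModule.{v, u, u, u} A}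

/-- The resolution of a generator, as an object of `D_fd(A)`. -/
def HProjResolution.dfdObj (R : HProjResolution M) (hM : M.IsDfdGenerator) :
    (dfdOp A).Obj :=
  (⟨R.P, R.isHProjective, (hM _).1 (.of_quasiIso' R.π R.isQuasiIso (.of M rfl))⟩ : DfdObj A)

/-- Evaluation at the object of `A`, as a module over `D_fd(A)ᵒᵖ`. -/
abbrev evMod (A : DGCat.{v, u, u} k) [Unique A.Obj] :
    DGModule.{v, max v (u + 1), u, u} (dfdOp A) :=
  evalModule A (fun L : DfdObj.{v, u, u, u} A => L.1) default

variable (R : HProjResolution M) (hM : M.IsDfdGenerator)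

/-- The action of `A` on the module given by evaluation. -/
def evMap (n : ℤ) : (A.Hom default default).X n →ₗ[k] homSubmodule (evMod A) (evMod A) n :=
  evalMap A (fun L : DfdObj.{v, u, u, u} A => L.1) n

theorem hd_evMap (i j : ℤ) (x : (A.Hom default default).X i) :
    hd (evMod A) (evMod A) i j (evMap i x) = evMap j (((A.Hom default default).d i j).hom x) :=
  ((evalFunctor A (fun L : DfdObj.{v, u, u, u} A => L.1)).map_d (X := (default : A.Obj))
    (Y := (default : A.Obj)) i j x).symm

/-- The endomorphism algebra of the resolution inside `D_fd(A)ᵒᵖ` is definitionally the centraliser,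
and evaluation restricts to `R.overCentraliser`. -/
theorem isQuasiIsoMap_completionMap_iff
    (S : HProjResolution (res.{v, u} (R.dfdObj hM) (evMod A))) :
    IsQuasiIsoMap (resolutionMap (K := A.Hom default default) (resFamily evMap) S) ↔
    IsQuasiIsoMap (K := A.Hom default default) (L := homComplex _ R.overCentraliser)
      (R.completionMap S) :=
  Iff.rfl

include hM in
theorem isQuasiIso_of_dfdObj {N N' : DGModule.{v, max v (u + 1), u, u} (dfdOp A)}
    (f : Morphism N N') (hf : QuasiIso (f.app (R.dfdObj hM))) : f.IsQuasiIso :=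
  dfd_isQuasiIso (P := R.dfdObj hM) hM R.π R.isQuasiIso f hf

include hM in
/-- Evaluation is quasi-fully faithful if and only if the algebra is derived complete. -/
theorem isQuasiFullyFaithful_iff :
    DGFunctor.IsQuasiFullyFaithful (C := dfdOp A)
      (evalFunctor A (fun L : DfdObj.{v, u, u, u} A => L.1)) ↔ R.IsDerivedComplete := by
  -- One equivalence for every pair of resolutions, so that the resolution supplied by either
  -- hypothesis can be used.
  have key (S : HProjResolution (evMod A))
      (S' : HProjResolution (res.{v, u} (R.dfdObj hM) (evMod A))) :=
    (isQuasiIsoMap_res_iff (isQuasiIso_of_dfdObj R hM) (K := A.Hom default default)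
      (N := evMod A) (N' := evMod A) evMap
      hd_evMap S S').trans (isQuasiIsoMap_completionMap_iff R hM S')
  obtain ⟨π, -, hπ⟩ := exists_lind_resolution (isQuasiIso_of_dfdObj R hM) (evMod A)
  let S : HProjResolution (evMod A) := ⟨_, π, isHProjective_lind _, hπ⟩
  let S' : HProjResolution (res.{v, u} (R.dfdObj hM) (evMod A)) :=
    ⟨_, lindAug _, isHProjective_res_lind _, isQuasiIso_lindAug _⟩
  constructor
  · intro h
    obtain ⟨S₁, h₁⟩ := h (default : A.Obj)
    exact ⟨S', (key S₁ S').1 (h₁ (default : A.Obj))⟩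
  · rintro ⟨S₁, h₁⟩ a
    obtain rfl : (default : A.Obj) = a := Subsingleton.elim (α := A.Obj) _ _
    refine ⟨S, fun b => ?_⟩
    obtain rfl : (default : A.Obj) = b := Subsingleton.elim (α := A.Obj) _ _
    exact (key S S₁).2 h₁

include hM in
/-- Evaluation generates if and only if the resolution is a generator over the centraliser. -/
theorem generates_iff_isDfdGenerator :
    (∀ N : DGModule.{v, max v (u + 1), u, u} (dfdOp A), N.IsPerfectlyValued →
      Thick (fun L => ∃ a, L = (evalFunctor A (fun L : DfdObj.{v, u, u, u} A => L.1)).obj a) N) ↔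
      R.overCentraliser.IsDfdGenerator := by
  constructor
  · intro h T
    constructor
    · intro hT X
      refine Thick.of_isThickClass isThickClass_isPerfect ?_ hT
      rintro L rfl
      exact ((R.dfdObj hM : DfdObj A)).2.2 default
    · intro hT
      change DGModule.{v, u, u, u} ((dfdOp A).corner (R.dfdObj hM)) at T
      -- At the resolution of `M` the induced module is quasi-isomorphic to `T`, and finiteness
      -- spreads from there. Generation then applies to `lind T`, and restricting gives `T` back.
      have hN : (lind T).IsPerfectlyValued :=
        dfd_isPerfectlyValued (P := R.dfdObj hM) hM R.π R.isQuasiIso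
          (isThickClass_isPerfect.of_quasiIso' _
            (isQuasiIso_lindAug T ((dfdOp A).pt (R.dfdObj hM))) (hT _))
      refine Thick.of_quasiIso (lindAug T) (isQuasiIso_lindAug T)
        (Thick.res (R.dfdObj hM) ?_ (h _ hN))
      rintro L ⟨a, rfl⟩
      obtain rfl : (default : A.Obj) = a := Subsingleton.elim (α := A.Obj) _ _
      rfl
  · intro h N hN
    -- Conversely, `N` is recovered up to quasi-isomorphism as the induction of its restriction, and
    -- induction carries the thick subcategory of `M` into that of evaluation.
    let T : DGModule.{v, u, u, u} ((dfdOp A).corner (R.dfdObj hM)) := res (R.dfdObj hM) N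
    have hT : Thick (fun L => L = R.overCentraliser) T := (h T).2 fun X => hN (R.dfdObj hM)
    obtain ⟨g, hg⟩ := exists_lind_comparison (N := N) (T := T) (Morphism.id _)
      (fun X => inferInstanceAs (QuasiIso (𝟙 _)))
    refine Thick.of_quasiIso g (isQuasiIso_of_dfdObj R hM g hg)
      (thick_lind (isQuasiIso_of_dfdObj R hM) ?_ hT)
    rintro L rfl
    exact ⟨evMod A, ⟨(default : A.Obj), rfl⟩, rfl⟩

-- Evaluation always lands in perfectly valued modules, because the objects of `D_fd(A)` are
-- perfectly valued; so only full faithfulness and generation remain.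
include hM in
theorem isReflexive_iff :
    A.IsReflexive ↔ R.IsDerivedComplete ∧ R.overCentraliser.IsDfdGenerator := by
  rw [← isQuasiFullyFaithful_iff R hM, ← generates_iff_isDfdGenerator R hM]
  exact ⟨fun h => h.2, fun h => ⟨fun a L => L.2.2 a, h⟩⟩

end Reflexive

end DGModule

end

/-! ### The two-out-of-three theorem. -/

theorem mainTheorem2 {k : Type v} [Field k] (A : DGCat.{v, u, u} k) [Unique A.Obj]
    (M : DGModule.{v, u, u, u} A) (R : DGModule.HProjResolution M) (hM : M.IsDfdGenerator) :
    (A.IsReflexive ∧ R.overCentraliser.IsDfdGenerator → R.IsDerivedComplete) ∧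
    (A.IsReflexive ∧ R.IsDerivedComplete → R.overCentraliser.IsDfdGenerator) ∧
    (R.overCentraliser.IsDfdGenerator ∧ R.IsDerivedComplete → A.IsReflexive) := by
  rw [DGModule.isReflexive_iff R hM]
  exact ⟨fun h => h.1.1, fun h => h.1.2, fun h => ⟨h.2, h.1⟩⟩
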